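/- **Setting.** Let $d\ge 1$, $\Omega=[0,1)^d$, and let $a\in L_1(\mathbb R^d)$, $\mu\in L_\infty(\mathbb R^d\times\mathbb R^d)$ be real-valued functions such that, almost everywhere, $a\ge 0$, $a(-x)=a(x)$, $0<\mu_-\le\mu(x,y)\le\mu_+<\infty$, $\mu(x,y)=\mu(y,x)$ and $\mu(x+m,y+n)=\mu(x,y)$ for all $m,n\in\mathbb Z^d$; moreover $\operatorname{mes}\{a\ne0\}>0$ and $M_k(a)=\int_{\mathbb R^d}|x|^k a(x)\,dx<\infty$ for $k=1,2,3$. For $\xi\in\mathbb R^d$ put $$\widetilde a(\xi,z)=\sum_{n\in\mathbb Z^d}a(z+n)e^{-i\langle\xi,z+n\rangle},\qquad p(x)=\int_{\mathbb R^d}a(x-y)\mu(x,y)\,dy,$$ and let $\mathbb A(\xi)$ be the bounded operator in the complex space $L_2(\Omega)$ given by $$\mathbb A(\xi)u(x)=p(x)u(x)-\int_\Omega\widetilde a(\xi,x-y)\mu(x,y)u(y)\,dy .$$ Let $P$ be the orthogonal projection of $L_2(\Omega)$ onto the constant functions. **Constants.** Let $\hat A(y)=\int_{\mathbb R^d}(1-\cos\langle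 z,y\rangle)a(z)\,dz$, $\mathcal A_r(a)=\min_{|y|\ge r}\hat A(y)$, $\mathcal M(a)=\min_{|\theta|=1}\int_{\mathbb R^d}a(z)\langle z,\theta\rangle^2dz$, $r(a)=\frac32\mathcal M(a)M_3(a)^{-1}$, $$C(a)=\min\{\tfrac14\mathcal M(a),\ \mathcal A_{r(a)}(a)\pi^{-2}d^{-1},\ \mathcal A_\pi(a)\pi^{-2}d^{-1}\},$$ $$\delta_0(a,\mu)=\min\{1,\ 3^{-1}2^{-d}M_1(a)^{-1}\mu_+^{-1}\mu_-\mathcal A_\pi(a)\},\qquad d_0=\operatorname{dist}(0,\sigma(\mathbb A(0))\setminus\{0\}),$$ $$C_1(a,\mu)=6(\pi+2)\pi^{-1}2^d d_0^{-1}\mu_+M_1(a),$$ $$C_2(a,\mu)=\frac{\pi+2}{2\pi}\Big(\mu_+M_3+\frac{\mu_+^2}{d_0}(3M_2+M_3)(12M_1+3M_2+M_3)+\frac{\mu_+^3}{d_0^2}(6M_1+3M_2+M_3)^3\Big),\quad M_k=M_k(a),$$ $$S(a,\mu)=\frac{2C_1(a,\mu)}{(\mu_-C(a))^{1/2}}+\frac{C_2(a,\mu)}{(\mu_-C(a))^{3/2}}+\Big(\frac{2d_0}{3}\Big)^{-1/2}.$$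 **Theorem 2.2.** One has $\delta_0(a,\mu)>0$, $C(a)>0$ and $d_0\ge\mu_-\mathcal A_\pi(a)$. Consequently $S(a,\mu)$ does not exceed the expression obtained from it on replacing $d_0$ by $\mu_-\mathcal A_\pi(a)$, and this expression depends only on $d,\mu_-,\mu_+,M_1(a),M_2(a),M_3(a),\mathcal M(a),\mathcal A_\pi(a),\mathcal A_{r(a)}(a)$. For each $j=1,\dots,d$ there is an a.e. unique real-valued $\mathbb Z^d$-periodic function $v_j$, square integrable on $\Omega$, such that $$\int_{\mathbb R^d}a(x-y)\mu(x,y)(v_j(x)-v_j(y))\,dy=\int_{\mathbb R^d}a(x-y)\mu(x,y)(x_j-y_j)\,dy\ \text{ for a.e. }x\in\Omega,\qquad\int_\Omega v_j\,dx=0.$$ Put $$g_{ij}=\int_\Omega dx\int_{\mathbb R^d}dy\,\big((x_i-y_i)(x_j-y_j)-v_j(x)(x_i-y_i)-v_i(x)(x_j-y_j)\big)a(x-y)\mu(x,y).$$ Then for all $\varepsilon>0$ and all $\xi\in\mathbb R^d$ with $|\xi|\le\delta_0(a,\mu)$ the operator $\mathbb A(\xi)+\varepsilon^2I$ is invertible,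 $\frac12\sum_{i,j}g_{ij}\xi_i\xi_j+\varepsilon^2>0$, and $$\Big\|(\mathbb A(\xi)+\varepsilon^2I)^{-1}-\Big(\tfrac12\sum_{i,j=1}^d g_{ij}\xi_i\xi_j+\varepsilon^2\Big)^{-1}P\Big\|\le S(a,\mu)\,\varepsilon^{-1}.$$ -/

import Mathlib

open MeasureTheory
open scoped ENNReal NNReal

namespace NonlocalHom

/-! ### The lattice, the periodicity cell, and the space `L₂(Ω)` -/

/-- `ℝᵈ` with the Euclidean norm. -/
abbrev Rd (d : ℕ) : Type := EuclideanSpace ℝ (Fin d)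

/-- The point of `ℝᵈ` with integer coordinates `n`. -/
noncomputable def latt {d : ℕ} (n : Fin d → ℤ) : Rd d := WithLp.toLp 2 (fun i => (n i : ℝ))

/-- The periodicity cell `Ω = [0,1)ᵈ`. -/
def cell (d : ℕ) : Set (Rd d) := {x | ∀ i, x i ∈ Set.Ico (0 : ℝ) 1}

/-- Lebesgue measure on `Ω`. -/
noncomputable abbrev cellMeasure (d : ℕ) : Measure (Rd d) := volume.restrict (cell d)

/-- The complex Hilbert space `L₂(Ω)`. -/
abbrev L2cell (d : ℕ) : Type := Lp ℂ 2 (cellMeasure d)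

lemma measurableSet_cell (d : ℕ) : MeasurableSet (cell d) := by
  have : cell d = ⋂ i : Fin d, (fun x : Rd d => x i) ⁻¹' Set.Ico (0 : ℝ) 1 := by
    ext x; simp [cell]
  rw [this]
  refine MeasurableSet.iInter fun i => ?_
  exact measurableSet_Ico.preimage (by fun_prop)

lemma volume_cell (d : ℕ) : volume (cell d) = 1 := by
  have h := (PiLp.volume_preserving_ofLp (Fin d)).measure_preimage
    (s := Set.pi Set.univ fun _ : Fin d => Set.Ico (0 : ℝ) 1)
    (MeasurableSet.univ_pi fun _ => measurableSet_Ico).nullMeasurableSet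
  rw [Real.volume_pi_Ico] at h
  have e : cell d = (WithLp.ofLp : Rd d → (Fin d → ℝ)) ⁻¹'
      (Set.pi Set.univ fun _ : Fin d => Set.Ico (0 : ℝ) 1) := by
    ext x; simp [cell]
  rw [e, h]; simp

instance isProbabilityMeasure_cellMeasure (d : ℕ) : IsProbabilityMeasure (cellMeasure d) :=
  ⟨by rw [Measure.restrict_apply_univ, volume_cell]⟩

/-- Every integrable quantity on `ℝᵈ` is obtained by summing over the translates of the cell. -/
lemma tsum_lintegral_cell {d : ℕ} (f : Rd d → ℝ≥0∞) :
    ∑' n : Fin d → ℤ, ∫⁻ y in cell d, f (y + latt n) = ∫⁻ y, f y := by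
  have hcov : (⋃ n : Fin d → ℤ, (fun y : Rd d => y - latt n) ⁻¹' cell d) = Set.univ := by
    refine Set.eq_univ_of_forall fun x => Set.mem_iUnion.2 ⟨fun i => ⌊x i⌋, ?_⟩
    intro i
    simp only [latt, PiLp.sub_apply]
    exact ⟨Int.fract_nonneg _, Int.fract_lt_one _⟩
  have hdisj : Pairwise (Function.onFun Disjoint
      fun n : Fin d → ℤ => (fun y : Rd d => y - latt n) ⁻¹' cell d) := by
    intro m n hmn
    rw [Function.onFun, Set.disjoint_left]
    intro x hm hn
    apply hmn
    funext i
    have h1 := hm i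
    have h2 := hn i
    simp only [latt, PiLp.sub_apply, Set.mem_Ico] at h1 h2
    have e1 : ⌊x i⌋ = m i := Int.floor_eq_iff.2 ⟨by linarith, by linarith⟩
    have e2 : ⌊x i⌋ = n i := Int.floor_eq_iff.2 ⟨by linarith, by linarith⟩
    exact e1.symm.trans e2
  rw [← setLIntegral_univ f, ← hcov, lintegral_iUnion
    (fun n => (measurableSet_cell d).preimage (by fun_prop)) hdisj]
  refine tsum_congr fun n => ?_
  have := (measurePreserving_add_right (volume : Measure (Rd d)) (latt n)).setLIntegral_comp_preimage_emb
    (MeasurableEquiv.addRight (latt n)).measurableEmbedding f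
    ((fun y : Rd d => y - latt n) ⁻¹' cell d)
  rw [← this]
  congr 2
  ext x; simp

/-! ### Bounded operators in `L₂` given by a pointwise formula -/

lemma memLp_of_formula {α : Type*} [MeasurableSpace α] {ν : Measure α}
    (T : (α → ℂ) → α → ℂ) (C : ℝ≥0)
    (hmeas : ∀ u, MemLp u 2 ν → AEStronglyMeasurable (T u) ν)
    (hbd : ∀ u, MemLp u 2 ν → eLpNorm (T u) 2 ν ≤ C * eLpNorm u 2 ν)
    {u : α → ℂ} (hu : MemLp u 2 ν) : MemLp (T u) 2 ν :=
  ⟨hmeas u hu, (hbd u hu).trans_lt (ENNReal.mul_lt_top ENNReal.coe_lt_top hu.2)⟩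

/-- The bounded operator in `L₂(ν)` that sends `u` to the class of `T u`. -/
noncomputable def opOfFormula {α : Type*} [MeasurableSpace α] {ν : Measure α}
    (T : (α → ℂ) → α → ℂ) (C : ℝ≥0)
    (hmeas : ∀ u, MemLp u 2 ν → AEStronglyMeasurable (T u) ν)
    (hbd : ∀ u, MemLp u 2 ν → eLpNorm (T u) 2 ν ≤ C * eLpNorm u 2 ν)
    (hcongr : ∀ u v, u =ᵐ[ν] v → T u =ᵐ[ν] T v)
    (hadd : ∀ u v, MemLp u 2 ν → MemLp v 2 ν → T (u + v) =ᵐ[ν] T u + T v)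
    (hsmul : ∀ (c : ℂ) u, MemLp u 2 ν → T (c • u) =ᵐ[ν] c • T u) :
    Lp ℂ 2 ν →L[ℂ] Lp ℂ 2 ν :=
  LinearMap.mkContinuous
    { toFun := fun u => (memLp_of_formula T C hmeas hbd (Lp.memLp u)).toLp (T u)
      map_add' := fun u v => by
        rw [← MemLp.toLp_add]
        exact MemLp.toLp_congr _ _
          ((hcongr _ _ (Lp.coeFn_add u v)).trans (hadd u v (Lp.memLp u) (Lp.memLp v)))
      map_smul' := fun c u => by
        rw [RingHom.id_apply, ← MemLp.toLp_const_smul]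
        exact MemLp.toLp_congr _ _
          ((hcongr _ _ (Lp.coeFn_smul c u)).trans (hsmul c u (Lp.memLp u))) }
    C
    (fun u => by
      have h := ENNReal.toReal_mono
        (ENNReal.mul_lt_top ENNReal.coe_lt_top (Lp.memLp u).2).ne (hbd u (Lp.memLp u))
      rw [ENNReal.toReal_mul, ENNReal.coe_toReal] at h
      rw [LinearMap.coe_mk, AddHom.coe_mk, Lp.norm_toLp, Lp.norm_def]
      exact h)

lemma opOfFormula_ae {α : Type*} [MeasurableSpace α] {ν : Measure α}
    {T : (α → ℂ) → α → ℂ} {C : ℝ≥0} {hmeas} {hbd} {hcongr} {hadd} {hsmul} (u : Lp ℂ 2 ν) :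
    opOfFormula (ν := ν) T C hmeas hbd hcongr hadd hsmul u =ᵐ[ν] T u :=
  MemLp.coeFn_toLp (memLp_of_formula T C hmeas hbd (Lp.memLp u))

section Schur

variable {α : Type*} [MeasurableSpace α] {ν : Measure α} [SFinite ν] {k : α → α → ℂ} {C : ℝ≥0}

lemma schur_lintegral
    (hk : AEStronglyMeasurable (Function.uncurry k) (ν.prod ν))
    (h1 : ∀ᵐ x ∂ν, ∫⁻ y, ‖k x y‖ₑ ∂ν ≤ C) (h2 : ∀ᵐ y ∂ν, ∫⁻ x, ‖k x y‖ₑ ∂ν ≤ C)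
    {u : α → ℂ} (hu : AEStronglyMeasurable u ν) :
    ∫⁻ x, (∫⁻ y, ‖k x y‖ₑ * ‖u y‖ₑ ∂ν) ^ (2 : ℝ) ∂ν ≤ (C : ℝ≥0∞) ^ (2 : ℝ) * ∫⁻ y, ‖u y‖ₑ ^ (2 : ℝ) ∂ν := by
  have hkx : ∀ᵐ x ∂ν, AEStronglyMeasurable (k x) ν := hk.prodMk_left
  have hprod : AEMeasurable (Function.uncurry fun x y => ‖k x y‖ₑ * ‖u y‖ₑ ^ (2 : ℝ)) (ν.prod ν) :=
    hk.enorm.mul ((hu.comp_snd (μ := ν)).enorm.pow_const _)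
  calc ∫⁻ x, (∫⁻ y, ‖k x y‖ₑ * ‖u y‖ₑ ∂ν) ^ (2 : ℝ) ∂ν
      ≤ ∫⁻ x, C * ∫⁻ y, ‖k x y‖ₑ * ‖u y‖ₑ ^ (2 : ℝ) ∂ν ∂ν := by
        refine lintegral_mono_ae ?_
        filter_upwards [hkx, h1] with x hx hC
        have hold := ENNReal.lintegral_mul_le_Lp_mul_Lq ν Real.HolderConjugate.two_two
          (f := fun y => ‖k x y‖ₑ ^ (1 / 2 : ℝ)) (g := fun y => ‖k x y‖ₑ ^ (1 / 2 : ℝ) * ‖u y‖ₑ)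
          (hx.enorm.pow_const _) ((hx.enorm.pow_const _).mul hu.enorm)
        have e1 : ∀ y, ‖k x y‖ₑ ^ (1 / 2 : ℝ) * (‖k x y‖ₑ ^ (1 / 2 : ℝ) * ‖u y‖ₑ)
            = ‖k x y‖ₑ * ‖u y‖ₑ := fun y => by
          rw [← mul_assoc, ← ENNReal.rpow_add_of_nonneg _ _ (by norm_num) (by norm_num)]
          norm_num
        have e2 : ∀ y, (‖k x y‖ₑ ^ (1 / 2 : ℝ)) ^ (2 : ℝ) = ‖k x y‖ₑ := fun y => by
          rw [← ENNReal.rpow_mul]; norm_num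
        have e3 : ∀ y, (‖k x y‖ₑ ^ (1 / 2 : ℝ) * ‖u y‖ₑ) ^ (2 : ℝ)
            = ‖k x y‖ₑ * ‖u y‖ₑ ^ (2 : ℝ) := fun y => by
          rw [ENNReal.mul_rpow_of_nonneg _ _ (by norm_num), e2]
        simp only [Pi.mul_apply, e1, e2, e3] at hold
        calc (∫⁻ y, ‖k x y‖ₑ * ‖u y‖ₑ ∂ν) ^ (2 : ℝ)
            ≤ ((∫⁻ y, ‖k x y‖ₑ ∂ν) ^ (1 / 2 : ℝ) *
                (∫⁻ y, ‖k x y‖ₑ * ‖u y‖ₑ ^ (2 : ℝ) ∂ν) ^ (1 / 2 : ℝ)) ^ (2 : ℝ) :=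
              ENNReal.rpow_le_rpow hold (by norm_num)
          _ = (∫⁻ y, ‖k x y‖ₑ ∂ν) * ∫⁻ y, ‖k x y‖ₑ * ‖u y‖ₑ ^ (2 : ℝ) ∂ν := by
              rw [ENNReal.mul_rpow_of_nonneg _ _ (by norm_num), ← ENNReal.rpow_mul,
                ← ENNReal.rpow_mul]
              norm_num
          _ ≤ _ := by gcongr
    _ = C * ∫⁻ x, ∫⁻ y, ‖k x y‖ₑ * ‖u y‖ₑ ^ (2 : ℝ) ∂ν ∂ν :=
        lintegral_const_mul' _ _ ENNReal.coe_ne_top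
    _ = C * ∫⁻ y, ∫⁻ x, ‖k x y‖ₑ * ‖u y‖ₑ ^ (2 : ℝ) ∂ν ∂ν := by
        rw [lintegral_lintegral_swap hprod]
    _ ≤ C * ∫⁻ y, C * ‖u y‖ₑ ^ (2 : ℝ) ∂ν := by
        refine mul_le_mul' le_rfl (lintegral_mono_ae ?_)
        have hky : ∀ᵐ y ∂ν, AEStronglyMeasurable (fun x => k x y) ν := hk.prod_swap.prodMk_left
        filter_upwards [h2, hky] with y hy hky
        rw [lintegral_mul_const'' _ hky.enorm]
        gcongr
    _ = _ := by
        rw [lintegral_const_mul' _ _ ENNReal.coe_ne_top, ← mul_assoc]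
        congr 1
        rw [show (2 : ℝ) = 1 + 1 by norm_num,
          ENNReal.rpow_add_of_nonneg _ _ (by norm_num) (by norm_num), ENNReal.rpow_one]

lemma schur_bound
    (hk : AEStronglyMeasurable (Function.uncurry k) (ν.prod ν))
    (h1 : ∀ᵐ x ∂ν, ∫⁻ y, ‖k x y‖ₑ ∂ν ≤ C) (h2 : ∀ᵐ y ∂ν, ∫⁻ x, ‖k x y‖ₑ ∂ν ≤ C)
    {u : α → ℂ} (hu : AEStronglyMeasurable u ν) :
    eLpNorm (fun x => ∫ y, k x y * u y ∂ν) 2 ν ≤ C * eLpNorm u 2 ν := by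
  rw [eLpNorm_eq_lintegral_rpow_enorm_toReal (by norm_num) (by norm_num),
    eLpNorm_eq_lintegral_rpow_enorm_toReal (by norm_num) (by norm_num)]
  simp only [ENNReal.toReal_ofNat]
  have h := schur_lintegral hk h1 h2 hu
  have h' : ∫⁻ x, ‖∫ y, k x y * u y ∂ν‖ₑ ^ (2 : ℝ) ∂ν
      ≤ (C : ℝ≥0∞) ^ (2 : ℝ) * ∫⁻ y, ‖u y‖ₑ ^ (2 : ℝ) ∂ν := by
    refine le_trans (lintegral_mono fun x => ?_) h
    refine ENNReal.rpow_le_rpow ?_ (by norm_num)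
    refine (enorm_integral_le_lintegral_enorm _).trans_eq ?_
    simp only [enorm_mul]
  refine (ENNReal.rpow_le_rpow h' (by norm_num : (0 : ℝ) ≤ 1 / 2)).trans_eq ?_
  rw [ENNReal.mul_rpow_of_nonneg _ _ (by norm_num), ← ENNReal.rpow_mul]
  norm_num

lemma schur_integrable
    (hk : AEStronglyMeasurable (Function.uncurry k) (ν.prod ν))
    (h1 : ∀ᵐ x ∂ν, ∫⁻ y, ‖k x y‖ₑ ∂ν ≤ C) (h2 : ∀ᵐ y ∂ν, ∫⁻ x, ‖k x y‖ₑ ∂ν ≤ C)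
    {u : α → ℂ} (hu : MemLp u 2 ν) : ∀ᵐ x ∂ν, Integrable (fun y => k x y * u y) ν := by
  have h := schur_lintegral hk h1 h2 hu.1
  have hfin : ∫⁻ y, ‖u y‖ₑ ^ (2 : ℝ) ∂ν < ∞ := by
    simpa using lintegral_rpow_enorm_lt_top_of_eLpNorm_lt_top
      (by norm_num) (by norm_num) hu.2
  have hm : AEMeasurable (fun x => (∫⁻ y, ‖k x y‖ₑ * ‖u y‖ₑ ∂ν) ^ (2 : ℝ)) ν :=
    AEMeasurable.pow_const (AEMeasurable.lintegral_prod_right'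
      (f := fun z : α × α => ‖k z.1 z.2‖ₑ * ‖u z.2‖ₑ)
      (hk.enorm.mul (hu.1.comp_snd (μ := ν)).enorm)) _
  have hlt := ae_lt_top' hm (h.trans_lt (ENNReal.mul_lt_top (by simp) hfin)).ne
  filter_upwards [hlt, hk.prodMk_left] with x hx hkx
  refine ⟨hkx.mul hu.1, ?_⟩
  rw [HasFiniteIntegral]
  simp only [enorm_mul]
  by_contra hcon
  rw [not_lt, top_le_iff] at hcon
  rw [hcon] at hx
  simp at hx

/-- The bounded integral operator in `L₂(ν)` with kernel `k`. -/
noncomputable def integralOp (k : α → α → ℂ) (C : ℝ≥0)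
    (hk : AEStronglyMeasurable (Function.uncurry k) (ν.prod ν))
    (h1 : ∀ᵐ x ∂ν, ∫⁻ y, ‖k x y‖ₑ ∂ν ≤ C) (h2 : ∀ᵐ y ∂ν, ∫⁻ x, ‖k x y‖ₑ ∂ν ≤ C) :
    Lp ℂ 2 ν →L[ℂ] Lp ℂ 2 ν :=
  opOfFormula (fun u x => ∫ y, k x y * u y ∂ν) C
    (fun _ hu => (hk.mul (hu.1.comp_snd (μ := ν))).integral_prod_right')
    (fun _ hu => schur_bound hk h1 h2 hu.1)
    (fun u v huv => Filter.Eventually.of_forall fun x => by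
      refine integral_congr_ae ?_
      filter_upwards [huv] with y hy
      rw [hy])
    (fun u v hu hv => by
      filter_upwards [schur_integrable hk h1 h2 hu, schur_integrable hk h1 h2 hv] with x h3 h4
      simp only [Pi.add_apply, mul_add]
      exact integral_add h3 h4)
    (fun c u _ => Filter.Eventually.of_forall fun x => by
      simp only [Pi.smul_apply, smul_eq_mul, mul_left_comm _ c]
      exact integral_const_mul _ _)

end Schur

/-- The operator of multiplication by a bounded function in `L₂(ν)`. -/
noncomputable def multOp {α : Type*} [MeasurableSpace α] {ν : Measure α} (p : α → ℂ) (C : ℝ≥0)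
    (hp : AEStronglyMeasurable p ν) (hC : ∀ᵐ x ∂ν, ‖p x‖ ≤ C) : Lp ℂ 2 ν →L[ℂ] Lp ℂ 2 ν :=
  opOfFormula (fun u x => p x * u x) C
    (fun _ hu => hp.mul hu.1)
    (fun u _ => by
      have := eLpNorm_le_nnreal_smul_eLpNorm_of_ae_le_mul (f := fun x => p x * u x) (g := u)
        (c := C) (μ := ν) (by
          filter_upwards [hC] with x hx
          rw [nnnorm_mul]
          gcongr
          exact_mod_cast hx) 2
      simpa [ENNReal.smul_def] using this)
    (fun u v huv => by
      filter_upwards [huv] with y hy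
      rw [hy])
    (fun u v _ _ => Filter.Eventually.of_forall fun x => by simp [mul_add])
    (fun c u _ => Filter.Eventually.of_forall fun x => by simp [mul_left_comm])

/-! ### The coefficients -/

/-- The coefficients of the nonlocal operator and the standing assumptions on them.  Since `a` and
`μ` are elements of `L₁` and `L_∞`, the pointwise conditions are required almost everywhere. -/
structure Coefficients (d : ℕ) where
  /-- the jump kernel -/
  a : Rd d → ℝ
  /-- the periodic environment -/
  mu : Rd d → Rd d → ℝ
  /-- the lower bound of `mu` -/
  muMinus : ℝ
  /-- the upper bound of `mu` -/
  muPlus : ℝ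
  a_integrable : Integrable a
  a_nontrivial : 0 < volume {x | a x ≠ 0}
  a_nonneg : ∀ᵐ x, 0 ≤ a x
  a_even : ∀ᵐ x, a (-x) = a x
  mu_measurable : AEStronglyMeasurable (fun z : Rd d × Rd d => mu z.1 z.2) volume
  muMinus_pos : 0 < muMinus
  mu_bounds : ∀ᵐ z : Rd d × Rd d, muMinus ≤ mu z.1 z.2 ∧ mu z.1 z.2 ≤ muPlus
  mu_symm : ∀ᵐ z : Rd d × Rd d, mu z.1 z.2 = mu z.2 z.1
  mu_periodic : ∀ m n : Fin d → ℤ, ∀ᵐ z : Rd d × Rd d,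
    mu (z.1 + latt m) (z.2 + latt n) = mu z.1 z.2
  moment_integrable : ∀ k ∈ ({1, 2, 3} : Finset ℕ), Integrable fun x => ‖x‖ ^ k * a x

namespace Coefficients

variable {d : ℕ} (c : Coefficients d)

/-! ### The fiber operators -/

/-- The potential `p(x) = ∫ a(x-y) μ(x,y) dy`. -/
noncomputable def potential (x : Rd d) : ℝ := ∫ y, c.a (x - y) * c.mu x y

/-- `ã(ξ,z) = ∑ₙ a(z+n) exp(-i⟨ξ, z+n⟩)`, the sum being over `n ∈ ℤᵈ`. -/
noncomputable def aTilde (ξ z : Rd d) : ℂ :=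
  ∑' n : Fin d → ℤ, (c.a (z + latt n) : ℂ) * Complex.exp (-Complex.I * (inner ℝ ξ (z + latt n) : ℝ))

/-- The kernel `ã(ξ,x-y) μ(x,y)` of the operator `𝔹(ξ)`. -/
noncomputable def fiberKernel (ξ x y : Rd d) : ℂ := c.aTilde ξ (x - y) * (c.mu x y : ℂ)

/-- A bound for the potential and for the Schur norm of the kernels. -/
noncomputable def schurConst : ℝ≥0 := Real.toNNReal c.muPlus * (∫⁻ z, ‖c.a z‖ₑ).toNNReal

lemma lintegral_a_ne_top : ∫⁻ z, ‖c.a z‖ₑ ≠ ∞ := c.a_integrable.2.ne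

lemma coe_schurConst :
    (c.schurConst : ℝ≥0∞) = (∫⁻ z, ‖c.a z‖ₑ) * ENNReal.ofReal c.muPlus := by
  rw [schurConst, ENNReal.coe_mul, ENNReal.coe_toNNReal c.lintegral_a_ne_top, mul_comm]
  rfl

lemma mu_enorm_le : ∀ᵐ z : Rd d × Rd d, ‖c.mu z.1 z.2‖ₑ ≤ ENNReal.ofReal c.muPlus := by
  filter_upwards [c.mu_bounds] with z hz
  rw [Real.enorm_eq_ofReal (c.muMinus_pos.le.trans hz.1)]
  exact ENNReal.ofReal_le_ofReal hz.2

lemma aestronglyMeasurable_a_sub (s : Rd d) :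
    AEStronglyMeasurable (fun z : Rd d × Rd d => c.a (z.1 - z.2 + s)) (volume.prod volume) := by
  have h1 : AEStronglyMeasurable (fun x : Rd d => c.a (x + s)) volume :=
    c.a_integrable.1.comp_quasiMeasurePreserving
      (measurePreserving_add_right volume s).quasiMeasurePreserving
  exact h1.comp_quasiMeasurePreserving (quasiMeasurePreserving_sub volume volume)

lemma prod_cellMeasure_ac :
    (cellMeasure d).prod (cellMeasure d) ≪ (volume : Measure (Rd d)).prod volume := by
  rw [Measure.prod_restrict]
  exact Measure.restrict_le_self.absolutelyContinuous

lemma prod_cellMeasure_ac' :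
    (cellMeasure d).prod (volume : Measure (Rd d)) ≪ (volume : Measure (Rd d)).prod volume :=
  Measure.AbsolutelyContinuous.prod
    (Measure.absolutelyContinuous_of_le
      (Measure.restrict_le_self (μ := (volume : Measure (Rd d))) (s := cell d)))
    Measure.AbsolutelyContinuous.rfl

lemma lintegral_sub_cell (x : Rd d) :
    ∫⁻ y in cell d, ∑' n : Fin d → ℤ, ‖c.a (x - y + latt n)‖ₑ = ∫⁻ z, ‖c.a z‖ₑ := by
  have hm : ∀ n : Fin d → ℤ, AEMeasurable (fun y => ‖c.a (x - y + latt n)‖ₑ) (cellMeasure d) := by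
    intro n
    have h1 : AEStronglyMeasurable (fun z : Rd d => c.a (z + latt n)) volume :=
      c.a_integrable.1.comp_quasiMeasurePreserving
        (measurePreserving_add_right volume _).quasiMeasurePreserving
    exact (h1.comp_quasiMeasurePreserving
      (quasiMeasurePreserving_sub_left volume x)).restrict.enorm
  rw [lintegral_tsum hm]
  have hneg : ∀ n : Fin d → ℤ, latt (-n) = -(latt n : Rd d) := by
    intro n; ext i; simp [latt]
  rw [← (Equiv.neg (Fin d → ℤ)).tsum_eq]
  have := tsum_lintegral_cell (fun y => ‖c.a (x - y)‖ₑ)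
  simp only [Equiv.neg_apply, hneg]
  simp only [sub_add_eq_sub_sub] at this
  simp only [← sub_eq_add_neg]
  rw [this]
  exact lintegral_sub_left_eq_self (fun z => ‖c.a z‖ₑ) x

lemma lintegral_sub_cell' (y : Rd d) :
    ∫⁻ x in cell d, ∑' n : Fin d → ℤ, ‖c.a (x - y + latt n)‖ₑ = ∫⁻ z, ‖c.a z‖ₑ := by
  have hm : ∀ n : Fin d → ℤ, AEMeasurable (fun x => ‖c.a (x - y + latt n)‖ₑ) (cellMeasure d) := by
    intro n
    have h1 : AEStronglyMeasurable (fun z : Rd d => c.a (z + latt n)) volume :=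
      c.a_integrable.1.comp_quasiMeasurePreserving
        (measurePreserving_add_right volume _).quasiMeasurePreserving
    exact (h1.comp_quasiMeasurePreserving
      (measurePreserving_sub_right volume y).quasiMeasurePreserving).restrict.enorm
  rw [lintegral_tsum hm]
  have := tsum_lintegral_cell (fun x => ‖c.a (x - y)‖ₑ)
  simp only [add_sub_right_comm] at this
  rw [this]
  exact lintegral_sub_right_eq_self (fun z => ‖c.a z‖ₑ) y

lemma enorm_term (ξ z : Rd d) :
    ‖(c.a z : ℂ) * Complex.exp (-Complex.I * (inner ℝ ξ z : ℝ))‖ₑ = ‖c.a z‖ₑ := by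
  rw [enorm_mul]
  have : ‖Complex.exp (-Complex.I * (inner ℝ ξ z : ℝ))‖ₑ = 1 := by
    rw [← ofReal_norm, Complex.norm_exp]; simp
  rw [this, mul_one, ← ofReal_norm, ← ofReal_norm, Complex.norm_real]

lemma enorm_aTilde_le (ξ z : Rd d) :
    ‖c.aTilde ξ z‖ₑ ≤ ∑' n : Fin d → ℤ, ‖c.a (z + latt n)‖ₑ := by
  refine enorm_tsum_le_tsum_enorm.trans_eq (tsum_congr fun n => c.enorm_term ξ _)

lemma fiberKernel_measurable (ξ : Rd d) :
    AEStronglyMeasurable (Function.uncurry (c.fiberKernel ξ))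
      ((cellMeasure d).prod (cellMeasure d)) := by
  have hmu : AEStronglyMeasurable (fun z : Rd d × Rd d => (c.mu z.1 z.2 : ℂ))
      ((cellMeasure d).prod (cellMeasure d)) :=
    Complex.continuous_ofReal.comp_aestronglyMeasurable
      (c.mu_measurable.mono_ac prod_cellMeasure_ac)
  have hterm : ∀ n : Fin d → ℤ, AEStronglyMeasurable (fun z : Rd d × Rd d =>
      (c.a (z.1 - z.2 + latt n) : ℂ) *
        Complex.exp (-Complex.I * (inner ℝ ξ (z.1 - z.2 + latt n) : ℝ)))
      ((cellMeasure d).prod (cellMeasure d)) := by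
    intro n
    refine AEStronglyMeasurable.mul (Complex.continuous_ofReal.comp_aestronglyMeasurable
      ((c.aestronglyMeasurable_a_sub _).mono_ac prod_cellMeasure_ac)) ?_
    exact Continuous.aestronglyMeasurable (by fun_prop)
  have hfin : ∀ᵐ z ∂((cellMeasure d).prod (cellMeasure d)),
      ∑' n : Fin d → ℤ, ‖c.a (z.1 - z.2 + latt n)‖ₑ < ∞ := by
    have hm : AEMeasurable (fun z : Rd d × Rd d => ∑' n : Fin d → ℤ, ‖c.a (z.1 - z.2 + latt n)‖ₑ)
        ((cellMeasure d).prod (cellMeasure d)) :=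
      AEMeasurable.tsum fun n =>
        ((c.aestronglyMeasurable_a_sub _).mono_ac prod_cellMeasure_ac).enorm
    refine ae_lt_top' hm ?_
    rw [lintegral_prod _ hm]
    simp only [lintegral_sub_cell]
    simpa using c.lintegral_a_ne_top
  have hsum : ∀ s : Finset (Fin d → ℤ), AEStronglyMeasurable (fun z : Rd d × Rd d =>
      ∑ n ∈ s, (c.a (z.1 - z.2 + latt n) : ℂ) *
        Complex.exp (-Complex.I * (inner ℝ ξ (z.1 - z.2 + latt n) : ℝ)))
      ((cellMeasure d).prod (cellMeasure d)) := by
    intro s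
    induction s using Finset.induction_on with
    | empty => simpa using aestronglyMeasurable_const
    | insert n s hn ih =>
      simp only [Finset.sum_insert hn]
      exact (hterm n).add ih
  have hA : AEStronglyMeasurable (fun z : Rd d × Rd d => c.aTilde ξ (z.1 - z.2))
      ((cellMeasure d).prod (cellMeasure d)) := by
    refine aestronglyMeasurable_of_tendsto_ae (Filter.atTop : Filter (Finset (Fin d → ℤ)))
      hsum ?_
    filter_upwards [hfin] with z hz
    have : Summable fun n : Fin d → ℤ => (c.a (z.1 - z.2 + latt n) : ℂ) *
        Complex.exp (-Complex.I * (inner ℝ ξ (z.1 - z.2 + latt n) : ℝ)) := by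
      refine Summable.of_enorm ?_
      simp only [enorm_term]
      exact hz.ne
    exact this.hasSum
  have h := hA.mul hmu
  exact h

lemma fiberKernel_bound_left (ξ : Rd d) :
    ∀ᵐ x ∂(cellMeasure d), ∫⁻ y, ‖c.fiberKernel ξ x y‖ₑ ∂(cellMeasure d) ≤ c.schurConst := by
  have hmu := Measure.ae_ae_of_ae_prod (prod_cellMeasure_ac.ae_le c.mu_enorm_le)
  filter_upwards [hmu] with x hx
  calc ∫⁻ y, ‖c.fiberKernel ξ x y‖ₑ ∂(cellMeasure d)
      ≤ ∫⁻ y, (∑' n : Fin d → ℤ, ‖c.a (x - y + latt n)‖ₑ) * ENNReal.ofReal c.muPlus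
          ∂(cellMeasure d) := by
        refine lintegral_mono_ae ?_
        filter_upwards [hx] with y hy
        rw [fiberKernel, enorm_mul]
        refine mul_le_mul' (c.enorm_aTilde_le ξ _) ?_
        simpa [← ofReal_norm, Complex.norm_real] using hy
    _ = c.schurConst := by
        rw [lintegral_mul_const' _ _ ENNReal.ofReal_ne_top, lintegral_sub_cell, coe_schurConst]

lemma fiberKernel_bound_right (ξ : Rd d) :
    ∀ᵐ y ∂(cellMeasure d), ∫⁻ x, ‖c.fiberKernel ξ x y‖ₑ ∂(cellMeasure d) ≤ c.schurConst := by
  have hmu := Measure.ae_ae_of_ae_prod (Measure.measurePreserving_swap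
    (μ := cellMeasure d) (ν := cellMeasure d) |>.quasiMeasurePreserving.ae
      (prod_cellMeasure_ac.ae_le c.mu_enorm_le))
  filter_upwards [hmu] with y hy
  calc ∫⁻ x, ‖c.fiberKernel ξ x y‖ₑ ∂(cellMeasure d)
      ≤ ∫⁻ x, (∑' n : Fin d → ℤ, ‖c.a (x - y + latt n)‖ₑ) * ENNReal.ofReal c.muPlus
          ∂(cellMeasure d) := by
        refine lintegral_mono_ae ?_
        filter_upwards [hy] with x hx
        rw [fiberKernel, enorm_mul]
        refine mul_le_mul' (c.enorm_aTilde_le ξ _) ?_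
        simpa [← ofReal_norm, Complex.norm_real] using hx
    _ = c.schurConst := by
        rw [lintegral_mul_const' _ _ ENNReal.ofReal_ne_top, lintegral_sub_cell', coe_schurConst]

lemma potential_measurable :
    AEStronglyMeasurable (fun x => (c.potential x : ℂ)) (cellMeasure d) := by
  have h := (c.aestronglyMeasurable_a_sub 0).mul c.mu_measurable
  simp only [add_zero] at h
  exact Complex.continuous_ofReal.comp_aestronglyMeasurable
    (AEStronglyMeasurable.integral_prod_right' h).restrict

lemma potential_bound : ∀ᵐ x ∂(cellMeasure d), ‖(c.potential x : ℂ)‖ ≤ c.schurConst := by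
  have hmu := Measure.ae_ae_of_ae_prod (prod_cellMeasure_ac'.ae_le c.mu_enorm_le)
  filter_upwards [hmu] with x hx
  have h : ‖c.potential x‖ₑ ≤ c.schurConst := by
    calc ‖c.potential x‖ₑ ≤ ∫⁻ y, ‖c.a (x - y) * c.mu x y‖ₑ :=
          enorm_integral_le_lintegral_enorm _
      _ ≤ ∫⁻ y, ‖c.a (x - y)‖ₑ * ENNReal.ofReal c.muPlus := by
          refine lintegral_mono_ae ?_
          filter_upwards [hx] with y hy
          rw [enorm_mul]
          gcongr
      _ = c.schurConst := by
          rw [lintegral_mul_const' _ _ ENNReal.ofReal_ne_top,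
            lintegral_sub_left_eq_self (fun z => ‖c.a z‖ₑ) x, coe_schurConst]
  rw [Complex.norm_real]
  exact_mod_cast h

/-- The operator `𝔹(ξ)` in `L₂(Ω)`. -/
noncomputable def fiberB (ξ : Rd d) : L2cell d →L[ℂ] L2cell d :=
  integralOp (c.fiberKernel ξ) c.schurConst (c.fiberKernel_measurable ξ)
    (c.fiberKernel_bound_left ξ) (c.fiberKernel_bound_right ξ)

/-- The fiber operator `𝔸(ξ) = p - 𝔹(ξ)` in `L₂(Ω)`. -/
noncomputable def fiberA (ξ : Rd d) : L2cell d →L[ℂ] L2cell d :=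
  multOp (fun x => (c.potential x : ℂ)) c.schurConst c.potential_measurable c.potential_bound
    - c.fiberB ξ

/-- The action of `𝔸(ξ)`, pointwise almost everywhere on `Ω`. -/
lemma fiberA_ae (ξ : Rd d) (u : L2cell d) :
    ∀ᵐ x ∂(cellMeasure d), c.fiberA ξ u x = (c.potential x : ℂ) * u x
      - ∫ y in cell d, c.aTilde ξ (x - y) * (c.mu x y : ℂ) * u y := by
  have h1 : multOp (fun x => (c.potential x : ℂ)) c.schurConst c.potential_measurable
      c.potential_bound u =ᵐ[cellMeasure d] fun x => (c.potential x : ℂ) * u x :=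
    opOfFormula_ae u
  have h2 : c.fiberB ξ u =ᵐ[cellMeasure d]
      fun x => ∫ y, c.fiberKernel ξ x y * u y ∂(cellMeasure d) := opOfFormula_ae u
  filter_upwards [h1, h2, Lp.coeFn_sub (multOp (fun x => (c.potential x : ℂ)) c.schurConst
    c.potential_measurable c.potential_bound u) (c.fiberB ξ u)] with x h1 h2 h3
  exact h3.trans (congrArg₂ (· - ·) h1 h2)

/-! ### The cell problems and the effective matrix -/

/-- `v` is a solution of the `j`-th cell problem: it is a `ℤᵈ`-periodic function, square integrable
on `Ω`, with zero mean over `Ω`, and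
`∫ a(x-y) μ(x,y) (v(x) - v(y)) dy = ∫ a(x-y) μ(x,y) (x_j - y_j) dy` for almost all `x ∈ Ω`. -/
structure IsCellSolution (j : Fin d) (v : Rd d → ℝ) : Prop where
  periodic : ∀ (n : Fin d → ℤ) (x : Rd d), v (x + latt n) = v x
  memLp : MemLp v 2 (cellMeasure d)
  equation : ∀ᵐ x ∂(cellMeasure d),
    ∫ y, c.a (x - y) * c.mu x y * (v x - v y) = ∫ y, c.a (x - y) * c.mu x y * (x j - y j)
  mean_zero : ∫ x in cell d, v x = 0

/-- The numbers `g_{ij}` built from the solutions `v` of the cell problems. -/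
noncomputable def g (v : Fin d → Rd d → ℝ) (i j : Fin d) : ℝ :=
  ∫ x in cell d, ∫ y, ((x i - y i) * (x j - y j) - v j x * (x i - y i) - v i x * (x j - y j))
    * c.a (x - y) * c.mu x y

/-- The quadratic form `(1/2) ∑ g_{ij} ξ_i ξ_j`. -/
noncomputable def effForm (v : Fin d → Rd d → ℝ) (ξ : Rd d) : ℝ :=
  (1 / 2) * ∑ i, ∑ j, c.g v i j * ξ i * ξ j

/-! ### The constants -/

/-- The moments `M_k(a) = ∫ |x|ᵏ a(x) dx`. -/
noncomputable def M (k : ℕ) : ℝ := ∫ x, ‖x‖ ^ k * c.a x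

/-- `Â(y) = ∫ (1 - cos⟨z,y⟩) a(z) dz`. -/
noncomputable def Ahat (y : Rd d) : ℝ := ∫ z, (1 - Real.cos (inner ℝ z y)) * c.a z

/-- `𝒜_r(a)`, the minimum of `Â` over `|y| ≥ r`. -/
noncomputable def calA (r : ℝ) : ℝ := sInf (c.Ahat '' {y | r ≤ ‖y‖})

/-- `ℳ(a)`, the minimum over unit vectors `θ` of `∫ a(z) ⟨z,θ⟩² dz`. -/
noncomputable def calM : ℝ :=
  sInf ((fun θ : Rd d => ∫ z, c.a z * (inner ℝ z θ) ^ 2) '' {θ | ‖θ‖ = 1})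

/-- `r(a) = (3/2) ℳ(a) / M₃(a)`. -/
noncomputable def rad : ℝ := 3 / 2 * c.calM * (c.M 3)⁻¹

/-- The distance from the point `0` to the rest of the spectrum of `𝔸(0)`. -/
noncomputable def d0 : ℝ := Metric.infDist (0 : ℂ) (spectrum ℂ (c.fiberA 0) \ {0})

/-- `δ₀(a,μ) = min {1, 3⁻¹ 2⁻ᵈ M₁(a)⁻¹ μ₊⁻¹ μ₋ 𝒜_π(a)}`. -/
noncomputable def delta0 : ℝ :=
  min 1 (3⁻¹ * (2 ^ d)⁻¹ * (c.M 1)⁻¹ * c.muPlus⁻¹ * c.muMinus * c.calA Real.pi)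

end Coefficients

/-- `C(a)` as a function of `d`, `ℳ(a)`, `𝒜_{r(a)}(a)`, `𝒜_π(a)`. -/
noncomputable def constC (d : ℕ) (calM Ar Api : ℝ) : ℝ :=
  min (calM / 4) (min (Ar * (Real.pi ^ 2)⁻¹ * (d : ℝ)⁻¹) (Api * (Real.pi ^ 2)⁻¹ * (d : ℝ)⁻¹))

/-- `C₁(a,μ)` as a function of `d`, `μ₊`, `M₁(a)` and of the spectral gap `δ`. -/
noncomputable def constC1 (d : ℕ) (muPlus M1 δ : ℝ) : ℝ :=
  6 * (Real.pi + 2) * Real.pi⁻¹ * 2 ^ d * δ⁻¹ * muPlus * M1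

/-- `C₂(a,μ)` as a function of `μ₊`, `M₁(a)`, `M₂(a)`, `M₃(a)` and of the spectral gap `δ`. -/
noncomputable def constC2 (muPlus M1 M2 M3 δ : ℝ) : ℝ :=
  (Real.pi + 2) / (2 * Real.pi) *
    (muPlus * M3
      + muPlus ^ 2 / δ * ((3 * M2 + M3) * (12 * M1 + 3 * M2 + M3))
      + muPlus ^ 3 / δ ^ 2 * (6 * M1 + 3 * M2 + M3) ^ 3)

/-- `S(a,μ)` as a function of the quantities that enter it, `δ` being the spectral gap. -/
noncomputable def constS (d : ℕ) (muMinus muPlus M1 M2 M3 calM Ar Api δ : ℝ) : ℝ :=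
  2 * constC1 d muPlus M1 δ / (muMinus * constC d calM Ar Api) ^ (1 / 2 : ℝ)
    + constC2 muPlus M1 M2 M3 δ / (muMinus * constC d calM Ar Api) ^ (3 / 2 : ℝ)
    + (2 * δ / 3) ^ (-(1 / 2) : ℝ)

namespace Coefficients

variable {d : ℕ} (c : Coefficients d)

/-- The constant `C(a)`. -/
noncomputable def Ca : ℝ := constC d c.calM (c.calA c.rad) (c.calA Real.pi)

/-- The constant `S(a,μ)`. -/
noncomputable def S : ℝ :=
  constS d c.muMinus c.muPlus (c.M 1) (c.M 2) (c.M 3) c.calM (c.calA c.rad) (c.calA Real.pi) c.d0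

/-- The bound for `S(a,μ)` obtained on replacing the spectral gap by `μ₋ 𝒜_π(a)`; it depends only on
`d`, `μ₋`, `μ₊`, `M₁(a)`, `M₂(a)`, `M₃(a)`, `ℳ(a)`, `𝒜_π(a)` and `𝒜_{r(a)}(a)`. -/
noncomputable def SBound : ℝ :=
  constS d c.muMinus c.muPlus (c.M 1) (c.M 2) (c.M 3) c.calM (c.calA c.rad) (c.calA Real.pi)
    (c.muMinus * c.calA Real.pi)

end Coefficients

/-- The constant function `𝟏_Ω` as an element of `L₂(Ω)`. -/
noncomputable def oneCell (d : ℕ) : L2cell d := Lp.const 2 (cellMeasure d) (1 : ℂ)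

/-- The orthogonal projection of `L₂(Ω)` onto the constants. -/
noncomputable def projConst (d : ℕ) : L2cell d →L[ℂ] L2cell d :=
  (Submodule.span ℂ {oneCell d}).starProjection

end NonlocalHom

/-!
Up to sign, `𝔸(0)` is the generator of a jump process on the torus, and `𝔸(ξ)` is obtained from it
by attaching phases to the jumps. Their forms are governed by the jump measure
`ν = a(x-y) μ(x,y) dx dy` on `Ω × ℝᵈ` (`Coefficients.nu`). The exchange of the two endpoints of a
jump, followed by a lattice shift that returns the first endpoint to `Ω`, preserves `ν`
(`Coefficients.measurePreserving_swapPt_nu`). Hence, for periodic `u`,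
`⟪u, 𝔸(ξ) u⟫ = ½ ∫ |u(x) - exp(-i⟨ξ, x-y⟩) u(y)|² dν` (`Coefficients.re_inner_fiberA`), which is
monotone in `μ`. For `μ = 1` the exponentials `exp(2πi⟨n,x⟩)` diagonalise the operator with
eigenvalues `Â(ξ + 2πn)`; this gives `𝔸(ξ) ≥ μ₋ C(a) |ξ|²` for `|ξ| ≤ 1`
(`Coefficients.le_re_inner_fiberA`), and `𝔸(0) ≥ μ₋ 𝒜_π(a)` on the complement of the constants
(`Coefficients.le_re_inner_fiberA_zero`). By the spectral theorem the latter bound improves to `d₀`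
(`infDist_spectrum_mul_le`), and `|ξ| ≤ δ₀` ensures `‖𝔸(ξ) - 𝔸(0)‖ ≤ d₀ / 6`, so that `𝔸(ξ)` is at
least `5 d₀ / 6` there. The cell problem is `𝔸(0) v_j = f_j` with `f_j` orthogonal to the constants,
which is uniquely solvable for the same reason.

The resolvent is then controlled through the Schur complement of `𝔸(ξ) + τ`, `τ = ε²`, with respect
to the unit vector `𝟏`. There are `w ⟂ 𝟏` and a scalar `s` with `(𝔸(ξ) + τ)(𝟏 - w) = s 𝟏`, and
`(𝔸(ξ) + τ)⁻¹` differs from the rank-one operator `s⁻¹ ⟪𝟏 - w, ·⟫ (𝟏 - w)` by at most the inverse of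
the lower bound on the complement (`SchurData.norm_inverse_sub_rankOne_le`). Moreover
`s = τ + ⟪𝟏, 𝔸(ξ) 𝟏⟫ - ⟪𝔸(ξ) 𝟏, w⟫`. To leading order `⟪𝟏, 𝔸(ξ) 𝟏⟫` is `½ ∫ ⟨ξ, x-y⟩² dν`, and
`w` is `i ∑ ξ_j v_j`, since `𝔸(ξ) 𝟏 ≈ i ∑ ξ_j f_j`. So `s - τ` is the effective form
`½ ∑ g_{ij} ξ_i ξ_j` up to `O(|ξ|³ + τ |ξ|²)` (`Coefficients.abs_schur_sub_effForm_le`). As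
`s ≥ μ₋ C(a) |ξ|² + τ`, letting `ξ` and `τ` tend to zero at the same rate gives the lower bound
`μ₋ C(a) |ξ|²` for the effective form as well (`Coefficients.le_effForm`). It remains to sum the
errors: with `K = μ₋ C(a) |ξ|² + ε²` they are bounded by `(5 d₀ / 6 + ε²)⁻¹` and multiples of
`|ξ| / K`, `|ξ|³ / K²` and `ε² |ξ|² / K²`, each of which is `O(1 / ε)` with constants that add up
to at most `S` (`error_terms_le`, `Coefficients.error_terms_le_S`).
-/

/-! ### Resolvents of nonnegative operators with an isolated low-lying vector -/

namespace NonlocalHom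

section Abstract

variable {H : Type*} [NormedAddCommGroup H] [InnerProductSpace ℂ H]

local notation "⟪" x ", " y "⟫" => inner ℂ x y

lemma norm_le_div_of_mul_sq_le {E : Type*} [NormedAddCommGroup E] {z : E} {g K : ℝ}
    (hg : 0 < g) (hK : 0 ≤ K) (h : g * ‖z‖ ^ 2 ≤ K * ‖z‖) : ‖z‖ ≤ K / g := by
  rw [le_div_iff₀ hg]
  rcases (norm_nonneg z).eq_or_lt with h0 | h0
  · rw [← h0]; simpa using hK
  · nlinarith

lemma re_inner_le (x y : H) : (⟪x, y⟫).re ≤ ‖x‖ * ‖y‖ :=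
  (Complex.re_le_norm _).trans (norm_inner_le_norm x y)

lemma inner_self_re (x : H) : (⟪x, x⟫).re = ‖x‖ ^ 2 := inner_self_eq_norm_sq (𝕜 := ℂ) x

/-- The lower bound `⟪u, A u⟫ ≥ g‖u‖²` implies `⟪u, (A + τ) u⟫ ≥ (g + τ)‖u‖²`. -/
lemma coercive_add_smul {A : H →L[ℂ] H} {g : ℝ} (τ : ℝ) {u : H}
    (h : g * ‖u‖ ^ 2 ≤ (⟪u, A u⟫).re) :
    (g + τ) * ‖u‖ ^ 2 ≤ (⟪u, (A + (τ : ℂ) • 1) u⟫).re := by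
  have h1 : (⟪u, (A + (τ : ℂ) • 1) u⟫).re = (⟪u, A u⟫).re + τ * ‖u‖ ^ 2 := by
    simp [← inner_self_re u]
  rw [h1]; linarith

/-- A vector `w` orthogonal to `e` on which the form of `A` is at least `g‖w‖²`, and with
`A w` equal to `f` up to a multiple of `e`, obeys `‖w‖ ≤ K / g` once `|⟪w, f⟫| ≤ K‖w‖`. -/
lemma norm_le_of_map_eq_add_smul {A : H →L[ℂ] H} {e w f : H} {g K : ℝ} {t : ℂ} (hg : 0 < g)
    (hK : 0 ≤ K) (hA : g * ‖w‖ ^ 2 ≤ (⟪w, A w⟫).re) (hw : ⟪e, w⟫ = 0) (hAw : A w = f + t • e)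
    (hf : ‖⟪w, f⟫‖ ≤ K * ‖w‖) : ‖w‖ ≤ K / g := by
  refine norm_le_div_of_mul_sq_le hg hK (hA.trans ?_)
  rw [hAw, inner_add_right, inner_smul_right, inner_eq_zero_symm.1 hw, mul_zero, add_zero]
  exact (Complex.re_le_norm _).trans hf

/-- An operator with a strictly positive lower bound of its form is invertible. -/
lemma isUnit_of_coercive [CompleteSpace H] {A : H →L[ℂ] H} {g : ℝ} (hg : 0 < g)
    (h : ∀ u, g * ‖u‖ ^ 2 ≤ (⟪u, A u⟫).re) : IsUnit A := by
  refine ContinuousLinearMap.isUnit_of_forall_le_norm_inner_map A (c := ⟨g, hg.le⟩) hg fun x => ?_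
  rw [norm_inner_symm]
  have := (h x).trans (Complex.re_le_norm _)
  rw [mul_comm]; exact this

/-- The data of the Schur complement of `A + τ` with respect to the unit vector `e`:
`φ = e - w` with `w ⟂ e` and `(A + τ) φ = s e`. -/
structure SchurData (A : H →L[ℂ] H) (e : H) (τ : ℝ) where
  /-- the component of `e - φ` orthogonal to `e` -/
  w : H
  /-- the Schur complement -/
  s : ℝ
  orth : ⟪e, w⟫ = 0
  map_eq : (A + (τ : ℂ) • 1) (e - w) = (s : ℂ) • e

variable {A A₀ : H →L[ℂ] H} {e : H} {κ g τ : ℝ}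

/-- With `y = (A + τ)⁻¹ e` the Schur complement is `s = ⟪e, y⟫⁻¹`, which is real by symmetry and
positive by coercivity, and `φ = s y`. -/
lemma exists_schurData [CompleteSpace H] (he : ‖e‖ = 1) (hsym : ∀ x y, ⟪A x, y⟫ = ⟪x, A y⟫)
    (hκ : 0 ≤ κ) (hA : ∀ u, κ * ‖u‖ ^ 2 ≤ (⟪u, A u⟫).re) (hτ : 0 < τ) :
    Nonempty (SchurData A e τ) := by
  have hc : ∀ u, (κ + τ) * ‖u‖ ^ 2 ≤ (⟪u, (A + (τ : ℂ) • 1) u⟫).re := fun u =>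
    coercive_add_smul τ (hA u)
  obtain ⟨U, hU⟩ := isUnit_of_coercive (by positivity) hc
  set T := A + (τ : ℂ) • (1 : H →L[ℂ] H) with hT
  have hTsym : ∀ x y, ⟪T x, y⟫ = ⟪x, T y⟫ := fun x y => by
    simp [hT, hsym]
  set G : H →L[ℂ] H := ↑U⁻¹ with hG
  have hTG : ∀ x, T (G x) = x := fun x => by
    rw [← mul_apply_eq_comp, ← hU, hG, Units.mul_inv]; rfl
  set y := G e with hy
  have hTy : T y = e := hTG e
  have hreal : ⟪e, y⟫ = (((⟪e, y⟫).re : ℝ) : ℂ) := by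
    have : (starRingEnd ℂ) ⟪e, y⟫ = ⟪e, y⟫ := by
      rw [inner_conj_symm]
      conv_lhs => rw [← hTy, ← hTsym, hTy]
    exact (Complex.conj_eq_iff_re.1 this).symm
  have hpos : 0 < (⟪e, y⟫).re := by
    have hy0 : y ≠ 0 := by
      intro h0
      rw [h0, map_zero] at hTy
      rw [← hTy] at he; simp at he
    have h1 := hc y
    rw [← hTsym, hTy] at h1
    have : 0 < ‖y‖ := norm_pos_iff.2 hy0
    exact lt_of_lt_of_le (by positivity) h1
  set r := (⟪e, y⟫).re with hr
  have hr0 : (r : ℂ) ≠ 0 := by exact_mod_cast hpos.ne'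
  refine ⟨⟨e - ((r⁻¹ : ℝ) : ℂ) • y, r⁻¹, ?_, ?_⟩⟩
  · have hee : ⟪e, e⟫ = 1 := by rw [inner_self_eq_norm_sq_to_K, he]; simp
    rw [inner_sub_right, inner_smul_right, hreal, hee]
    push_cast
    rw [inv_mul_cancel₀ hr0, sub_self]
  · rw [sub_sub_cancel, map_smul, ← hT, hTy]

namespace SchurData

variable (D : SchurData A e τ)

lemma inner_vec_eq_one (he : ‖e‖ = 1) : ⟪e, e - D.w⟫ = 1 := by
  rw [inner_sub_right, D.orth, sub_zero, inner_self_eq_norm_sq_to_K, he]; simp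

/-- The Schur complement inherits the lower bound of `A + τ`, because
`s = ⟪φ, (A + τ) φ⟫` and `‖φ‖ ≥ ‖e‖ = 1`. -/
lemma le_s (he : ‖e‖ = 1) (hκ : 0 ≤ κ) (hτ : 0 < τ)
    (hA : ∀ u, κ * ‖u‖ ^ 2 ≤ (⟪u, A u⟫).re) : κ + τ ≤ D.s := by
  have h1 := coercive_add_smul τ (hA (e - D.w))
  rw [D.map_eq, inner_smul_right, ← inner_conj_symm, D.inner_vec_eq_one he] at h1
  simp only [map_one, mul_one, Complex.ofReal_re] at h1
  have h2 : 1 ≤ ‖e - D.w‖ := by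
    have := norm_inner_le_norm (𝕜 := ℂ) e (e - D.w)
    rw [D.inner_vec_eq_one he, he] at this
    simpa using this
  have h3 : 1 ≤ ‖e - D.w‖ ^ 2 := one_le_pow₀ h2
  nlinarith

lemma map_w : (A + (τ : ℂ) • 1) D.w = A e + ((τ : ℂ) - D.s) • e := by
  have h := D.map_eq
  rw [map_sub, sub_eq_iff_eq_add] at h
  have h2 : (A + (τ : ℂ) • (1 : H →L[ℂ] H)) e = A e + (τ : ℂ) • e := by simp
  rw [h2] at h
  rw [sub_smul, ← add_sub_assoc, h]
  abel

/-- The Schur complement in terms of the orthogonal component. -/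
lemma s_eq (he : ‖e‖ = 1) (hsym : ∀ x y, ⟪A x, y⟫ = ⟪x, A y⟫) :
    (D.s : ℂ) = ⟪e, A e⟫ + τ - ⟪A e, D.w⟫ := by
  have hee : ⟪e, e⟫ = 1 := by rw [inner_self_eq_norm_sq_to_K, he]; simp
  have h : ⟪e, (A + (τ : ℂ) • 1) (e - D.w)⟫ = D.s := by
    rw [D.map_eq, inner_smul_right, hee, mul_one]
  rw [← h, hsym]
  simp [D.orth, he]
  ring

lemma norm_w_le {η : ℝ} (hg : 0 < g) (hτ : 0 < τ) (hη : 0 ≤ η)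
    (hA : ∀ u, ⟪e, u⟫ = 0 → g * ‖u‖ ^ 2 ≤ (⟪u, A u⟫).re) (hAe : ‖A e‖ ≤ η) :
    ‖D.w‖ ≤ η / g := by
  refine (norm_le_of_map_eq_add_smul (by positivity : 0 < g + τ) hη
    (coercive_add_smul τ (hA _ D.orth)) D.orth D.map_w ?_).trans ?_
  · refine (norm_inner_le_norm _ _).trans ?_
    rw [mul_comm]; gcongr
  · gcongr; linarith

/-- Comparison of the orthogonal component `w` with the solution `V` of the limiting problem
`A₀ V = f`, where `f` approximates the component of `A e` orthogonal to `e`. -/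
lemma norm_w_sub_le {η ρ : ℝ} {V : H} (hg : 0 < g) (hτ : 0 < τ) (hη : 0 ≤ η) (hρ : 0 ≤ ρ)
    (hA : ∀ u, ⟪e, u⟫ = 0 → g * ‖u‖ ^ 2 ≤ (⟪u, A u⟫).re) (hAA : ‖A - A₀‖ ≤ η)
    (hV : ⟪e, V⟫ = 0) (hr : ∀ z, ⟪e, z⟫ = 0 → ‖⟪z, A e - A₀ V⟫‖ ≤ ρ * ‖z‖) :
    ‖D.w - V‖ ≤ (ρ + η * ‖V‖ + τ * ‖V‖) / g := by
  have horth : ⟪e, D.w - V⟫ = 0 := by rw [inner_sub_right, D.orth, hV, sub_zero]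
  have hmap : (A + (τ : ℂ) • 1) (D.w - V) =
      ((A e - A₀ V) - ((A - A₀) V + (τ : ℂ) • V)) + ((τ : ℂ) - D.s) • e := by
    rw [map_sub, D.map_w]
    simp only [add_apply, sub_apply, smul_apply, one_apply_eq_self]
    abel
  refine (norm_le_of_map_eq_add_smul (by positivity : 0 < g + τ) (by positivity)
    (coercive_add_smul τ (hA _ horth)) horth hmap (K := ρ + η * ‖V‖ + τ * ‖V‖) ?_).trans ?_
  · rw [inner_sub_right]
    refine (norm_sub_le _ _).trans ?_
    have h1 := hr _ horth
    have h2 : ‖(A - A₀) V + (τ : ℂ) • V‖ ≤ η * ‖V‖ + τ * ‖V‖ := by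
      refine (norm_add_le _ _).trans (add_le_add (((A - A₀).le_opNorm V).trans (by gcongr)) ?_)
      rw [norm_smul, Complex.norm_real, Real.norm_of_nonneg hτ.le]
    have h3 := norm_inner_le_norm (𝕜 := ℂ) (D.w - V) ((A - A₀) V + (τ : ℂ) • V)
    have h4 := mul_le_mul_of_nonneg_left h2 (norm_nonneg (D.w - V))
    linarith
  · gcongr; linarith

/-- The resolvent differs from the rank-one operator built from `φ = e - w` by an operator of
norm at most `1 / (g + τ)`: the difference takes values in the orthogonal complement of `e`, where
the form of `A + τ` is at least `g + τ`. -/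
lemma norm_inverse_sub_rankOne_le (he : ‖e‖ = 1) (hsym : ∀ x y, ⟪A x, y⟫ = ⟪x, A y⟫)
    (hg : 0 < g) (hκ : 0 ≤ κ) (hτ : 0 < τ) (hA : ∀ u, κ * ‖u‖ ^ 2 ≤ (⟪u, A u⟫).re)
    (hAe : ∀ u, ⟪e, u⟫ = 0 → g * ‖u‖ ^ 2 ≤ (⟪u, A u⟫).re) {f u : H}
    (hu : (A + (τ : ℂ) • 1) u = f) :
    ‖u - ((D.s : ℂ)⁻¹ * ⟪e - D.w, f⟫) • (e - D.w)‖ ≤ ‖f‖ / (g + τ) := by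
  have hs : (D.s : ℂ) ≠ 0 := by
    have := D.le_s he hκ hτ hA
    exact_mod_cast (by linarith : 0 < D.s).ne'
  set T := A + (τ : ℂ) • (1 : H →L[ℂ] H) with hT
  have hTsym : ∀ x y, ⟪T x, y⟫ = ⟪x, T y⟫ := fun x y => by
    simp [hT, hsym]
  have hφ : ⟪e - D.w, f⟫ = D.s * ⟪e, u⟫ := by
    rw [← hu, ← hTsym, hT, D.map_eq, inner_smul_left, Complex.conj_ofReal]
  have horth : ⟪e, u - ((D.s : ℂ)⁻¹ * ⟪e - D.w, f⟫) • (e - D.w)⟫ = 0 := by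
    rw [inner_sub_right, inner_smul_right, D.inner_vec_eq_one he, hφ, ← mul_assoc,
      inv_mul_cancel₀ hs]
    simp
  refine norm_le_of_map_eq_add_smul (by positivity : 0 < g + τ) (norm_nonneg f)
    (coercive_add_smul τ (hAe _ horth)) horth (f := f) (t := -⟪e - D.w, f⟫) ?_ ?_
  · rw [← hT, map_sub, hu, map_smul, hT, D.map_eq, smul_smul, neg_smul, sub_eq_add_neg]
    congr 3
    field_simp
  · exact (norm_inner_le_norm _ _).trans (mul_comm _ _).le

end SchurData

end Abstract

/-! ### Approximation of the Schur complement and of the resolvent -/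

section ThresholdEstimate

variable {H : Type*} [NormedAddCommGroup H] [InnerProductSpace ℂ H]

local notation "⟪" x ", " y "⟫" => inner ℂ x y

variable {A A₀ : H →L[ℂ] H} {e V : H} {κ g dlt η ρ θ α₂ τ : ℝ}

/-- The bound for the difference between the Schur complement of `A + τ` and `τ` plus the
effective value `α₂ - ⟪A₀ V, V⟫`. -/
noncomputable def schurError (g dlt η ρ θ τ : ℝ) : ℝ :=
  θ + (2 * ρ * η / g + η ^ 3 / (dlt * g) + τ * η ^ 2 / (dlt * g))

/-- The Schur complement is close to its effective value.  Here `A₀ V` approximates `A e` in the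
orthogonal complement of `e` and `α₂` approximates `⟪e, A e⟫`. -/
lemma SchurData.abs_s_sub_le (D : SchurData A e τ) (he : ‖e‖ = 1)
    (hsym : ∀ x y, ⟪A x, y⟫ = ⟪x, A y⟫)
    (hτ : 0 < τ) (hg : 0 < g) (hdlt : 0 < dlt) (hη : 0 ≤ η) (hρ : 0 ≤ ρ)
    (hAg : ∀ u, ⟪e, u⟫ = 0 → g * ‖u‖ ^ 2 ≤ (⟪u, A u⟫).re)
    (hA₀ : ∀ u, ⟪e, u⟫ = 0 → dlt * ‖u‖ ^ 2 ≤ (⟪u, A₀ u⟫).re)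
    (hA₀e : A₀ e = 0) (hAA : ‖A - A₀‖ ≤ η) (hV : ⟪e, V⟫ = 0) (hVη : ‖A₀ V‖ ≤ η)
    (hr : ∀ z, ⟪e, z⟫ = 0 → ‖⟪z, A e - A₀ V⟫‖ ≤ ρ * ‖z‖)
    (hα : |(⟪e, A e⟫).re - α₂| ≤ θ) :
    |D.s - τ - (α₂ - (⟪A₀ V, V⟫).re)| ≤ schurError g dlt η ρ θ τ := by
  have hAe : ‖A e‖ ≤ η := by
    have h : A e = (A - A₀) e := by rw [sub_apply, hA₀e, sub_zero]
    rw [h]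
    refine ((A - A₀).le_opNorm e).trans ?_
    rw [he, mul_one]; exact hAA
  have hw : ‖D.w‖ ≤ η / g := D.norm_w_le hg hτ hη hAg hAe
  have hVn : ‖V‖ ≤ η / dlt := by
    refine norm_le_of_map_eq_add_smul (f := A₀ V) (t := 0) hdlt hη (hA₀ V hV) hV (by simp) ?_
    refine (norm_inner_le_norm _ _).trans ?_
    rw [mul_comm]; gcongr
  have hz : ‖D.w - V‖ ≤ (ρ + η * (η / dlt) + τ * (η / dlt)) / g :=
    (D.norm_w_sub_le hg hτ hη hρ hAg hAA hV hr).trans (by gcongr)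
  have hkey : ⟪A e, D.w⟫ - ⟪A₀ V, V⟫ = ⟪A e - A₀ V, D.w⟫ + ⟪A₀ V, D.w - V⟫ := by
    rw [inner_sub_left, inner_sub_right]; ring
  have h1 : ‖⟪A e - A₀ V, D.w⟫‖ ≤ ρ * (η / g) := by
    rw [norm_inner_symm]
    exact (hr _ D.orth).trans (by gcongr)
  have h2 : ‖⟪A₀ V, D.w - V⟫‖ ≤ η * ((ρ + η * (η / dlt) + τ * (η / dlt)) / g) :=
    (norm_inner_le_norm _ _).trans (by gcongr)
  have h3 : ‖⟪A e, D.w⟫ - ⟪A₀ V, V⟫‖ ≤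
      ρ * (η / g) + η * ((ρ + η * (η / dlt) + τ * (η / dlt)) / g) := by
    rw [hkey]; exact (norm_add_le _ _).trans (add_le_add h1 h2)
  have h4 := (Complex.abs_re_le_norm _).trans h3
  have hs := congrArg Complex.re (D.s_eq he hsym)
  simp only [Complex.sub_re, Complex.add_re, Complex.ofReal_re] at hs h4
  have e1 : D.s - τ - (α₂ - (⟪A₀ V, V⟫).re) =
      ((⟪e, A e⟫).re - α₂) - ((⟪A e, D.w⟫).re - (⟪A₀ V, V⟫).re) := by rw [hs]; ring
  rw [e1]
  refine (abs_sub _ _).trans ?_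
  refine (add_le_add hα h4).trans_eq ?_
  rw [schurError]
  field_simp
  ring

/-- The resolvent of `A` at `-τ` is approximated by the rank-one operator `(E + τ)⁻¹ ⟪e, ·⟫ e`,
provided that the Schur complement is approximated by `E + τ`. -/
lemma SchurData.norm_resolvent_sub_le (D : SchurData A e τ) {E δ : ℝ} (he : ‖e‖ = 1)
    (hsym : ∀ x y, ⟪A x, y⟫ = ⟪x, A y⟫) (hκ : 0 ≤ κ) (hτ : 0 < τ) (hg : 0 < g) (hη : 0 ≤ η)
    (hA : ∀ u, κ * ‖u‖ ^ 2 ≤ (⟪u, A u⟫).re)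
    (hAg : ∀ u, ⟪e, u⟫ = 0 → g * ‖u‖ ^ 2 ≤ (⟪u, A u⟫).re)
    (hAe : ‖A e‖ ≤ η) (hηg : 5 * η ≤ g) (hE : κ ≤ E) (hδ : |D.s - τ - E| ≤ δ)
    {f u : H} (hu : (A + (τ : ℂ) • 1) u = f) :
    ‖u - (((E + τ)⁻¹ : ℝ) : ℂ) • ⟪e, f⟫ • e‖ ≤
      (1 / (g + τ) + 11 / 5 * (η / g) / (κ + τ) + δ / (κ + τ) ^ 2) * ‖f‖ := by
  have hs := D.le_s he hκ hτ hA
  have hs0 : 0 < D.s := by linarith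
  have hκτ : 0 < κ + τ := by linarith
  have hw : ‖D.w‖ ≤ η / g := D.norm_w_le hg hτ hη hAg hAe
  have hw5 : ‖D.w‖ ≤ 1 / 5 := hw.trans (by rw [div_le_iff₀ hg]; linarith)
  have h1 := D.norm_inverse_sub_rankOne_le he hsym hg hκ hτ hA hAg hu
  have h2 : ‖((D.s : ℂ)⁻¹ * ⟪e - D.w, f⟫) • (e - D.w) - ((D.s : ℂ)⁻¹ * ⟪e, f⟫) • e‖ ≤
      11 / 5 * (η / g) / (κ + τ) * ‖f‖ := by
    have e1 : ((D.s : ℂ)⁻¹ * ⟪e - D.w, f⟫) • (e - D.w) - ((D.s : ℂ)⁻¹ * ⟪e, f⟫) • e =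
        -((D.s : ℂ)⁻¹ • (⟪D.w, f⟫ • (e - D.w) + ⟪e, f⟫ • D.w)) := by
      rw [inner_sub_left]
      simp only [mul_sub, sub_smul, smul_sub, smul_add, smul_smul]
      abel
    rw [e1, norm_neg, norm_smul, norm_inv, Complex.norm_real, Real.norm_of_nonneg hs0.le]
    have e2 : ‖⟪D.w, f⟫ • (e - D.w) + ⟪e, f⟫ • D.w‖ ≤ 11 / 5 * (η / g) * ‖f‖ := by
      refine (norm_add_le _ _).trans ?_
      rw [norm_smul, norm_smul]
      have i1 := norm_inner_le_norm (𝕜 := ℂ) D.w f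
      have i2 := norm_inner_le_norm (𝕜 := ℂ) e f
      rw [he, one_mul] at i2
      have i3 : ‖e - D.w‖ ≤ 6 / 5 := (norm_sub_le _ _).trans (by rw [he]; linarith)
      calc ‖⟪D.w, f⟫‖ * ‖e - D.w‖ + ‖⟪e, f⟫‖ * ‖D.w‖
          ≤ (‖D.w‖ * ‖f‖) * (6 / 5) + ‖f‖ * ‖D.w‖ := by gcongr
        _ = 11 / 5 * ‖D.w‖ * ‖f‖ := by ring
        _ ≤ 11 / 5 * (η / g) * ‖f‖ := by gcongr
    calc D.s⁻¹ * ‖⟪D.w, f⟫ • (e - D.w) + ⟪e, f⟫ • D.w‖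
        ≤ (κ + τ)⁻¹ * (11 / 5 * (η / g) * ‖f‖) := by gcongr
      _ = 11 / 5 * (η / g) / (κ + τ) * ‖f‖ := by ring
  have h3 : ‖((D.s : ℂ)⁻¹ * ⟪e, f⟫) • e - (((E + τ)⁻¹ : ℝ) : ℂ) • ⟪e, f⟫ • e‖ ≤
      δ / (κ + τ) ^ 2 * ‖f‖ := by
    have hE0 : 0 < E + τ := by linarith
    rw [smul_smul, ← sub_smul, ← sub_mul, norm_smul, norm_mul, he, mul_one,
      ← Complex.ofReal_inv, ← Complex.ofReal_sub, Complex.norm_real]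
    have i2 := norm_inner_le_norm (𝕜 := ℂ) e f
    rw [he, one_mul] at i2
    have hδ0 : 0 ≤ δ := (abs_nonneg _).trans hδ
    have e3 : ‖D.s⁻¹ - (E + τ)⁻¹‖ ≤ δ / (κ + τ) ^ 2 := by
      rw [inv_sub_inv hs0.ne' hE0.ne', Real.norm_eq_abs, abs_div, abs_mul, abs_of_pos hs0,
        abs_of_pos hE0, pow_two]
      have : |E + τ - D.s| ≤ δ := by
        rw [abs_sub_comm]; convert hδ using 2; ring
      gcongr
    gcongr
  calc ‖u - (((E + τ)⁻¹ : ℝ) : ℂ) • ⟪e, f⟫ • e‖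
      = ‖(u - ((D.s : ℂ)⁻¹ * ⟪e - D.w, f⟫) • (e - D.w)) +
        (((D.s : ℂ)⁻¹ * ⟪e - D.w, f⟫) • (e - D.w) - ((D.s : ℂ)⁻¹ * ⟪e, f⟫) • e) +
        (((D.s : ℂ)⁻¹ * ⟪e, f⟫) • e - (((E + τ)⁻¹ : ℝ) : ℂ) • ⟪e, f⟫ • e)‖ := by
          congr 1; abel
    _ ≤ _ := norm_add₃_le
    _ ≤ _ := by
      refine (add_le_add (add_le_add h1 h2) h3).trans_eq ?_
      ring

end ThresholdEstimate

/-! ### The spectral gap and the quadratic form -/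

section Spectrum

variable {H : Type*} [NormedAddCommGroup H] [InnerProductSpace ℂ H]

local notation "⟪" x ", " y "⟫" => inner ℂ x y

variable {A : H →L[ℂ] H} {e : H} {γ : ℝ}

/-- The rank-one projection `⟪e, ·⟫ e`. -/
noncomputable def rankOneProj (e : H) : H →L[ℂ] H := (innerSL ℂ e).smulRight e

lemma rankOneProj_apply (e x : H) : rankOneProj e x = ⟪e, x⟫ • e := by simp [rankOneProj]

lemma inner_unit_self (he : ‖e‖ = 1) : ⟪e, e⟫ = 1 := by
  rw [inner_self_eq_norm_sq_to_K, he]; simp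

/-- The quadratic form of `A + t P` in the decomposition of the space along `e`. -/
lemma re_inner_add_smul_proj (hsym : ∀ x y, ⟪A x, y⟫ = ⟪x, A y⟫) (he : ‖e‖ = 1) (hAe : A e = 0)
    (t : ℝ) (hA : ∀ u, ⟪e, u⟫ = 0 → γ * ‖u‖ ^ 2 ≤ (⟪u, A u⟫).re) (ht : γ ≤ t) (u : H) :
    γ * ‖u‖ ^ 2 ≤ (⟪u, (A + (t : ℂ) • rankOneProj e) u⟫).re := by
  set z := u - ⟪e, u⟫ • e with hz
  have hez : ⟪e, z⟫ = 0 := by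
    rw [hz, inner_sub_right, inner_smul_right, inner_unit_self he]; simp
  have hu : u = ⟪e, u⟫ • e + z := by rw [hz]; abel
  have hn : ‖u‖ ^ 2 = ‖⟪e, u⟫‖ ^ 2 + ‖z‖ ^ 2 := by
    have h : ⟪⟪e, u⟫ • e, z⟫ = 0 := by rw [inner_smul_left, hez, mul_zero]
    have := norm_add_sq_eq_norm_sq_add_norm_sq_of_inner_eq_zero _ _ h
    rw [← hu, norm_smul, he, mul_one] at this
    nlinarith [this]
  have hAu : ⟪u, A u⟫ = ⟪z, A z⟫ := by
    have h1 : A u = A z := by rw [hz, map_sub, map_smul, hAe, smul_zero, sub_zero]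
    rw [← hsym, h1, hsym, h1]
  have hP : (⟪u, (t : ℂ) • rankOneProj e u⟫).re = t * ‖⟪e, u⟫‖ ^ 2 := by
    rw [inner_smul_right, rankOneProj_apply, inner_smul_right, ← inner_conj_symm u e,
      Complex.mul_conj, ← Complex.ofReal_mul, Complex.ofReal_re, Complex.normSq_eq_norm_sq]
  rw [add_apply, inner_add_right, Complex.add_re, hAu, smul_apply, hP, hn]
  have := hA z hez
  nlinarith [sq_nonneg ‖⟪e, u⟫‖]

/-- Adding a multiple of the projection onto the kernel vector `e` moves no point of the spectrum
other than the eigenvalue of `e`. -/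
lemma isUnit_sub_iff_isUnit_add_smul_proj (he : ‖e‖ = 1) (hAe : A e = 0) {t l : ℂ} (hl : l ≠ 0)
    (htl : t ≠ l) : IsUnit (algebraMap ℂ (H →L[ℂ] H) l - (A + t • rankOneProj e)) ↔
    IsUnit (algebraMap ℂ (H →L[ℂ] H) l - A) := by
  have hPP : rankOneProj e * rankOneProj e = rankOneProj e := by
    ext x
    simp [rankOneProj_apply, he]
  have hAP : A * rankOneProj e = 0 := by
    ext x
    simp [rankOneProj_apply, hAe]
  have hlt : l - t ≠ 0 := sub_ne_zero.2 htl.symm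
  set P := rankOneProj e
  have hfac : algebraMap ℂ (H →L[ℂ] H) l - A =
      (algebraMap ℂ (H →L[ℂ] H) l - (A + t • P)) * (1 + (t / (l - t)) • P) := by
    rw [Algebra.algebraMap_eq_smul_one]
    simp only [sub_mul, add_mul, mul_add, mul_one, smul_mul_assoc, one_mul, mul_smul_comm, hAP,
      hPP]
    have h1 : (t / (l - t)) • (l • P - (0 + t • P)) = t • P := by
      rw [zero_add, ← sub_smul, smul_smul, div_mul_cancel₀ _ hlt]
    rw [h1]
    abel
  have hU : IsUnit (1 + (t / (l - t)) • P) := by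
    have hc1 : t / (l - t) + (-(t / l)) + (t / (l - t)) * (-(t / l)) = 0 := by field_simp; ring
    have hm : ∀ a b : ℂ, a + b + a * b = 0 → (1 + a • P) * (1 + b • P) = 1 := fun a b hab => by
      have : (1 + a • P) * (1 + b • P) = 1 + (a + b + a * b) • P := by
        simp only [add_mul, mul_add, mul_one, one_mul, smul_mul_assoc, mul_smul_comm, hPP]
        module
      rw [this, hab, zero_smul, add_zero]
    exact ⟨⟨_, 1 + (-(t / l)) • P, hm _ _ hc1, hm _ _ (by rw [← hc1]; ring)⟩, rfl⟩
  obtain ⟨U, hU⟩ := hU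
  rw [hfac, ← hU, Units.isUnit_mul_units]

variable [CompleteSpace H]

/-- A lower bound for the form on the complement of the kernel vector `e` separates `0` from the
rest of the spectrum. -/
lemma le_norm_of_mem_spectrum (hsym : ∀ x y, ⟪A x, y⟫ = ⟪x, A y⟫) (he : ‖e‖ = 1) (hAe : A e = 0)
    (hA : ∀ u, ⟪e, u⟫ = 0 → γ * ‖u‖ ^ 2 ≤ (⟪u, A u⟫).re) {l : ℂ}
    (hl : l ∈ spectrum ℂ A) (hl0 : l ≠ 0) : γ ≤ ‖l‖ := by
  by_contra! hlt
  refine hl ((isUnit_sub_iff_isUnit_add_smul_proj (t := (γ : ℂ)) he hAe hl0 ?_).1 ?_)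
  · rintro rfl
    rw [Complex.norm_real] at hlt
    exact absurd (Real.le_norm_self γ) (not_le.2 hlt)
  · rw [IsUnit.sub_iff]
    refine isUnit_of_coercive (sub_pos.2 hlt) fun u => ?_
    have h1 := re_inner_add_smul_proj hsym he hAe γ hA le_rfl u
    have h2 : (⟪u, l • u⟫).re ≤ ‖l‖ * ‖u‖ ^ 2 := by
      refine (re_inner_le _ _).trans_eq ?_
      rw [norm_smul]; ring
    rw [sub_apply, inner_sub_right, Complex.sub_re, Algebra.algebraMap_eq_smul_one, smul_apply,
      one_apply_eq_self]
    linarith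

lemma isSelfAdjoint_of_symm (hsym : ∀ x y, ⟪A x, y⟫ = ⟪x, A y⟫) : IsSelfAdjoint A :=
  ContinuousLinearMap.isSelfAdjoint_iff_isSymmetric.2 hsym

/-- The distance from `0` to the rest of the spectrum is at least the lower bound of the form on
the complement of the kernel vector. -/
lemma le_infDist_spectrum (hsym : ∀ x y, ⟪A x, y⟫ = ⟪x, A y⟫) (he : ‖e‖ = 1) (hAe : A e = 0)
    (hγ : 0 < γ) (hA : ∀ u, ⟪e, u⟫ = 0 → γ * ‖u‖ ^ 2 ≤ (⟪u, A u⟫).re)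
    (hex : ∃ v, ⟪e, v⟫ = 0 ∧ v ≠ 0) :
    γ ≤ Metric.infDist (0 : ℂ) (spectrum ℂ A \ {0}) := by
  -- `Metric.infDist` to the empty set is `0`, so the set has to be shown to be nonempty
  have hne : (spectrum ℂ A \ {0}).Nonempty := by
    by_contra hemp
    rw [Set.not_nonempty_iff_eq_empty, Set.sdiff_eq_empty] at hemp
    have hr := (isSelfAdjoint_of_symm hsym).spectralRadius_eq_nnnorm
    have h0 : spectralRadius ℂ A = 0 := by
      refine le_antisymm (iSup₂_le fun k hk => ?_) bot_le
      rw [Set.mem_singleton_iff.1 (hemp hk)]; simp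
    rw [h0] at hr
    have hA0 : A = 0 := by simpa using hr.symm
    obtain ⟨v, hv, hv0⟩ := hex
    have h1 := hA v hv
    rw [hA0] at h1
    simp only [zero_apply, inner_zero_right, Complex.zero_re] at h1
    have : 0 < ‖v‖ := norm_pos_iff.2 hv0
    have : 0 < γ * ‖v‖ ^ 2 := by positivity
    linarith
  rw [Metric.le_infDist hne]
  rintro l ⟨hl, hl0⟩
  rw [dist_zero_left]
  exact le_norm_of_mem_spectrum hsym he hAe hA hl hl0

/-- On the complement of the kernel vector the form is bounded from below by the distance from `0`
to the rest of the spectrum. -/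
lemma infDist_spectrum_mul_le (hsym : ∀ x y, ⟪A x, y⟫ = ⟪x, A y⟫) (he : ‖e‖ = 1) (hAe : A e = 0)
    (hγ : 0 < γ) (hA : ∀ u, ⟪e, u⟫ = 0 → γ * ‖u‖ ^ 2 ≤ (⟪u, A u⟫).re)
    (hex : ∃ v, ⟪e, v⟫ = 0 ∧ v ≠ 0) {u : H} (hu : ⟪e, u⟫ = 0) :
    Metric.infDist (0 : ℂ) (spectrum ℂ A \ {0}) * ‖u‖ ^ 2 ≤ (⟪u, A u⟫).re := by
  have hγd := le_infDist_spectrum hsym he hAe hγ hA hex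
  set δ := Metric.infDist (0 : ℂ) (spectrum ℂ A \ {0}) with hδ
  -- `B` agrees with `A` on the complement of `e`; the eigenvalue of `e` is moved from `0` to `δ`
  set B := A + (δ : ℂ) • rankOneProj e with hB
  have hBsym : ∀ x y, ⟪B x, y⟫ = ⟪x, B y⟫ := fun x y => by
    simp only [hB, add_apply, smul_apply, rankOneProj_apply, inner_add_left, inner_add_right,
      inner_smul_left, inner_smul_right, hsym, Complex.conj_ofReal, inner_conj_symm]
    ring
  have hBc := re_inner_add_smul_proj hsym he hAe δ hA hγd
  have hspec : ∀ x ∈ spectrum ℝ B, δ ≤ x := by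
    intro x hx
    by_contra! hlt
    have hx' : (x : ℂ) ∈ spectrum ℂ B := (spectrum.algebraMap_mem_iff ℂ).2 hx
    rcases lt_or_ge x γ with hxγ | hxγ
    · refine hx' ?_
      rw [spectrum.mem_resolventSet_iff, IsUnit.sub_iff]
      refine isUnit_of_coercive (sub_pos.2 hxγ) fun u => ?_
      have h1 := hBc u
      have h2 : (⟪u, (x : ℂ) • u⟫).re = x * ‖u‖ ^ 2 := by
        rw [inner_smul_right, Complex.re_ofReal_mul, inner_self_re]
      rw [sub_apply, inner_sub_right, Complex.sub_re, Algebra.algebraMap_eq_smul_one, smul_apply,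
        one_apply_eq_self, h2]
      linarith
    · have hx0 : 0 < x := hγ.trans_le hxγ
      have hxA : (x : ℂ) ∈ spectrum ℂ A := by
        by_contra hn
        refine hx' ?_
        exact (isUnit_sub_iff_isUnit_add_smul_proj he hAe (by exact_mod_cast hx0.ne')
          (by exact_mod_cast hlt.ne')).2 (spectrum.notMem_iff.1 hn)
      have h1 : δ ≤ dist (0 : ℂ) x :=
        Metric.infDist_le_dist_of_mem ⟨hxA, by simpa using hx0.ne'⟩
      rw [dist_zero_left, Complex.norm_real, Real.norm_of_nonneg hx0.le] at h1
      linarith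
  have hle : algebraMap ℝ (H →L[ℂ] H) δ ≤ B :=
    algebraMap_le_of_le_spectrum hspec (isSelfAdjoint_of_symm hBsym)
  have hpos := ((ContinuousLinearMap.le_def _ _).1 hle).re_inner_nonneg_right u
  have h3 : (⟪u, algebraMap ℝ (H →L[ℂ] H) δ u⟫).re = δ * ‖u‖ ^ 2 := by
    rw [Algebra.algebraMap_eq_smul_one, smul_apply, one_apply_eq_self,
      ← Complex.coe_smul, inner_smul_right, Complex.re_ofReal_mul, inner_self_re]
  have h4 : B u = A u := by
    rw [hB, add_apply, smul_apply, rankOneProj_apply, hu, zero_smul, smul_zero, add_zero]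
  rw [sub_apply, inner_sub_right, map_sub, h4] at hpos
  change 0 ≤ (⟪u, A u⟫).re - (⟪u, algebraMap ℝ (H →L[ℂ] H) δ u⟫).re at hpos
  linarith

end Spectrum

end NonlocalHom

/-! ### Elementary trigonometric inequalities -/

namespace NonlocalHom

lemma one_sub_le_cos {t : ℝ} (ht : 0 ≤ t) : 1 - t ≤ Real.cos t := by
  rcases le_total t 2 with h | h
  · have := Real.one_sub_sq_div_two_le_cos (x := t)
    nlinarith
  · have := Real.neg_one_le_cos t
    linarith

lemma sub_sq_le_sin {t : ℝ} (ht : 0 ≤ t) : t - t ^ 2 / 2 ≤ Real.sin t := by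
  have hd : ∀ x : ℝ, HasDerivAt (fun x => Real.sin x - (x - x ^ 2 / 2))
      (Real.cos x - (1 - x)) x := fun x => by
    have := (Real.hasDerivAt_sin x).sub ((hasDerivAt_id x).sub ((hasDerivAt_pow 2 x).div_const 2))
    convert! this using 1
    simp
  have hm : MonotoneOn (fun x => Real.sin x - (x - x ^ 2 / 2)) (Set.Ici 0) := by
    refine monotoneOn_of_deriv_nonneg (convex_Ici 0) (by fun_prop)
      (fun x _ => (hd x).differentiableAt.differentiableWithinAt) fun x hx => ?_
    rw [interior_Ici, Set.mem_Ioi] at hx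
    rw [(hd x).deriv, sub_nonneg]
    exact one_sub_le_cos hx.le
  have := hm (Set.mem_Ici.2 le_rfl) (Set.mem_Ici.2 ht) ht
  simp only [Real.sin_zero] at this
  linarith

lemma cos_le_taylor_of_nonneg {t : ℝ} (ht : 0 ≤ t) :
    Real.cos t ≤ 1 - t ^ 2 / 2 + t ^ 3 / 6 := by
  have hd : ∀ x : ℝ, HasDerivAt (fun x => (1 - x ^ 2 / 2 + x ^ 3 / 6) - Real.cos x)
      (Real.sin x - (x - x ^ 2 / 2)) x := fun x => by
    have := ((((hasDerivAt_const x (1 : ℝ)).sub ((hasDerivAt_pow 2 x).div_const 2)).add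
      ((hasDerivAt_pow 3 x).div_const 6))).sub (Real.hasDerivAt_cos x)
    convert! this using 1
    simp; ring
  have hm : MonotoneOn (fun x => (1 - x ^ 2 / 2 + x ^ 3 / 6) - Real.cos x) (Set.Ici 0) := by
    refine monotoneOn_of_deriv_nonneg (convex_Ici 0) (by fun_prop)
      (fun x _ => (hd x).differentiableAt.differentiableWithinAt) fun x hx => ?_
    rw [interior_Ici, Set.mem_Ioi] at hx
    rw [(hd x).deriv, sub_nonneg]
    exact sub_sq_le_sin hx.le
  have := hm (Set.mem_Ici.2 le_rfl) (Set.mem_Ici.2 ht) ht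
  simp only [Real.cos_zero] at this
  linarith

lemma cos_le_taylor (t : ℝ) : Real.cos t ≤ 1 - t ^ 2 / 2 + |t| ^ 3 / 6 := by
  have := cos_le_taylor_of_nonneg (abs_nonneg t)
  rwa [Real.cos_abs, sq_abs] at this

lemma abs_one_sub_cos_sub_le (t : ℝ) : |1 - Real.cos t - t ^ 2 / 2| ≤ |t| ^ 3 / 6 := by
  have h1 := cos_le_taylor t
  have h2 := Real.one_sub_sq_div_two_le_cos (x := t)
  have h3 : 0 ≤ |t| ^ 3 / 6 := by positivity
  rw [abs_le]; constructor <;> linarith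

lemma abs_sub_sin_le (t : ℝ) : |t - Real.sin t| ≤ t ^ 2 / 2 := by
  have key : ∀ s : ℝ, 0 ≤ s → |s - Real.sin s| ≤ s ^ 2 / 2 := fun s hs => by
    have h1 := sub_sq_le_sin hs
    have h2 := Real.sin_le hs
    rw [abs_le]; constructor <;> nlinarith
  rcases le_total 0 t with h | h
  · exact key t h
  · have := key (-t) (by linarith)
    rw [Real.sin_neg, neg_sq, ← abs_neg] at this
    convert this using 2; ring

lemma exp_neg_I_mul (t : ℝ) :
    Complex.exp (-Complex.I * (t : ℝ)) = ⟨Real.cos t, -Real.sin t⟩ := by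
  have h : -Complex.I * (t : ℂ) = ((-t : ℝ) : ℂ) * Complex.I := by push_cast; ring
  rw [h, Complex.exp_mul_I, ← Complex.ofReal_cos, ← Complex.ofReal_sin, Real.cos_neg,
    Real.sin_neg]
  apply Complex.ext <;> simp [-Complex.ofReal_cos, -Complex.ofReal_sin]

lemma norm_one_sub_exp_sub_le (t : ℝ) :
    ‖1 - Complex.exp (-Complex.I * (t : ℝ)) - Complex.I * t‖ ≤ t ^ 2 := by
  refine (Complex.norm_le_abs_re_add_abs_im _).trans ?_
  rw [exp_neg_I_mul]
  simp only [Complex.sub_re, Complex.sub_im, Complex.one_re, Complex.one_im, Complex.mul_re,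
    Complex.mul_im, Complex.I_re, Complex.I_im, Complex.ofReal_re, Complex.ofReal_im]
  have h1 := abs_sub_sin_le t
  have h2 := Real.one_sub_sq_div_two_le_cos (x := t)
  have h3 := Real.cos_le_one t
  rw [abs_sub_comm] at h1
  have e1 : |1 - Real.cos t - (0 * t - 1 * 0)| ≤ t ^ 2 / 2 := by
    rw [abs_le]; constructor <;> nlinarith [sq_nonneg t]
  have e2 : |0 - -Real.sin t - (0 * 0 + 1 * t)| ≤ t ^ 2 / 2 := by
    convert h1 using 2; ring
  exact (add_le_add e1 e2).trans_eq (add_halves _)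

lemma norm_exp_neg_I_mul (t : ℝ) : ‖Complex.exp (-Complex.I * (t : ℝ))‖ = 1 := by
  rw [Complex.norm_exp]; simp

lemma norm_exp_neg_I_mul_sub_one_le (t : ℝ) :
    ‖Complex.exp (-Complex.I * (t : ℝ)) - 1‖ ≤ |t| := by
  have h : Complex.exp (-Complex.I * (t : ℝ)) = Complex.exp (Complex.I * ((-t : ℝ) : ℂ)) := by
    congr 1; push_cast; ring
  rw [h]
  refine (Real.norm_exp_I_mul_ofReal_sub_one_le).trans_eq ?_
  rw [norm_neg, Real.norm_eq_abs]

/-! ### Positivity of the constants -/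

lemma volume_inner_eq_zero {d : ℕ} {y : Rd d} (hy : y ≠ 0) (t : ℝ) :
    volume {z : Rd d | inner ℝ z y = t} = 0 := by
  have h0 : volume ((LinearMap.ker (innerSL ℝ y : Rd d →ₗ[ℝ] ℝ) : Submodule ℝ (Rd d)) :
      Set (Rd d)) = 0 := by
    refine Measure.addHaar_submodule volume _ fun htop => hy ?_
    have : y ∈ LinearMap.ker (innerSL ℝ y : Rd d →ₗ[ℝ] ℝ) := by rw [htop]; trivial
    simpa using this
  have hyy : inner ℝ y y ≠ 0 := by simpa using hy
  rw [← (measurePreserving_sub_right volume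
    ((t / inner ℝ y y) • y)).measure_preimage_emb
      (MeasurableEquiv.subRight ((t / inner ℝ y y) • y)).measurableEmbedding] at h0
  rw [← h0]
  congr 1
  ext z
  simp only [Set.mem_ofPred_eq, Set.mem_preimage, SetLike.mem_coe, LinearMap.mem_ker,
    ContinuousLinearMap.coe_coe, innerSL_apply_apply, inner_sub_right, inner_smul_right]
  rw [div_mul_cancel₀ _ hyy, sub_eq_zero, real_inner_comm]

namespace Coefficients

variable {d : ℕ} (c : Coefficients d)

lemma norm_pow_mul_integrable {k : ℕ} (hk : k ≤ 3) : Integrable fun x => ‖x‖ ^ k * c.a x := by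
  rcases Nat.eq_zero_or_pos k with rfl | h
  · simpa using c.a_integrable
  · exact c.moment_integrable k (by simp; omega)

/-- The integral of `a` against a weight that is positive almost everywhere is positive. -/
lemma integral_mul_a_pos {w : Rd d → ℝ} (hw : ∀ᵐ z, 0 < w z)
    (hint : Integrable fun z => w z * c.a z) : 0 < ∫ z, w z * c.a z := by
  rw [integral_pos_iff_support_of_nonneg_ae ?_ hint]
  · refine c.a_nontrivial.trans_le (measure_mono_ae ?_)
    filter_upwards [hw] with z hz ha
    exact mul_ne_zero hz.ne' ha
  · filter_upwards [hw, c.a_nonneg] with z hz ha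
    exact mul_nonneg hz.le ha

lemma ae_ne_zero (hd : 1 ≤ d) : ∀ᵐ z : Rd d, z ≠ 0 := by
  have : Nonempty (Fin d) := ⟨⟨0, hd⟩⟩
  have : Nontrivial (Rd d) := inferInstance
  exact Measure.ae_ne volume 0

lemma M_pos (hd : 1 ≤ d) {k : ℕ} (hk : k ≤ 3) : 0 < c.M k := by
  refine c.integral_mul_a_pos ?_ (c.norm_pow_mul_integrable hk)
  filter_upwards [ae_ne_zero hd] with z hz
  have := norm_pos_iff.2 hz
  positivity

lemma muMinus_le_muPlus : c.muMinus ≤ c.muPlus := by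
  obtain ⟨z, hz⟩ := c.mu_bounds.exists
  exact hz.1.trans hz.2

lemma muPlus_pos : 0 < c.muPlus := c.muMinus_pos.trans_le c.muMinus_le_muPlus

lemma Ahat_integrable (y : Rd d) :
    Integrable fun z => (1 - Real.cos (inner ℝ z y)) * c.a z := by
  refine c.a_integrable.bdd_mul (c := 2) (by fun_prop) (.of_forall fun z => ?_)
  rw [Real.norm_eq_abs, abs_le]
  constructor <;> linarith [Real.cos_le_one (inner ℝ z y), Real.neg_one_le_cos (inner ℝ z y)]

lemma cos_mul_integrable (y : Rd d) :
    Integrable fun z => Real.cos (inner ℝ z y) * c.a z :=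
  c.a_integrable.bdd_mul (c := 1) (by fun_prop) (.of_forall fun z => Real.abs_cos_le_one _)

lemma Ahat_nonneg (y : Rd d) : 0 ≤ c.Ahat y := by
  refine integral_nonneg_of_ae ?_
  filter_upwards [c.a_nonneg] with z hz
  exact mul_nonneg (by linarith [Real.cos_le_one (inner ℝ z y)]) hz

lemma Ahat_pos {y : Rd d} (hy : y ≠ 0) : 0 < c.Ahat y := by
  refine c.integral_mul_a_pos ?_ (c.Ahat_integrable y)
  have : ∀ᵐ z : Rd d, ∀ n : ℤ, inner ℝ z y ≠ (n : ℝ) * (2 * Real.pi) :=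
    ae_all_iff.2 fun n => by
      rw [ae_iff]; simpa using volume_inner_eq_zero hy _
  filter_upwards [this] with z hz
  rw [sub_pos]
  refine (Real.cos_le_one _).lt_of_ne fun h => ?_
  obtain ⟨n, hn⟩ := (Real.cos_eq_one_iff _).1 h
  exact hz n hn.symm

lemma continuous_Ahat : Continuous c.Ahat := by
  refine continuous_of_dominated (bound := fun z => 2 * ‖c.a z‖)
    (fun y => (c.Ahat_integrable y).1) (fun y => .of_forall fun z => ?_)
    (c.a_integrable.norm.const_mul 2) (.of_forall fun z => by fun_prop)
  rw [norm_mul]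
  gcongr
  rw [Real.norm_eq_abs, abs_le]
  constructor <;> linarith [Real.cos_le_one (inner ℝ z y), Real.neg_one_le_cos (inner ℝ z y)]

lemma Ahat_eq (y : Rd d) : c.Ahat y = c.M 0 - ∫ z, Real.cos (inner ℝ z y) * c.a z := by
  rw [M, ← integral_sub (c.norm_pow_mul_integrable (by norm_num)) (c.cos_mul_integrable y)]
  refine integral_congr_ae (.of_forall fun z => ?_)
  simp only [pow_zero]; ring

/-- By the Riemann–Lebesgue lemma, `Â` tends to `∫ a` at infinity. -/
lemma tendsto_Ahat : Filter.Tendsto c.Ahat (Filter.cocompact (Rd d)) (nhds (c.M 0)) := by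
  have h1 := tendsto_integral_exp_inner_smul_cocompact (V := Rd d) (fun z => (c.a z : ℂ))
  have hs : Filter.Tendsto (fun y : Rd d => (2 * Real.pi)⁻¹ • y) (Filter.cocompact (Rd d))
      (Filter.cocompact (Rd d)) :=
    (Homeomorph.smulOfNeZero ((2 * Real.pi)⁻¹ : ℝ)
      (by positivity)).isClosedEmbedding.tendsto_cocompact
  have h2 := (Complex.continuous_re.tendsto 0).comp (h1.comp hs)
  have h3 : ∀ y : Rd d, Complex.re (∫ z, Real.fourierChar (-inner ℝ z ((2 * Real.pi)⁻¹ • y)) •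
      (c.a z : ℂ)) = ∫ z, Real.cos (inner ℝ z y) * c.a z := fun y => by
    have hpt : ∀ z : Rd d, Real.fourierChar (-inner ℝ z ((2 * Real.pi)⁻¹ • y)) • (c.a z : ℂ) =
        Complex.exp (-Complex.I * (inner ℝ z y : ℝ)) * c.a z := fun z => by
      rw [Circle.smul_def, Real.fourierChar_apply, inner_smul_right, smul_eq_mul]
      congr 2
      push_cast
      field_simp
    simp only [hpt]
    have hint : Integrable fun z => Complex.exp (-Complex.I * (inner ℝ z y : ℝ)) * (c.a z : ℂ) :=
      c.a_integrable.ofReal.bdd_mul (c := 1)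
        (Continuous.aestronglyMeasurable (by fun_prop))
        (.of_forall fun z => (norm_exp_neg_I_mul _).le)
    have := integral_re hint
    simp only [RCLike.re_eq_complex_re] at this
    rw [← this]
    refine integral_congr_ae (.of_forall fun z => ?_)
    simp only [exp_neg_I_mul, Complex.mul_re, Complex.ofReal_re, Complex.ofReal_im, mul_zero,
      sub_zero]
  have h4 : Filter.Tendsto (fun y : Rd d => ∫ z, Real.cos (inner ℝ z y) * c.a z)
      (Filter.cocompact (Rd d)) (nhds 0) := by
    refine (h2.congr fun y => ?_)
    exact h3 y
  have h5 := h4.const_sub (c.M 0)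
  rw [sub_zero] at h5
  exact h5.congr fun y => (c.Ahat_eq y).symm

lemma calA_le {r : ℝ} {y : Rd d} (hy : r ≤ ‖y‖) : c.calA r ≤ c.Ahat y :=
  csInf_le ⟨0, by rintro _ ⟨y, -, rfl⟩; exact c.Ahat_nonneg y⟩ ⟨y, hy, rfl⟩

lemma exists_norm_eq_one (hd : 1 ≤ d) : ∃ θ : Rd d, ‖θ‖ = 1 :=
  ⟨EuclideanSpace.single ⟨0, hd⟩ 1, by simp⟩

/-- The infimum `𝒜_r` is positive: `Â` is close to `∫ a > 0` outside a compact set, and on the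
compact set it attains a positive minimum. -/
lemma calA_pos (hd : 1 ≤ d) {r : ℝ} (hr : 0 < r) : 0 < c.calA r := by
  have hM : 0 < c.M 0 := c.M_pos hd (by norm_num)
  have hev : ∀ᶠ y in Filter.cocompact (Rd d), c.M 0 / 2 < c.Ahat y :=
    c.tendsto_Ahat.eventually (lt_mem_nhds (by linarith))
  obtain ⟨K, hK, hKs⟩ := Filter.mem_cocompact.1 hev
  have hcl : IsClosed {y : Rd d | r ≤ ‖y‖} := isClosed_le continuous_const continuous_norm
  obtain ⟨θ, hθ⟩ := exists_norm_eq_one hd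
  have hne : (c.Ahat '' {y | r ≤ ‖y‖}).Nonempty :=
    ⟨_, r • θ, by simp [norm_smul, hθ, le_abs_self], rfl⟩
  have hm : ∃ m > 0, ∀ y, r ≤ ‖y‖ → m ≤ c.Ahat y := by
    rcases (K ∩ {y | r ≤ ‖y‖}).eq_empty_or_nonempty with he | he
    · refine ⟨c.M 0 / 2, by positivity, fun y hy => le_of_lt ?_⟩
      exact hKs fun hyK => (Set.notMem_empty y) (he ▸ ⟨hyK, hy⟩)
    · obtain ⟨y₀, hy₀, hmin⟩ := (hK.inter_right hcl).exists_isMinOn he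
        c.continuous_Ahat.continuousOn
      have hy₀' : y₀ ≠ 0 := by
        rintro rfl
        have := hy₀.2
        rw [Set.mem_ofPred_eq, norm_zero] at this
        linarith
      refine ⟨min (c.M 0 / 2) (c.Ahat y₀), lt_min (by positivity) (c.Ahat_pos hy₀'), fun y hy => ?_⟩
      by_cases hyK : y ∈ K
      · exact (min_le_right _ _).trans (hmin ⟨hyK, hy⟩)
      · exact (min_le_left _ _).trans (le_of_lt (hKs hyK))
  obtain ⟨m, hm0, hm⟩ := hm
  refine hm0.trans_le (le_csInf hne ?_)
  rintro _ ⟨y, hy, rfl⟩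
  exact hm y hy

lemma inner_sq_mul_integrable (θ : Rd d) : Integrable fun z => c.a z * (inner ℝ z θ) ^ 2 := by
  refine (((c.norm_pow_mul_integrable (k := 2) (by norm_num)).norm).const_mul (‖θ‖ ^ 2)).mono'
    (c.a_integrable.1.mul (by fun_prop)) (.of_forall fun z => ?_)
  rw [norm_mul, norm_mul, norm_pow, norm_pow, norm_norm]
  have : ‖(inner ℝ z θ : ℝ)‖ ≤ ‖z‖ * ‖θ‖ := norm_inner_le_norm z θ
  calc ‖c.a z‖ * ‖(inner ℝ z θ : ℝ)‖ ^ 2 ≤ ‖c.a z‖ * (‖z‖ * ‖θ‖) ^ 2 := by gcongr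
    _ = _ := by ring

/-- The quadratic form `θ ↦ ∫ a(z) ⟨z,θ⟩² dz`. -/
noncomputable def secondMoment (θ : Rd d) : ℝ := ∫ z, c.a z * (inner ℝ z θ) ^ 2

lemma secondMoment_pos {θ : Rd d} (hθ : θ ≠ 0) : 0 < c.secondMoment θ := by
  have h := c.inner_sq_mul_integrable θ
  simp only [secondMoment]
  simp only [mul_comm (c.a _)] at h ⊢
  refine c.integral_mul_a_pos ?_ h
  have : ∀ᵐ z : Rd d, inner ℝ z θ ≠ 0 := by
    rw [ae_iff]; simpa using volume_inner_eq_zero hθ 0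
  filter_upwards [this] with z hz
  positivity

lemma secondMoment_smul (t : ℝ) (θ : Rd d) :
    c.secondMoment (t • θ) = t ^ 2 * c.secondMoment θ := by
  rw [secondMoment, secondMoment, ← integral_const_mul]
  refine integral_congr_ae (.of_forall fun z => ?_)
  simp only [inner_smul_right]; ring

lemma continuousOn_secondMoment : ContinuousOn c.secondMoment {θ | ‖θ‖ = 1} := by
  refine continuousOn_of_dominated (bound := fun z => ‖‖z‖ ^ 2 * c.a z‖)
    (fun θ _ => (c.inner_sq_mul_integrable θ).1) (fun θ hθ => .of_forall fun z => ?_)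
    (c.norm_pow_mul_integrable (by norm_num)).norm (.of_forall fun z => by fun_prop)
  rw [norm_mul, norm_mul, norm_pow, norm_pow, norm_norm, mul_comm]
  have : ‖(inner ℝ z θ : ℝ)‖ ≤ ‖z‖ * ‖θ‖ := norm_inner_le_norm z θ
  rw [show ‖θ‖ = 1 from hθ, mul_one] at this
  gcongr

lemma calM_pos (hd : 1 ≤ d) : 0 < c.calM := by
  obtain ⟨θ, hθ⟩ := exists_norm_eq_one hd
  have hK : IsCompact {θ : Rd d | ‖θ‖ = 1} := by
    have := isCompact_sphere (0 : Rd d) 1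
    rwa [show Metric.sphere (0 : Rd d) 1 = {θ | ‖θ‖ = 1} by ext; simp] at this
  obtain ⟨θ₀, hθ₀, hmin⟩ := hK.exists_isMinOn ⟨θ, hθ⟩ c.continuousOn_secondMoment
  have h0 : θ₀ ≠ 0 := by
    rintro rfl
    simp at hθ₀
  refine (c.secondMoment_pos h0).trans_le (le_csInf ⟨_, θ, hθ, rfl⟩ ?_)
  rintro _ ⟨y, hy, rfl⟩
  exact hmin hy

lemma calM_mul_le (ξ : Rd d) : c.calM * ‖ξ‖ ^ 2 ≤ c.secondMoment ξ := by
  by_cases h : ξ = 0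
  · subst h; simp [secondMoment]
  · have hn : 0 < ‖ξ‖ := norm_pos_iff.2 h
    have h1 : c.calM ≤ c.secondMoment (‖ξ‖⁻¹ • ξ) := by
      refine csInf_le ⟨0, ?_⟩ ⟨‖ξ‖⁻¹ • ξ, ?_, rfl⟩
      · rintro _ ⟨y, -, rfl⟩
        refine integral_nonneg_of_ae ?_
        filter_upwards [c.a_nonneg] with z hz
        exact mul_nonneg hz (sq_nonneg _)
      · rw [Set.mem_ofPred_eq, norm_smul, norm_inv, norm_norm, inv_mul_cancel₀ hn.ne']
    rw [c.secondMoment_smul] at h1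
    calc c.calM * ‖ξ‖ ^ 2 ≤ ((‖ξ‖⁻¹) ^ 2 * c.secondMoment ξ) * ‖ξ‖ ^ 2 := by gcongr
      _ = c.secondMoment ξ := by field_simp

lemma rad_pos (hd : 1 ≤ d) : 0 < c.rad := by
  have h1 := c.calM_pos hd
  have h2 := c.M_pos hd (k := 3) le_rfl
  rw [rad]; positivity

/-- Near the origin `Â` is bounded from below by a quarter of the minimal second moment. -/
lemma calM_div_four_le_Ahat (hd : 1 ≤ d) {ξ : Rd d} (hξ : ‖ξ‖ ≤ c.rad) :
    c.calM / 4 * ‖ξ‖ ^ 2 ≤ c.Ahat ξ := by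
  have hM3 := c.M_pos hd (k := 3) le_rfl
  have hint1 := (c.inner_sq_mul_integrable ξ).const_mul (1 / 2)
  have hint2 := (c.norm_pow_mul_integrable (k := 3) le_rfl).const_mul (‖ξ‖ ^ 3 / 6)
  have h1 : 1 / 2 * c.secondMoment ξ - ‖ξ‖ ^ 3 / 6 * c.M 3 ≤ c.Ahat ξ := by
    rw [secondMoment, M, ← integral_const_mul, ← integral_const_mul, ← integral_sub hint1 hint2]
    refine integral_mono_ae (hint1.sub hint2) (c.Ahat_integrable ξ) ?_
    filter_upwards [c.a_nonneg] with z hz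
    have h2 := cos_le_taylor (inner ℝ z ξ)
    have h3 : |(inner ℝ z ξ : ℝ)| ^ 3 ≤ (‖z‖ * ‖ξ‖) ^ 3 := by
      gcongr; exact abs_real_inner_le_norm z ξ
    have h4 : (inner ℝ z ξ) ^ 2 / 2 - (‖z‖ * ‖ξ‖) ^ 3 / 6 ≤ 1 - Real.cos (inner ℝ z ξ) := by
      linarith
    calc 1 / 2 * (c.a z * inner ℝ z ξ ^ 2) - ‖ξ‖ ^ 3 / 6 * (‖z‖ ^ 3 * c.a z)
        = ((inner ℝ z ξ) ^ 2 / 2 - (‖z‖ * ‖ξ‖) ^ 3 / 6) * c.a z := by ring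
      _ ≤ _ := by gcongr
  have h2 := c.calM_mul_le ξ
  have h3 : ‖ξ‖ * c.M 3 ≤ 3 / 2 * c.calM := by
    calc ‖ξ‖ * c.M 3 ≤ c.rad * c.M 3 := by gcongr
      _ = 3 / 2 * c.calM := by rw [rad]; field_simp
  nlinarith [sq_nonneg ‖ξ‖, mul_le_mul_of_nonneg_left h3 (sq_nonneg ‖ξ‖)]

lemma Ca_pos (hd : 1 ≤ d) : 0 < c.Ca := by
  have h1 := c.calM_pos hd
  have h2 := c.calA_pos hd (c.rad_pos hd)
  have h3 := c.calA_pos hd Real.pi_pos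
  have h4 : (0 : ℝ) < d := by exact_mod_cast hd
  rw [Ca, constC]
  refine lt_min (by positivity) (lt_min (by positivity) (by positivity))

lemma delta0_pos (hd : 1 ≤ d) : 0 < c.delta0 := by
  have h1 := c.calA_pos hd Real.pi_pos
  have h2 := c.M_pos hd (k := 1) (by norm_num)
  have h3 := c.muPlus_pos
  have h4 := c.muMinus_pos
  rw [delta0]
  refine lt_min one_pos (by positivity)

lemma mul_inv_pi_sq_mul_inv_le (hd : 1 ≤ d) {A t : ℝ} (hA : 0 ≤ A) (ht : 0 ≤ t) (ht1 : t ≤ 1) :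
    A * (Real.pi ^ 2)⁻¹ * (d : ℝ)⁻¹ * t ^ 2 ≤ A := by
  have h4 : (1 : ℝ) ≤ d := by exact_mod_cast hd
  have h5 : (1 : ℝ) ≤ Real.pi ^ 2 := one_le_pow₀ (by linarith [Real.pi_gt_three])
  calc A * (Real.pi ^ 2)⁻¹ * (d : ℝ)⁻¹ * t ^ 2 ≤ A * 1 * 1 * 1 := by
        gcongr
        · exact inv_le_one_of_one_le₀ h5
        · exact inv_le_one_of_one_le₀ h4
        · exact pow_le_one₀ ht ht1
    _ = A := by ring

lemma Ca_mul_le_calA_pi (hd : 1 ≤ d) {ξ : Rd d} (hξ : ‖ξ‖ ≤ 1) :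
    c.Ca * ‖ξ‖ ^ 2 ≤ c.calA Real.pi := by
  refine le_trans ?_ (mul_inv_pi_sq_mul_inv_le hd (c.calA_pos hd Real.pi_pos).le (norm_nonneg ξ) hξ)
  gcongr
  exact (min_le_right _ _).trans (min_le_right _ _)

lemma Ca_mul_le_Ahat (hd : 1 ≤ d) {ξ : Rd d} (hξ : ‖ξ‖ ≤ 1) : c.Ca * ‖ξ‖ ^ 2 ≤ c.Ahat ξ := by
  rcases le_total ‖ξ‖ c.rad with h | h
  · refine le_trans ?_ (c.calM_div_four_le_Ahat hd h)
    gcongr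
    exact min_le_left _ _
  · refine le_trans ?_ (c.calA_le h)
    refine le_trans ?_ (mul_inv_pi_sq_mul_inv_le hd (c.calA_pos hd (c.rad_pos hd)).le
      (norm_nonneg ξ) hξ)
    gcongr
    exact (min_le_right _ _).trans (min_le_left _ _)

end Coefficients

end NonlocalHom

/-! ### The Fourier basis of `L₂(Ω)` -/

namespace NonlocalHom

variable {d : ℕ}

/-- The measure on the torus with respect to which Mathlib's Fourier basis is orthonormal. -/
noncomputable def torusMeasure (d : ℕ) : Measure (UnitAddTorus (Fin d)) :=
  Measure.pi fun _ => AddCircle.haarAddCircle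

/-- The covering map from `ℝᵈ` onto the torus. -/
def toTorus (x : Rd d) : UnitAddTorus (Fin d) := fun i => (x i : UnitAddCircle)

/-- The section of the covering map with values in the cell. -/
noncomputable def ofTorus (y : UnitAddTorus (Fin d)) : Rd d :=
  WithLp.toLp 2 fun i => (AddCircle.equivIco 1 0 (y i) : ℝ)

lemma ofTorus_toTorus {x : Rd d} (hx : x ∈ cell d) : ofTorus (toTorus x) = x := by
  ext i
  have : (x i : ℝ) ∈ Set.Ico (0 : ℝ) (0 + 1) := by simpa using hx i
  exact AddCircle.equivIco_coe_of_mem this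

lemma measurable_ofTorus : Measurable (ofTorus (d := d)) := by
  refine (MeasurableEquiv.toLp 2 (Fin d → ℝ)).measurable.comp (measurable_pi_lambda _ fun i => ?_)
  exact measurable_subtype_coe.comp
    ((AddCircle.measurableEquivIco 1 0).measurable.comp (measurable_pi_apply i))

lemma measurePreserving_toTorus :
    MeasurePreserving (toTorus (d := d)) (cellMeasure d) (torusMeasure d) := by
  have e : cell d = (WithLp.ofLp : Rd d → (Fin d → ℝ)) ⁻¹'
      (Set.pi Set.univ fun _ : Fin d => Set.Ico (0 : ℝ) 1) := by
    ext x; simp [cell]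
  have h1 := (PiLp.volume_preserving_ofLp (Fin d)).restrict_preimage
    (s := Set.pi Set.univ fun _ : Fin d => Set.Ico (0 : ℝ) 1)
    (MeasurableSet.univ_pi fun _ => measurableSet_Ico)
  rw [← e] at h1
  have h2 : (volume : Measure (Fin d → ℝ)).restrict
      (Set.pi Set.univ fun _ : Fin d => Set.Ico (0 : ℝ) 1) =
      Measure.pi fun _ : Fin d => (volume : Measure ℝ).restrict (Set.Ioc 0 (0 + 1)) := by
    rw [volume_pi, Measure.restrict_pi_pi]
    congr 1
    funext i
    rw [zero_add]
    exact Measure.restrict_congr_set Ico_ae_eq_Ioc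
  rw [h2] at h1
  have h3 := measurePreserving_pi (fun _ : Fin d => (volume : Measure ℝ).restrict
    (Set.Ioc 0 (0 + 1))) (fun _ : Fin d => (AddCircle.haarAddCircle : Measure UnitAddCircle))
    (fun i => by
      have := AddCircle.measurePreserving_mk 1 0
      rwa [AddCircle.volume_eq_smul_haarAddCircle, ENNReal.ofReal_one, one_smul] at this)
  exact h3.comp h1

lemma measurePreserving_ofTorus :
    MeasurePreserving (ofTorus (d := d)) (torusMeasure d) (cellMeasure d) := by
  refine ⟨measurable_ofTorus, ?_⟩
  rw [← measurePreserving_toTorus.map_eq,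
    Measure.map_map measurable_ofTorus measurePreserving_toTorus.measurable]
  conv_rhs => rw [← Measure.map_id (μ := cellMeasure d)]
  refine Measure.map_congr ?_
  filter_upwards [ae_restrict_mem (measurableSet_cell d)] with x hx
  exact ofTorus_toTorus hx

/-- Composition with the covering map, as an isometry between the spaces `L₂`. -/
noncomputable def torusIsometry (d : ℕ) : Lp ℂ 2 (torusMeasure d) →ₗᵢ[ℂ] L2cell d :=
  Lp.compMeasurePreservingₗᵢ ℂ toTorus measurePreserving_toTorus

lemma torusIsometry_surjective : Function.Surjective (torusIsometry d) := by
  intro u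
  have hu : MemLp (u ∘ ofTorus) 2 (torusMeasure d) :=
    (Lp.memLp u).comp_measurePreserving measurePreserving_ofTorus
  refine ⟨hu.toLp _, ?_⟩
  refine Lp.ext ?_
  have h1 : torusIsometry d (hu.toLp _) =ᵐ[cellMeasure d] hu.toLp _ ∘ toTorus :=
    Lp.coeFn_compMeasurePreserving _ measurePreserving_toTorus
  have h2 := measurePreserving_toTorus.quasiMeasurePreserving.ae_eq_comp hu.coeFn_toLp
  filter_upwards [h1, h2, ae_restrict_mem (measurableSet_cell d)] with x h1 h2 hx
  rw [h1, h2]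
  simp [ofTorus_toTorus hx]

/-- The orthonormal basis of `L₂(Ω)` that consists of the exponentials `exp(2πi⟨n,x⟩)`. -/
noncomputable def fourierBasis (d : ℕ) : HilbertBasis (Fin d → ℤ) ℂ (L2cell d) :=
  HilbertBasis.ofRepr
    ((LinearIsometryEquiv.ofSurjective (torusIsometry d) torusIsometry_surjective).symm.trans
      (UnitAddTorus.mFourierBasis (d := Fin d)).repr)

lemma inner_latt (n : Fin d → ℤ) (x : Rd d) : inner ℝ (latt n) x = ∑ i, (n i : ℝ) * x i := by
  simp [PiLp.inner_apply, latt, mul_comm]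

lemma fourierBasis_ae (n : Fin d → ℤ) : fourierBasis d n =ᵐ[cellMeasure d]
    fun x => Complex.exp (Complex.I * (2 * Real.pi * inner ℝ (latt n) x : ℝ)) := by
  have h0 : fourierBasis d n = torusIsometry d (UnitAddTorus.mFourierLp 2 n) := by
    rw [← UnitAddTorus.coe_mFourierBasis]
    rw [← (fourierBasis d).repr_symm_single, ← (UnitAddTorus.mFourierBasis).repr_symm_single]
    rfl
  have h1 : torusIsometry d (UnitAddTorus.mFourierLp 2 n) =ᵐ[cellMeasure d]
      UnitAddTorus.mFourierLp 2 n ∘ toTorus :=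
    Lp.coeFn_compMeasurePreserving _ measurePreserving_toTorus
  have h2 := measurePreserving_toTorus.quasiMeasurePreserving.ae_eq_comp
    (UnitAddTorus.coeFn_mFourierLp 2 n)
  rw [h0]
  filter_upwards [h1, h2] with x h1 h2
  rw [h1, h2]
  simp only [Function.comp_apply, UnitAddTorus.mFourier, ContinuousMap.coe_mk, toTorus,
    fourier_coe_apply, inner_latt]
  rw [← Complex.exp_sum]
  congr 1
  push_cast
  rw [Finset.mul_sum, Finset.mul_sum]
  refine Finset.sum_congr rfl fun i _ => ?_
  ring

lemma fourierBasis_zero : fourierBasis d 0 = oneCell d := by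
  refine Lp.ext ?_
  have h : oneCell d =ᵐ[cellMeasure d] fun _ => (1 : ℂ) := Lp.coeFn_const 2 _ _
  filter_upwards [fourierBasis_ae (d := d) 0, h] with x h1 h2
  rw [h1, h2]
  simp [inner_latt]

lemma norm_oneCell : ‖oneCell d‖ = 1 := by
  rw [← fourierBasis_zero]; exact (fourierBasis d).orthonormal.1 0

/-- A symmetric operator that is diagonal in an orthonormal basis, with eigenvalues at least `κ`
on the part of the basis that meets `u`, has form at least `κ‖u‖²` on `u`. -/
lemma le_re_inner_of_diagonal {H ι : Type*} [NormedAddCommGroup H] [InnerProductSpace ℂ H]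
    (b : HilbertBasis ι ℂ H) {A : H →L[ℂ] H} (hsym : ∀ x y, inner ℂ (A x) y = inner ℂ x (A y))
    {l : ι → ℝ} (hl : ∀ n, A (b n) = (l n : ℂ) • b n) {κ : ℝ} {u : H}
    (hκ : ∀ n, inner ℂ (b n) u ≠ 0 → κ ≤ l n) : κ * ‖u‖ ^ 2 ≤ (inner ℂ u (A u)).re := by
  have hterm : ∀ n, inner ℂ u (b n) * inner ℂ (b n) (A u) =
      ((l n * ‖inner ℂ (b n) u‖ ^ 2 : ℝ) : ℂ) := fun n => by
    rw [← hsym, hl, inner_smul_left, Complex.conj_ofReal, ← inner_conj_symm u (b n), mul_left_comm,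
      ← Complex.normSq_eq_conj_mul_self, Complex.normSq_eq_norm_sq]
    push_cast; ring
  have hterm1 : ∀ n, inner ℂ u (b n) * inner ℂ (b n) u = ((‖inner ℂ (b n) u‖ ^ 2 : ℝ) : ℂ) :=
    fun n => by
    rw [← inner_conj_symm u (b n), ← Complex.normSq_eq_conj_mul_self, Complex.normSq_eq_norm_sq]
  have h1 := b.hasSum_inner_mul_inner u (A u)
  have h2 := b.hasSum_inner_mul_inner u u
  simp only [hterm] at h1
  simp only [hterm1] at h2
  have h1' := Complex.hasSum_re h1
  have h2' := (Complex.hasSum_re h2).mul_left κ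
  simp only [Complex.ofReal_re] at h1' h2'
  have h3 : (inner ℂ u u).re = ‖u‖ ^ 2 := inner_self_re u
  rw [← h3]
  refine hasSum_le (fun n => ?_) h2' h1'
  by_cases h : inner ℂ (b n) u = 0
  · simp [h]
  · have := hκ n h
    gcongr

end NonlocalHom

/-! ### Reduction to the cell -/

namespace NonlocalHom

variable {d : ℕ}

/-- The vector of integer parts. -/
noncomputable def floorVec (x : Rd d) : Fin d → ℤ := fun i => ⌊x i⌋

/-- The representative of a point in the cell, modulo `ℤᵈ`. -/
noncomputable def fracPt (x : Rd d) : Rd d := x - latt (floorVec x)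

lemma latt_add (m n : Fin d → ℤ) : (latt (m + n) : Rd d) = latt m + latt n := by
  ext i; simp [latt]

lemma latt_neg (n : Fin d → ℤ) : (latt (-n) : Rd d) = -latt n := by
  ext i; simp [latt]

lemma latt_zero : (latt 0 : Rd d) = 0 := by
  ext i; simp [latt]

lemma fracPt_mem (x : Rd d) : fracPt x ∈ cell d := fun i =>
  ⟨Int.fract_nonneg (x i), Int.fract_lt_one (x i)⟩

lemma floorVec_add_latt (x : Rd d) (n : Fin d → ℤ) :
    floorVec (x + latt n) = floorVec x + n := by
  funext i; simp [floorVec, latt]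

lemma fracPt_add_latt (x : Rd d) (n : Fin d → ℤ) : fracPt (x + latt n) = fracPt x := by
  rw [fracPt, floorVec_add_latt, latt_add, fracPt]; abel

lemma fracPt_sub_latt (x : Rd d) (n : Fin d → ℤ) : fracPt (x - latt n) = fracPt x := by
  rw [sub_eq_add_neg, ← latt_neg, fracPt_add_latt]

lemma floorVec_of_mem {x : Rd d} (hx : x ∈ cell d) : floorVec x = 0 := by
  funext i
  exact Int.floor_eq_zero_iff.2 (hx i)

lemma fracPt_of_mem {x : Rd d} (hx : x ∈ cell d) : fracPt x = x := by
  rw [fracPt, floorVec_of_mem hx, latt_zero, sub_zero]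

lemma apply_fracPt {β : Type*} {v : Rd d → β}
    (hv : ∀ (n : Fin d → ℤ) (x : Rd d), v (x + latt n) = v x) (x : Rd d) :
    v (fracPt x) = v x := by
  rw [fracPt, sub_eq_add_neg, ← latt_neg, hv]

lemma measurable_latt_floorVec : Measurable fun x : Rd d => (latt (floorVec x) : Rd d) := by
  refine (MeasurableEquiv.toLp 2 (Fin d → ℝ)).measurable.comp (measurable_pi_lambda _ fun i => ?_)
  have h : Measurable fun x : Rd d => x i := by fun_prop
  exact (measurable_from_top (f := fun n : ℤ => (n : ℝ))).comp (Int.measurable_floor.comp h)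

lemma measurable_fracPt : Measurable (fracPt (d := d)) :=
  measurable_id.sub measurable_latt_floorVec

lemma quasiMeasurePreserving_fracPt :
    Measure.QuasiMeasurePreserving (fracPt (d := d)) volume (cellMeasure d) := by
  refine ⟨measurable_fracPt, Measure.AbsolutelyContinuous.mk fun s hs h0 => ?_⟩
  rw [Measure.map_apply measurable_fracPt hs, ← lintegral_indicator_one (measurable_fracPt hs),
    ← tsum_lintegral_cell, ENNReal.tsum_eq_zero]
  intro n
  have : ∀ y ∈ cell d, (fracPt ⁻¹' s).indicator (1 : Rd d → ℝ≥0∞) (y + latt n) =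
      s.indicator 1 y := fun y hy => by
    have hmem : y + latt n ∈ fracPt ⁻¹' s ↔ y ∈ s := by
      rw [Set.mem_preimage, fracPt_add_latt, fracPt_of_mem hy]
    by_cases h : y ∈ s
    · rw [Set.indicator_of_mem h, Set.indicator_of_mem (hmem.2 h)]; rfl
    · rw [Set.indicator_of_notMem h, Set.indicator_of_notMem (mt hmem.1 h)]
  rw [setLIntegral_congr_fun (measurableSet_cell d) this, lintegral_indicator_one hs, h0]

/-- Integration over `ℝᵈ` is integration over the cell of the sum over the lattice. -/
lemma integral_eq_integral_cell_tsum {F : Rd d → ℂ} (hF : Integrable F) :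
    ∫ y, F y = ∫ y in cell d, ∑' n : Fin d → ℤ, F (y + latt n) := by
  have hshift : ∀ n : Fin d → ℤ, MeasurePreserving (fun y : Rd d => y + latt n) volume volume :=
    fun n => measurePreserving_add_right volume (latt n)
  have hmeas : ∀ n : Fin d → ℤ,
      AEStronglyMeasurable (fun y => F (y + latt n)) (cellMeasure d) := fun n =>
    (hF.1.comp_quasiMeasurePreserving (hshift n).quasiMeasurePreserving).restrict
  have hcov : (⋃ n : Fin d → ℤ, (fun y : Rd d => y - latt n) ⁻¹' cell d) = Set.univ := by
    refine Set.eq_univ_of_forall fun x => Set.mem_iUnion.2 ⟨floorVec x, ?_⟩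
    exact fracPt_mem x
  have hdisj : Pairwise (Function.onFun Disjoint
      fun n : Fin d → ℤ => (fun y : Rd d => y - latt n) ⁻¹' cell d) := by
    intro m n hmn
    rw [Function.onFun, Set.disjoint_left]
    intro x hm hn
    refine hmn ?_
    have h1 : floorVec (x - latt m) = 0 := floorVec_of_mem hm
    have h2 : floorVec (x - latt n) = 0 := floorVec_of_mem hn
    rw [sub_eq_add_neg, ← latt_neg, floorVec_add_latt] at h1 h2
    have := h1.trans h2.symm
    simpa using this
  rw [integral_tsum hmeas]
  · rw [← setIntegral_univ, ← hcov, integral_iUnion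
      (fun n => (measurableSet_cell d).preimage (by fun_prop)) hdisj hF.integrableOn]
    refine tsum_congr fun n => ?_
    rw [← (hshift n).setIntegral_preimage_emb
      (MeasurableEquiv.addRight (latt n)).measurableEmbedding]
    congr 2
    ext x; simp
  · rw [tsum_lintegral_cell fun y => ‖F y‖ₑ]
    exact hF.2.ne

/-! ### The jump measure -/

/-- The exchange of the two endpoints of a jump, followed by the shift that returns the first
one to the cell. -/
noncomputable def swapPt (z : Rd d × Rd d) : Rd d × Rd d :=
  (fracPt z.2, z.1 - latt (floorVec z.2))

lemma swapPt_sub (z : Rd d × Rd d) : (swapPt z).1 - (swapPt z).2 = -(z.1 - z.2) := by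
  simp only [swapPt, fracPt]; abel

lemma measurable_swapPt : Measurable (swapPt (d := d)) :=
  (measurable_fracPt.comp measurable_snd).prodMk
    (measurable_fst.sub (measurable_latt_floorVec.comp measurable_snd))

lemma fracPt_swapPt_snd {z : Rd d × Rd d} (hz : z.1 ∈ cell d) : fracPt (swapPt z).2 = z.1 := by
  rw [swapPt, fracPt_sub_latt, fracPt_of_mem hz]

/-- The product of the Lebesgue measures on `Ω` and on `ℝᵈ`. -/
noncomputable abbrev baseMeasure (d : ℕ) : Measure (Rd d × Rd d) :=
  (cellMeasure d).prod (volume : Measure (Rd d))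

/-- The exchange of endpoints preserves the product measure: split the second variable into its
integer and fractional parts, exchange the two integrations over the cell, and reassemble. -/
lemma measurePreserving_swapPt :
    MeasurePreserving (swapPt (d := d)) (baseMeasure d) (baseMeasure d) := by
  refine ⟨measurable_swapPt, Measure.ext_of_lintegral _ fun f hf => ?_⟩
  have hfm : ∀ n : Fin d → ℤ, Measurable fun z : Rd d × Rd d => f (z.2, z.1 - latt n) :=
    fun n => hf.comp (measurable_snd.prodMk (measurable_fst.sub_const _))
  calc ∫⁻ z, f z ∂(Measure.map swapPt (baseMeasure d))
      = ∫⁻ x in cell d, ∫⁻ y, f (fracPt y, x - latt (floorVec y)) := by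
        rw [lintegral_map hf measurable_swapPt,
          lintegral_prod (fun z => f (swapPt z)) (hf.comp measurable_swapPt).aemeasurable]
        rfl
    _ = ∫⁻ x in cell d, ∑' n : Fin d → ℤ, ∫⁻ y in cell d, f (y, x - latt n) := by
        refine lintegral_congr fun x => ?_
        rw [← tsum_lintegral_cell]
        refine tsum_congr fun n => setLIntegral_congr_fun (measurableSet_cell d) fun y hy => ?_
        simp only [fracPt_add_latt, floorVec_add_latt, fracPt_of_mem hy, floorVec_of_mem hy,
          zero_add]
    _ = ∑' n : Fin d → ℤ, ∫⁻ x in cell d, ∫⁻ y in cell d, f (y, x - latt n) :=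
        lintegral_tsum fun n => ((hfm n).lintegral_prod_right').aemeasurable
    _ = ∑' n : Fin d → ℤ, ∫⁻ y in cell d, ∫⁻ x in cell d, f (y, x - latt n) :=
        tsum_congr fun n => lintegral_lintegral_swap (hfm n).aemeasurable
    _ = ∫⁻ y in cell d, ∑' n : Fin d → ℤ, ∫⁻ x in cell d, f (y, x - latt n) := by
        refine (lintegral_tsum fun n => ?_).symm
        exact (Measurable.lintegral_prod_left' (hfm n)).aemeasurable
    _ = ∫⁻ y in cell d, ∫⁻ x, f (y, x) := by
        refine lintegral_congr fun y => ?_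
        rw [← tsum_lintegral_cell, ← (Equiv.neg (Fin d → ℤ)).tsum_eq]
        simp only [Equiv.neg_apply, latt_neg, sub_neg_eq_add]
    _ = ∫⁻ z, f z ∂(baseMeasure d) := (lintegral_prod _ hf.aemeasurable).symm

namespace Coefficients

variable (c : Coefficients d)

/-- The jump density `a(x-y) μ(x,y)`. -/
noncomputable def density (z : Rd d × Rd d) : ℝ := c.a (z.1 - z.2) * c.mu z.1 z.2

lemma aestronglyMeasurable_density : AEStronglyMeasurable c.density (baseMeasure d) := by
  have h := (c.aestronglyMeasurable_a_sub 0).mul c.mu_measurable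
  simp only [add_zero] at h
  exact h.mono_ac prod_cellMeasure_ac'

lemma ae_base_of_ae {p : Rd d × Rd d → Prop} (h : ∀ᵐ z, p z) : ∀ᵐ z ∂(baseMeasure d), p z :=
  prod_cellMeasure_ac'.ae_le h

lemma ae_base_sub {p : Rd d → Prop} (h : ∀ᵐ z, p z) : ∀ᵐ z ∂(baseMeasure d), p (z.1 - z.2) :=
  ae_base_of_ae ((quasiMeasurePreserving_sub volume volume).ae h)

lemma ae_base_fst_mem : ∀ᵐ z ∂(baseMeasure d), z.1 ∈ cell d :=
  Measure.quasiMeasurePreserving_fst.ae (ae_restrict_mem (measurableSet_cell d))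

lemma density_nonneg : ∀ᵐ z ∂(baseMeasure d), 0 ≤ c.density z := by
  filter_upwards [ae_base_sub c.a_nonneg, ae_base_of_ae c.mu_bounds] with z h1 h2
  exact mul_nonneg h1 (c.muMinus_pos.le.trans h2.1)

lemma density_le : ∀ᵐ z ∂(baseMeasure d), c.density z ≤ c.muPlus * c.a (z.1 - z.2) := by
  filter_upwards [ae_base_sub c.a_nonneg, ae_base_of_ae c.mu_bounds] with z h1 h2
  rw [density, mul_comm]
  exact mul_le_mul_of_nonneg_right h2.2 h1

lemma le_density : ∀ᵐ z ∂(baseMeasure d), c.muMinus * c.a (z.1 - z.2) ≤ c.density z := by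
  filter_upwards [ae_base_sub c.a_nonneg, ae_base_of_ae c.mu_bounds] with z h1 h2
  rw [density, mul_comm (c.a _)]
  exact mul_le_mul_of_nonneg_right h2.1 h1

lemma density_swapPt : ∀ᵐ z ∂(baseMeasure d), c.density (swapPt z) = c.density z := by
  have hper : ∀ᵐ z : Rd d × Rd d, ∀ n : Fin d → ℤ,
      c.mu (z.1 + latt n) (z.2 + latt n) = c.mu z.1 z.2 := ae_all_iff.2 fun n => c.mu_periodic n n
  have hswap : ∀ᵐ z : Rd d × Rd d, ∀ n : Fin d → ℤ,
      c.mu (z.2 + latt n) (z.1 + latt n) = c.mu z.2 z.1 :=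
    (Measure.measurePreserving_swap (μ := (volume : Measure (Rd d)))
      (ν := (volume : Measure (Rd d)))).quasiMeasurePreserving.ae hper
  filter_upwards [ae_base_of_ae hswap, ae_base_of_ae c.mu_symm, ae_base_sub c.a_even]
    with z h1 h2 h3
  rw [density, density, swapPt_sub, h3, h2]
  have := h1 (-floorVec z.2)
  rw [latt_neg, ← sub_eq_add_neg, ← sub_eq_add_neg] at this
  simp only [swapPt, fracPt]
  rw [this]

/-- The jump measure `a(x-y) μ(x,y) dx dy` on `Ω × ℝᵈ`. -/
noncomputable def nu : Measure (Rd d × Rd d) :=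
  (baseMeasure d).withDensity fun z => ENNReal.ofReal (c.density z)

lemma nu_ac : c.nu ≪ baseMeasure d := withDensity_absolutelyContinuous _ _

lemma aemeasurable_ofReal_density :
    AEMeasurable (fun z => ENNReal.ofReal (c.density z)) (baseMeasure d) :=
  c.aestronglyMeasurable_density.aemeasurable.ennreal_ofReal

lemma lintegral_nu {f : Rd d × Rd d → ℝ≥0∞} (hf : AEMeasurable f (baseMeasure d)) :
    ∫⁻ z, f z ∂c.nu = ∫⁻ z, ENNReal.ofReal (c.density z) * f z ∂(baseMeasure d) := by
  rw [nu, lintegral_withDensity_eq_lintegral_mul₀ c.aemeasurable_ofReal_density hf]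
  rfl

lemma integral_nu (f : Rd d × Rd d → ℂ) :
    ∫ z, f z ∂c.nu = ∫ z, (c.density z : ℂ) * f z ∂(baseMeasure d) := by
  rw [nu, integral_withDensity_eq_integral_toReal_smul₀ c.aemeasurable_ofReal_density
    (.of_forall fun z => ENNReal.ofReal_lt_top)]
  refine integral_congr_ae ?_
  filter_upwards [c.density_nonneg] with z hz
  rw [ENNReal.toReal_ofReal hz, Complex.real_smul]

lemma integral_nu_real (f : Rd d × Rd d → ℝ) :
    ∫ z, f z ∂c.nu = ∫ z, c.density z * f z ∂(baseMeasure d) := by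
  rw [nu, integral_withDensity_eq_integral_toReal_smul₀ c.aemeasurable_ofReal_density
    (.of_forall fun z => ENNReal.ofReal_lt_top)]
  refine integral_congr_ae ?_
  filter_upwards [c.density_nonneg] with z hz
  rw [ENNReal.toReal_ofReal hz, smul_eq_mul]

lemma integrable_nu_iff {f : Rd d × Rd d → ℂ} :
    Integrable f c.nu ↔ Integrable (fun z => (c.density z : ℂ) * f z) (baseMeasure d) := by
  rw [nu, integrable_withDensity_iff_integrable_smul₀' c.aemeasurable_ofReal_density
    (.of_forall fun z => ENNReal.ofReal_lt_top)]
  refine integrable_congr ?_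
  filter_upwards [c.density_nonneg] with z hz
  rw [ENNReal.toReal_ofReal hz, Complex.real_smul]

lemma integrable_nu_real_iff {f : Rd d × Rd d → ℝ} :
    Integrable f c.nu ↔ Integrable (fun z => c.density z * f z) (baseMeasure d) := by
  rw [nu, integrable_withDensity_iff_integrable_smul₀' c.aemeasurable_ofReal_density
    (.of_forall fun z => ENNReal.ofReal_lt_top)]
  refine integrable_congr ?_
  filter_upwards [c.density_nonneg] with z hz
  rw [ENNReal.toReal_ofReal hz, smul_eq_mul]

/-- The jump measure is symmetric: this combines the evenness of `a` with the symmetry and the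
periodicity of `μ`. -/
lemma measurePreserving_swapPt_nu : MeasurePreserving swapPt c.nu c.nu := by
  refine ⟨measurable_swapPt, Measure.ext_of_lintegral _ fun f hf => ?_⟩
  rw [lintegral_map hf measurable_swapPt,
    c.lintegral_nu (f := fun z => f (swapPt z)) (hf.comp measurable_swapPt).aemeasurable,
    c.lintegral_nu hf.aemeasurable]
  have hm : AEMeasurable (fun z => ENNReal.ofReal (c.density z) * f z) (baseMeasure d) :=
    c.aemeasurable_ofReal_density.mul hf.aemeasurable
  have h1 := lintegral_map' (by rwa [measurePreserving_swapPt.map_eq]) (μ := baseMeasure d)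
    (f := fun z => ENNReal.ofReal (c.density z) * f z) (g := swapPt) measurable_swapPt.aemeasurable
  rw [measurePreserving_swapPt.map_eq] at h1
  rw [h1]
  refine lintegral_congr_ae ?_
  filter_upwards [c.density_swapPt] with z hz
  rw [hz]

lemma ae_nu_fst_mem : ∀ᵐ z ∂c.nu, z.1 ∈ cell d := c.nu_ac.ae_le ae_base_fst_mem

lemma integral_comp_swapPt {E : Type*} [NormedAddCommGroup E] [NormedSpace ℝ E]
    {f : Rd d × Rd d → E} (hf : AEStronglyMeasurable f c.nu) :
    ∫ z, f (swapPt z) ∂c.nu = ∫ z, f z ∂c.nu := by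
  have h := integral_map (μ := c.nu) (φ := swapPt) measurable_swapPt.aemeasurable (f := f)
    (by rwa [c.measurePreserving_swapPt_nu.map_eq])
  rw [c.measurePreserving_swapPt_nu.map_eq] at h
  exact h.symm

/-- A weight that depends on the jump integrates against a function of the initial point to at
most `μ₊` times the product of the integrals. -/
lemma lintegral_nu_le {h g : Rd d → ℝ≥0∞} (hh : Measurable h)
    (hg : AEMeasurable g (cellMeasure d)) :
    ∫⁻ z, h (z.1 - z.2) * g z.1 ∂c.nu ≤
      ENNReal.ofReal c.muPlus * (∫⁻ z, ENNReal.ofReal (c.a z) * h z) * ∫⁻ x in cell d, g x := by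
  have hgm : AEMeasurable (fun z : Rd d × Rd d => g z.1) (baseMeasure d) :=
    hg.comp_quasiMeasurePreserving Measure.quasiMeasurePreserving_fst
  have hhm : AEMeasurable (fun z : Rd d × Rd d => h (z.1 - z.2)) (baseMeasure d) :=
    (hh.comp (measurable_fst.sub measurable_snd)).aemeasurable
  have ham : AEMeasurable (fun z : Rd d × Rd d => ENNReal.ofReal (c.a (z.1 - z.2)))
      (baseMeasure d) := by
    have := (c.aestronglyMeasurable_a_sub 0).mono_ac (prod_cellMeasure_ac' (d := d))
    simp only [add_zero] at this
    exact this.aemeasurable.ennreal_ofReal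
  rw [c.lintegral_nu (f := fun z => h (z.1 - z.2) * g z.1) (hhm.mul hgm)]
  calc ∫⁻ z, ENNReal.ofReal (c.density z) * (h (z.1 - z.2) * g z.1) ∂(baseMeasure d)
      ≤ ∫⁻ z, ENNReal.ofReal c.muPlus *
          ((ENNReal.ofReal (c.a (z.1 - z.2)) * h (z.1 - z.2)) * g z.1) ∂(baseMeasure d) := by
        refine lintegral_mono_ae ?_
        filter_upwards [c.density_le] with z hz
        rw [mul_assoc (ENNReal.ofReal (c.a _)), ← mul_assoc (ENNReal.ofReal c.muPlus),
          ← ENNReal.ofReal_mul c.muPlus_pos.le]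
        gcongr
    _ = ENNReal.ofReal c.muPlus * ∫⁻ z, (ENNReal.ofReal (c.a (z.1 - z.2)) * h (z.1 - z.2)) * g z.1
          ∂(baseMeasure d) := lintegral_const_mul' _ _ ENNReal.ofReal_ne_top
    _ = ENNReal.ofReal c.muPlus *
          ∫⁻ x in cell d, (∫⁻ z, ENNReal.ofReal (c.a z) * h z) * g x := by
        congr 1
        rw [lintegral_prod (fun z => ENNReal.ofReal (c.a (z.1 - z.2)) * h (z.1 - z.2) * g z.1)
          ((ham.mul hhm).mul hgm)]
        refine lintegral_congr_ae ?_
        filter_upwards [(ham.mul hhm).aestronglyMeasurable.prodMk_left] with x hx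
        rw [← lintegral_sub_left_eq_self (fun z => ENNReal.ofReal (c.a z) * h z) x]
        exact lintegral_mul_const'' _ hx.aemeasurable
    _ = _ := by
        rw [lintegral_const_mul'' _ hg, mul_assoc]

/-- The jump measure weighted with `|x-y|ᵏ`, against the square of a function on the cell. -/
lemma lintegral_pow_mul_sq_le {k : ℕ} (hk : k ≤ 3) {u : Rd d → ℂ}
    (hu : AEStronglyMeasurable u (cellMeasure d)) :
    ∫⁻ z, ENNReal.ofReal (‖z.1 - z.2‖ ^ k) * ‖u z.1‖ₑ ^ 2 ∂c.nu ≤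
      ENNReal.ofReal (c.muPlus * c.M k) * ∫⁻ x in cell d, ‖u x‖ₑ ^ 2 := by
  refine (c.lintegral_nu_le (h := fun z => ENNReal.ofReal (‖z‖ ^ k)) (g := fun x => ‖u x‖ₑ ^ 2)
    (by fun_prop) (hu.enorm.pow_const 2)).trans_eq ?_
  congr 1
  rw [ENNReal.ofReal_mul c.muPlus_pos.le]
  congr 1
  rw [M, ofReal_integral_eq_lintegral_ofReal (c.norm_pow_mul_integrable hk)]
  · refine lintegral_congr fun z => ?_
    rw [ENNReal.ofReal_mul (by positivity), mul_comm]
  · filter_upwards [c.a_nonneg] with z hz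
    exact mul_nonneg (by positivity) hz

end Coefficients

end NonlocalHom

/-! ### The quadratic form of the fiber operators -/

namespace NonlocalHom

variable {d : ℕ}

lemma oneCell_ae : oneCell d =ᵐ[cellMeasure d] fun _ => (1 : ℂ) := Lp.coeFn_const 2 _ _

namespace Coefficients

variable (c : Coefficients d)

lemma ae_nu_fst {p : Rd d → Prop} (h : ∀ᵐ x ∂(cellMeasure d), p x) : ∀ᵐ z ∂c.nu, p z.1 :=
  c.nu_ac.ae_le (Measure.quasiMeasurePreserving_fst.ae h)

lemma ae_nu_snd {p : Rd d → Prop} (h : ∀ᵐ x ∂(cellMeasure d), p x) :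
    ∀ᵐ z ∂c.nu, p (fracPt z.2) :=
  c.nu_ac.ae_le (Measure.quasiMeasurePreserving_snd.ae (quasiMeasurePreserving_fracPt.ae h))

lemma measurable_fst_comp (u : L2cell d) : Measurable fun z : Rd d × Rd d => u z.1 :=
  (Lp.stronglyMeasurable u).measurable.comp measurable_fst

lemma measurable_snd_comp (u : L2cell d) : Measurable fun z : Rd d × Rd d => u (fracPt z.2) :=
  (Lp.stronglyMeasurable u).measurable.comp (measurable_fracPt.comp measurable_snd)

lemma lintegral_sq_eq (u : L2cell d) :
    ∫⁻ x in cell d, ‖u x‖ₑ ^ 2 = ENNReal.ofReal (‖u‖ ^ 2) := by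
  have h := eLpNorm_eq_lintegral_rpow_enorm_toReal (f := u) (μ := cellMeasure d) (p := 2)
    (by norm_num) (by norm_num)
  rw [← Lp.enorm_def] at h
  simp only [ENNReal.toReal_ofNat] at h
  rw [ENNReal.ofReal_pow (norm_nonneg _), ofReal_norm, h, ← ENNReal.rpow_natCast,
    ← ENNReal.rpow_mul]
  norm_num

/-- Cauchy–Schwarz for the jump measure weighted with `|x-y|ᵏ`. -/
lemma lintegral_pow_mul_mul_le {k : ℕ} (hk : k ≤ 3) (v u : L2cell d) :
    ∫⁻ z, ENNReal.ofReal (‖z.1 - z.2‖ ^ k) * (‖v z.1‖ₑ * ‖u (fracPt z.2)‖ₑ) ∂c.nu ≤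
      ENNReal.ofReal (c.muPlus * c.M k * ‖v‖ * ‖u‖) := by
  have hM : 0 ≤ c.muPlus * c.M k := mul_nonneg c.muPlus_pos.le <| integral_nonneg_of_ae <| by
    filter_upwards [c.a_nonneg] with z hz
    exact mul_nonneg (by positivity) hz
  have hw : Measurable fun z : Rd d × Rd d => ENNReal.ofReal (‖z.1 - z.2‖ ^ k) := by fun_prop
  have hv := (measurable_fst_comp v).enorm
  have hu := (measurable_snd_comp u).enorm
  have h1 : ∀ w : L2cell d, ∫⁻ z, ENNReal.ofReal (‖z.1 - z.2‖ ^ k) * ‖w z.1‖ₑ ^ 2 ∂c.nu ≤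
      ENNReal.ofReal (c.muPlus * c.M k * ‖w‖ ^ 2) := fun w => by
    refine (c.lintegral_pow_mul_sq_le hk (Lp.aestronglyMeasurable w)).trans_eq ?_
    rw [lintegral_sq_eq, ← ENNReal.ofReal_mul hM]
  have h2 : ∫⁻ z, ENNReal.ofReal (‖z.1 - z.2‖ ^ k) * ‖u (fracPt z.2)‖ₑ ^ 2 ∂c.nu ≤
      ENNReal.ofReal (c.muPlus * c.M k * ‖u‖ ^ 2) := by
    have hm := c.measurePreserving_swapPt_nu.lintegral_comp
      (f := fun z : Rd d × Rd d => ENNReal.ofReal (‖z.1 - z.2‖ ^ k) * ‖u z.1‖ₑ ^ 2)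
      (hw.mul ((measurable_fst_comp u).enorm.pow_const 2))
    refine le_of_eq_of_le ?_ (h1 u)
    rw [← hm]
    simp only [swapPt_sub, norm_neg]
    rfl
  have hol := ENNReal.lintegral_mul_le_Lp_mul_Lq
    (c.nu.withDensity fun z => ENNReal.ofReal (‖z.1 - z.2‖ ^ k)) Real.HolderConjugate.two_two
    hv.aemeasurable hu.aemeasurable
  simp only [ENNReal.rpow_ofNat] at hol
  rw [lintegral_withDensity_eq_lintegral_mul _ hw (hv.mul hu),
    lintegral_withDensity_eq_lintegral_mul _ hw (hv.pow_const 2),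
    lintegral_withDensity_eq_lintegral_mul _ hw (hu.pow_const 2)] at hol
  refine hol.trans ?_
  calc _ ≤ ENNReal.ofReal (c.muPlus * c.M k * ‖v‖ ^ 2) ^ (1 / 2 : ℝ) *
        ENNReal.ofReal (c.muPlus * c.M k * ‖u‖ ^ 2) ^ (1 / 2 : ℝ) := by
        gcongr
        · exact h1 v
        · exact h2
    _ = _ := by
        rw [← ENNReal.mul_rpow_of_nonneg _ _ (by norm_num), ← ENNReal.ofReal_mul (by positivity),
          ENNReal.ofReal_rpow_of_nonneg (by positivity) (by norm_num), ← Real.sqrt_eq_rpow]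
        congr 1
        rw [show c.muPlus * c.M k * ‖v‖ ^ 2 * (c.muPlus * c.M k * ‖u‖ ^ 2) =
          (c.muPlus * c.M k * ‖v‖ * ‖u‖) ^ 2 by ring]
        exact Real.sqrt_sq (by positivity)

lemma lintegral_enorm_le_of_le {k : ℕ} (hk : k ≤ 3) (v u : L2cell d) {E : Type*}
    [NormedAddCommGroup E] {F : Rd d × Rd d → E} {C : ℝ} (hC : 0 ≤ C)
    (hF : ∀ᵐ z ∂c.nu, ‖F z‖ ≤ C * ‖z.1 - z.2‖ ^ k * ‖v z.1‖ * ‖u (fracPt z.2)‖) :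
    ∫⁻ z, ‖F z‖ₑ ∂c.nu ≤ ENNReal.ofReal (C * (c.muPlus * c.M k * ‖v‖ * ‖u‖)) := by
  rw [ENNReal.ofReal_mul hC]
  refine le_trans ?_ (mul_le_mul_right (c.lintegral_pow_mul_mul_le hk v u) _)
  rw [← lintegral_const_mul' _ _ ENNReal.ofReal_ne_top]
  refine lintegral_mono_ae ?_
  filter_upwards [hF] with z hz
  rw [← ofReal_norm, ← ofReal_norm, ← ofReal_norm, ← ENNReal.ofReal_mul (norm_nonneg _),
    ← ENNReal.ofReal_mul (by positivity), ← ENNReal.ofReal_mul hC]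
  refine ENNReal.ofReal_le_ofReal (hz.trans_eq ?_)
  ring

lemma integrable_nu_of_le {k : ℕ} (hk : k ≤ 3) (v u : L2cell d) {E : Type*}
    [NormedAddCommGroup E] {F : Rd d × Rd d → E} {C : ℝ} (hC : 0 ≤ C)
    (hFm : AEStronglyMeasurable F c.nu)
    (hF : ∀ᵐ z ∂c.nu, ‖F z‖ ≤ C * ‖z.1 - z.2‖ ^ k * ‖v z.1‖ * ‖u (fracPt z.2)‖) :
    Integrable F c.nu :=
  ⟨hFm, (c.lintegral_enorm_le_of_le hk v u hC hF).trans_lt ENNReal.ofReal_lt_top⟩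

lemma norm_integral_nu_le {k : ℕ} (hk : k ≤ 3) (v u : L2cell d) {E : Type*}
    [NormedAddCommGroup E] [NormedSpace ℝ E] {F : Rd d × Rd d → E} {C : ℝ} (hC : 0 ≤ C)
    (hF : ∀ᵐ z ∂c.nu, ‖F z‖ ≤ C * ‖z.1 - z.2‖ ^ k * ‖v z.1‖ * ‖u (fracPt z.2)‖) :
    ‖∫ z, F z ∂c.nu‖ ≤ C * (c.muPlus * c.M k * ‖v‖ * ‖u‖) := by
  have hM : 0 ≤ c.M k := integral_nonneg_of_ae <| by
    filter_upwards [c.a_nonneg] with z hz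
    exact mul_nonneg (by positivity) hz
  have h := (enorm_integral_le_lintegral_enorm F).trans (c.lintegral_enorm_le_of_le hk v u hC hF)
  rw [← ofReal_norm] at h
  exact (ENNReal.ofReal_le_ofReal_iff (by have := c.muPlus_pos; positivity)).1 h

/-- The jump measure is finite. -/
instance isFiniteMeasure_nu : IsFiniteMeasure c.nu := by
  refine ⟨?_⟩
  have h := c.lintegral_enorm_le_of_le (k := 0) (by norm_num) (oneCell d) (oneCell d)
    (F := fun _ => (1 : ℂ)) (C := 1) zero_le_one (by
      filter_upwards [c.ae_nu_fst oneCell_ae, c.ae_nu_snd oneCell_ae] with z h1 h2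
      rw [h1, h2]; simp)
  simp only [enorm_one, lintegral_const, one_mul] at h
  exact h.trans_lt ENNReal.ofReal_lt_top

/-- A function of the initial point of the jump that is square integrable over the cell is square
integrable with respect to the jump measure. -/
lemma memLp_fst (u : L2cell d) : MemLp (fun z : Rd d × Rd d => u z.1) 2 c.nu := by
  refine ⟨(measurable_fst_comp u).aestronglyMeasurable, ?_⟩
  rw [eLpNorm_lt_top_iff_lintegral_rpow_enorm_lt_top (by norm_num) (by norm_num)]
  have h := c.lintegral_pow_mul_sq_le (k := 0) (by norm_num) (Lp.aestronglyMeasurable u)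
  simp only [pow_zero, ENNReal.ofReal_one, one_mul, lintegral_sq_eq] at h
  simp only [ENNReal.toReal_ofNat, ENNReal.rpow_ofNat]
  exact h.trans_lt (ENNReal.mul_lt_top ENNReal.ofReal_lt_top ENNReal.ofReal_lt_top)

lemma memLp_snd (u : L2cell d) : MemLp (fun z : Rd d × Rd d => u (fracPt z.2)) 2 c.nu :=
  (c.memLp_fst u).comp_measurePreserving c.measurePreserving_swapPt_nu

/-- The phase `exp(-i⟨ξ, x-y⟩)` of a jump. -/
noncomputable def phase (ξ : Rd d) (z : Rd d × Rd d) : ℂ :=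
  Complex.exp (-Complex.I * (inner ℝ ξ (z.1 - z.2) : ℝ))

lemma continuous_phase (ξ : Rd d) : Continuous (phase ξ) := by
  unfold phase; fun_prop

lemma norm_phase (ξ : Rd d) (z : Rd d × Rd d) : ‖phase ξ z‖ = 1 := norm_exp_neg_I_mul _

lemma phase_swapPt (ξ : Rd d) (z : Rd d × Rd d) :
    phase ξ (swapPt z) = (starRingEnd ℂ) (phase ξ z) := by
  rw [phase, phase, swapPt_sub, ← Complex.exp_conj]
  congr 1
  simp only [inner_neg_right, map_mul, map_neg, Complex.conj_I, Complex.conj_ofReal,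
    Complex.ofReal_neg]
  ring

lemma phase_zero (z : Rd d × Rd d) : phase 0 z = 1 := by simp [phase]

/-- The twisted difference `u(x) - exp(-i⟨ξ, x-y⟩) u(y)` of a periodic function. -/
noncomputable def twistDiff (ξ : Rd d) (u : L2cell d) (z : Rd d × Rd d) : ℂ :=
  u z.1 - phase ξ z * u (fracPt z.2)

lemma memLp_phase_snd (ξ : Rd d) (u : L2cell d) :
    MemLp (fun z => phase ξ z * u (fracPt z.2)) 2 c.nu := by
  refine (c.memLp_snd u).of_le ?_ (.of_forall fun z => ?_)
  · exact (continuous_phase ξ).aestronglyMeasurable.mul (c.memLp_snd u).1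
  · rw [norm_mul, norm_phase, one_mul]

lemma memLp_twistDiff (ξ : Rd d) (u : L2cell d) : MemLp (twistDiff ξ u) 2 c.nu :=
  (c.memLp_fst u).sub (c.memLp_phase_snd ξ u)

lemma integrable_conj_mul {f g : Rd d × Rd d → ℂ} (hf : MemLp f 2 c.nu) (hg : MemLp g 2 c.nu) :
    Integrable (fun z => (starRingEnd ℂ) (f z) * g z) c.nu :=
  MemLp.integrable_mul (p := 2) (q := 2) hf.star hg

lemma integrable_density_mul_ae {f : Rd d × Rd d → ℂ} (hf : Integrable f c.nu) :
    ∀ᵐ x ∂(cellMeasure d), Integrable fun y => (c.density (x, y) : ℂ) * f (x, y) :=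
  (c.integrable_nu_iff.1 hf).prod_right_ae

lemma integral_nu_eq {f : Rd d × Rd d → ℂ} (hf : Integrable f c.nu) :
    ∫ z, f z ∂c.nu = ∫ x in cell d, ∫ y, (c.density (x, y) : ℂ) * f (x, y) := by
  rw [c.integral_nu, integral_prod _ (c.integrable_nu_iff.1 hf)]

/-- The fiber operator as a nonlocal operator acting on periodic functions. -/
lemma fiberA_apply_ae (ξ : Rd d) (u : L2cell d) :
    ∀ᵐ x ∂(cellMeasure d), c.fiberA ξ u x =
      ∫ y, (c.density (x, y) : ℂ) * twistDiff ξ u (x, y) := by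
  have hper : ∀ᵐ x ∂(cellMeasure d), ∀ᵐ y ∂(cellMeasure d), ∀ n : Fin d → ℤ,
      c.mu x (y + latt n) = c.mu x y := by
    have hall : ∀ᵐ z : Rd d × Rd d, ∀ n : Fin d → ℤ,
        c.mu z.1 (z.2 + latt n) = c.mu z.1 z.2 := by
      refine ae_all_iff.2 fun n => ?_
      filter_upwards [c.mu_periodic 0 n] with z hz
      rwa [latt_zero, add_zero] at hz
    exact Measure.ae_ae_of_ae_prod (prod_cellMeasure_ac.ae_le hall)
  filter_upwards [c.fiberA_ae ξ u,
    c.integrable_density_mul_ae ((c.memLp_fst u).integrable one_le_two),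
    c.integrable_density_mul_ae ((c.memLp_phase_snd ξ u).integrable one_le_two), hper]
    with x h1 h2 h3 h4
  rw [h1]
  simp only [twistDiff, mul_sub]
  rw [integral_sub h2 h3, integral_mul_const]
  congr 1
  · congr 1
    rw [potential, ← integral_complex_ofReal]
    rfl
  · rw [integral_eq_integral_cell_tsum h3]
    refine integral_congr_ae ?_
    filter_upwards [h4, ae_restrict_mem (measurableSet_cell d)] with y hy hyc
    rw [aTilde, mul_assoc, ← tsum_mul_right, ← (Equiv.neg (Fin d → ℤ)).tsum_eq]
    refine tsum_congr fun n => ?_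
    rw [Equiv.neg_apply, latt_neg, density, phase, fracPt_add_latt, fracPt_of_mem hyc]
    simp only [hy n, ← sub_eq_add_neg, sub_add_eq_sub_sub]
    push_cast
    ring

lemma inner_fiberA (ξ : Rd d) (v u : L2cell d) :
    inner ℂ v (c.fiberA ξ u) = ∫ z, (starRingEnd ℂ) (v z.1) * twistDiff ξ u z ∂c.nu := by
  rw [L2.inner_def,
    c.integral_nu_eq (c.integrable_conj_mul (c.memLp_fst v) (c.memLp_twistDiff ξ u))]
  refine integral_congr_ae ?_
  filter_upwards [c.fiberA_apply_ae ξ u] with x hx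
  rw [RCLike.inner_apply', hx, ← integral_const_mul]
  refine integral_congr_ae (.of_forall fun y => ?_)
  ring

lemma integrable_comp_swapPt {f : Rd d × Rd d → ℂ} (hf : Integrable f c.nu) :
    Integrable (fun z => f (swapPt z)) c.nu :=
  c.measurePreserving_swapPt_nu.integrable_comp_of_integrable hf

lemma twistDiff_swapPt (ξ : Rd d) (u : L2cell d) {z : Rd d × Rd d} (hz : z.1 ∈ cell d) :
    twistDiff ξ u (swapPt z) = u (fracPt z.2) - (starRingEnd ℂ) (phase ξ z) * u z.1 := by
  rw [twistDiff, fracPt_swapPt_snd hz, phase_swapPt]; rfl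

lemma conj_mul_twistDiff_add (ξ : Rd d) (v u : L2cell d) (z : Rd d × Rd d) :
    (starRingEnd ℂ) (v z.1) * twistDiff ξ u z + (starRingEnd ℂ) (v (fracPt z.2)) *
      (u (fracPt z.2) - (starRingEnd ℂ) (phase ξ z) * u z.1) =
      (starRingEnd ℂ) (twistDiff ξ v z) * twistDiff ξ u z := by
  have hphase : (starRingEnd ℂ) (phase ξ z) * phase ξ z = 1 := by
    rw [← Complex.normSq_eq_conj_mul_self, Complex.normSq_eq_norm_sq, norm_phase]; simp
  rw [twistDiff, twistDiff, map_sub, map_mul]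
  linear_combination (-(starRingEnd ℂ) (v (fracPt z.2)) * u (fracPt z.2)) * hphase

/-- The sesquilinear form of the fiber operator in symmetric form. -/
lemma inner_fiberA_symm (ξ : Rd d) (v u : L2cell d) :
    inner ℂ v (c.fiberA ξ u) =
      (1 / 2 : ℂ) * ∫ z, (starRingEnd ℂ) (twistDiff ξ v z) * twistDiff ξ u z ∂c.nu := by
  have hint : Integrable (fun z => (starRingEnd ℂ) (v z.1) * twistDiff ξ u z) c.nu :=
    c.integrable_conj_mul (c.memLp_fst v) (c.memLp_twistDiff ξ u)
  have h1 := c.inner_fiberA ξ v u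
  have hsw : ∫ z, (starRingEnd ℂ) (v (swapPt z).1) * twistDiff ξ u (swapPt z) ∂c.nu =
      inner ℂ v (c.fiberA ξ u) := by
    rw [h1]
    exact c.integral_comp_swapPt (f := fun z => (starRingEnd ℂ) (v z.1) * twistDiff ξ u z) hint.1
  have hint' : Integrable (fun z => (starRingEnd ℂ) (v (swapPt z).1) * twistDiff ξ u (swapPt z))
      c.nu :=
    c.integrable_comp_swapPt (f := fun z => (starRingEnd ℂ) (v z.1) * twistDiff ξ u z) hint
  have h2 : inner ℂ v (c.fiberA ξ u) + inner ℂ v (c.fiberA ξ u) =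
      ∫ z, (starRingEnd ℂ) (twistDiff ξ v z) * twistDiff ξ u z ∂c.nu := by
    nth_rewrite 2 [← hsw]
    rw [h1, ← integral_add hint hint']
    refine integral_congr_ae ?_
    filter_upwards [c.ae_nu_fst_mem] with z hz
    rw [twistDiff_swapPt ξ u hz]
    exact conj_mul_twistDiff_add ξ v u z
  rw [← h2]; ring

lemma fiberA_symm (ξ : Rd d) (v u : L2cell d) :
    inner ℂ (c.fiberA ξ v) u = inner ℂ v (c.fiberA ξ u) := by
  rw [← inner_conj_symm, c.inner_fiberA_symm, c.inner_fiberA_symm, map_mul, ← integral_conj]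
  congr 1
  · simp [map_ofNat]
  · refine integral_congr_ae (.of_forall fun z => ?_)
    simp only [map_mul, Complex.conj_conj]
    ring

lemma re_inner_fiberA (ξ : Rd d) (u : L2cell d) :
    (inner ℂ u (c.fiberA ξ u)).re = 1 / 2 * ∫ z, ‖twistDiff ξ u z‖ ^ 2 ∂c.nu := by
  have h : ∀ z, (starRingEnd ℂ) (twistDiff ξ u z) * twistDiff ξ u z =
      ((‖twistDiff ξ u z‖ ^ 2 : ℝ) : ℂ) := fun z => by
    rw [← Complex.normSq_eq_conj_mul_self, Complex.normSq_eq_norm_sq]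
  rw [c.inner_fiberA_symm]
  simp only [h]
  rw [integral_complex_ofReal]
  rw [show (1 / 2 : ℂ) = ((1 / 2 : ℝ) : ℂ) by push_cast; rfl, ← Complex.ofReal_mul,
    Complex.ofReal_re]

/-! ### Comparison with a constant environment -/

/-- The coefficients with the same jump kernel and with `μ = 1`. -/
noncomputable def flat : Coefficients d where
  a := c.a
  mu := fun _ _ => 1
  muMinus := 1
  muPlus := 1
  a_integrable := c.a_integrable
  a_nontrivial := c.a_nontrivial
  a_nonneg := c.a_nonneg
  a_even := c.a_even
  mu_measurable := aestronglyMeasurable_const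
  muMinus_pos := one_pos
  mu_bounds := .of_forall fun _ => ⟨le_rfl, le_rfl⟩
  mu_symm := .of_forall fun _ => rfl
  mu_periodic := fun _ _ => .of_forall fun _ => rfl
  moment_integrable := c.moment_integrable

/-- In its symmetric form the quadratic form is monotone in `μ`. -/
lemma muMinus_mul_flat_le (ξ : Rd d) (u : L2cell d) :
    c.muMinus * (inner ℂ u (c.flat.fiberA ξ u)).re ≤ (inner ℂ u (c.fiberA ξ u)).re := by
  rw [c.re_inner_fiberA, c.flat.re_inner_fiberA, mul_left_comm]
  refine mul_le_mul_of_nonneg_left ?_ (by norm_num)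
  have i1 := (c.memLp_twistDiff ξ u).integrable_norm_pow (by norm_num)
  have i2 := (c.flat.memLp_twistDiff ξ u).integrable_norm_pow (by norm_num)
  simp only at i1 i2
  rw [c.integral_nu_real, c.flat.integral_nu_real, ← integral_const_mul]
  refine integral_mono_ae ((c.flat.integrable_nu_real_iff.1 i2).const_mul _)
    (c.integrable_nu_real_iff.1 i1) ?_
  filter_upwards [c.le_density] with z hz
  have e : c.flat.density z = c.a (z.1 - z.2) := by simp [density, flat]
  rw [e, ← mul_assoc]
  gcongr

lemma integral_sin_mul_eq_zero (η : Rd d) : ∫ z, Real.sin (inner ℝ η z) * c.a z = 0 := by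
  have h := integral_neg_eq_self (fun z => Real.sin (inner ℝ η z) * c.a z) volume
  have h2 : ∫ z, Real.sin (inner ℝ η (-z)) * c.a (-z) =
      ∫ z, -(Real.sin (inner ℝ η z) * c.a z) := by
    refine integral_congr_ae ?_
    filter_upwards [c.a_even] with z hz
    rw [hz, inner_neg_right, Real.sin_neg]; ring
  rw [h2, integral_neg] at h
  linarith

/-- `Â` as a complex integral. -/
lemma integral_one_sub_exp (η : Rd d) :
    ∫ z, (c.a z : ℂ) * (1 - Complex.exp (-Complex.I * (inner ℝ η z : ℝ))) = c.Ahat η := by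
  have hpt : ∀ z, (c.a z : ℂ) * (1 - Complex.exp (-Complex.I * (inner ℝ η z : ℝ))) =
      (((1 - Real.cos (inner ℝ z η)) * c.a z : ℝ) : ℂ) +
        Complex.I * ((Real.sin (inner ℝ η z) * c.a z : ℝ) : ℂ) := fun z => by
    rw [exp_neg_I_mul, real_inner_comm]
    apply Complex.ext <;> simp [-Complex.ofReal_cos, -Complex.ofReal_sin] <;> ring
  have hs : Integrable fun z => Real.sin (inner ℝ η z) * c.a z :=
    c.a_integrable.bdd_mul (c := 1) (by fun_prop) (.of_forall fun z => Real.abs_sin_le_one _)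
  simp only [hpt]
  rw [integral_add (c.Ahat_integrable η).ofReal (hs.ofReal.const_mul _), integral_const_mul,
    integral_complex_ofReal, integral_complex_ofReal, c.integral_sin_mul_eq_zero η]
  simp [Ahat]

/-- In a constant environment the exponentials diagonalise the fiber operators. -/
lemma flat_fiberA_fourierBasis (ξ : Rd d) (n : Fin d → ℤ) :
    c.flat.fiberA ξ (fourierBasis d n) =
      (c.Ahat (ξ + (2 * Real.pi) • latt n) : ℂ) • fourierBasis d n := by
  refine Lp.ext ?_
  have hsnd : ∀ᵐ y : Rd d, fourierBasis d n (fracPt y) =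
      Complex.exp (Complex.I * (2 * Real.pi * inner ℝ (latt n) (fracPt y) : ℝ)) :=
    quasiMeasurePreserving_fracPt.ae (fourierBasis_ae n)
  filter_upwards [c.flat.fiberA_apply_ae ξ (fourierBasis d n), fourierBasis_ae n,
    Lp.coeFn_smul ((c.Ahat (ξ + (2 * Real.pi) • latt n) : ℂ)) (fourierBasis d n)] with x h1 h2 h3
  rw [h1, h3, Pi.smul_apply, smul_eq_mul, ← c.integral_one_sub_exp,
    ← integral_sub_left_eq_self (fun z => (c.a z : ℂ) *
      (1 - Complex.exp (-Complex.I * (inner ℝ (ξ + (2 * Real.pi) • latt n) z : ℝ)))) volume x,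
    ← integral_mul_const]
  refine integral_congr_ae ?_
  filter_upwards [hsnd] with y hy
  have hdens : c.flat.density (x, y) = c.a (x - y) := by simp [density, flat]
  -- the exponential is periodic
  have hexp : Complex.exp (Complex.I * (2 * Real.pi * inner ℝ (latt n) (fracPt y) : ℝ)) =
      Complex.exp (Complex.I * (2 * Real.pi * inner ℝ (latt n) y : ℝ)) := by
    rw [fracPt, inner_sub_right]
    obtain ⟨m, hm⟩ : ∃ m : ℤ, inner ℝ (latt n) (latt (floorVec y) : Rd d) = (m : ℝ) :=
      ⟨∑ i, n i * floorVec y i, by rw [inner_latt]; simp [latt]⟩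
    rw [hm]
    refine Complex.exp_eq_exp_iff_exists_int.2 ⟨-m, ?_⟩
    push_cast; ring
  rw [hdens, twistDiff, phase, hy, hexp, h2, mul_assoc (c.a (x - y) : ℂ), sub_mul, one_mul,
    ← Complex.exp_add, ← Complex.exp_add]
  congr 3
  rw [inner_add_left, inner_smul_left, inner_sub_right, inner_sub_right]
  simp only [conj_trivial]
  push_cast; ring

lemma norm_latt_ge {n : Fin d → ℤ} (hn : n ≠ 0) : 1 ≤ ‖(latt n : Rd d)‖ := by
  obtain ⟨i, hi⟩ := Function.ne_iff.1 hn
  have h1 : (1 : ℝ) ≤ |(n i : ℝ)| := by exact_mod_cast Int.one_le_abs hi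
  exact h1.trans (PiLp.norm_apply_le (latt n : Rd d) i)

lemma pi_le_norm_add {ξ : Rd d} (hξ : ‖ξ‖ ≤ 1) {n : Fin d → ℤ} (hn : n ≠ 0) :
    Real.pi ≤ ‖ξ + (2 * Real.pi) • (latt n : Rd d)‖ := by
  have h1 := norm_sub_le (ξ + (2 * Real.pi) • (latt n : Rd d)) ξ
  rw [add_sub_cancel_left, norm_smul, Real.norm_of_nonneg (by positivity)] at h1
  have h2 := norm_latt_ge hn
  have h3 := Real.pi_gt_three
  nlinarith

/-- The form of `𝔸(ξ)` is at least `μ₋ C(a) |ξ|²`: for `μ = 1` the eigenvalues are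
`Â(ξ + 2πn)`, and `|ξ + 2πn| ≥ π` unless `n = 0`. -/
lemma le_re_inner_fiberA (hd : 1 ≤ d) {ξ : Rd d} (hξ : ‖ξ‖ ≤ 1) (u : L2cell d) :
    c.muMinus * c.Ca * ‖ξ‖ ^ 2 * ‖u‖ ^ 2 ≤ (inner ℂ u (c.fiberA ξ u)).re := by
  refine le_trans ?_ (c.muMinus_mul_flat_le ξ u)
  rw [mul_assoc, mul_assoc]
  refine mul_le_mul_of_nonneg_left ?_ c.muMinus_pos.le
  rw [← mul_assoc]
  refine le_re_inner_of_diagonal (fourierBasis d) (c.flat.fiberA_symm ξ)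
    (c.flat_fiberA_fourierBasis ξ) fun n _ => ?_
  by_cases hn : n = 0
  · subst hn
    rw [latt_zero, smul_zero, add_zero]
    exact c.Ca_mul_le_Ahat hd hξ
  · exact (c.Ca_mul_le_calA_pi hd hξ).trans (c.calA_le (pi_le_norm_add hξ hn))

/-- The spectral gap of `𝔸(0)` in the sense of quadratic forms. -/
lemma le_re_inner_fiberA_zero {u : L2cell d} (hu : inner ℂ (oneCell d) u = 0) :
    c.muMinus * c.calA Real.pi * ‖u‖ ^ 2 ≤ (inner ℂ u (c.fiberA 0 u)).re := by
  refine le_trans ?_ (c.muMinus_mul_flat_le 0 u)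
  rw [mul_assoc]
  refine mul_le_mul_of_nonneg_left ?_ c.muMinus_pos.le
  refine le_re_inner_of_diagonal (fourierBasis d) (c.flat.fiberA_symm 0)
    (c.flat_fiberA_fourierBasis 0) fun n hn => ?_
  have hn0 : n ≠ 0 := by
    rintro rfl
    rw [fourierBasis_zero] at hn
    exact hn hu
  exact c.calA_le (pi_le_norm_add (by simp) hn0)

end Coefficients

end NonlocalHom

/-! ### The fiber operators near the origin -/

namespace NonlocalHom

variable {d : ℕ}

namespace Coefficients

variable (c : Coefficients d)

lemma fiberA_zero_oneCell : c.fiberA 0 (oneCell d) = 0 := by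
  refine ext_inner_left ℂ fun v => ?_
  rw [inner_zero_right, c.inner_fiberA]
  refine integral_eq_zero_of_ae ?_
  filter_upwards [c.ae_nu_fst oneCell_ae, c.ae_nu_snd oneCell_ae] with z h1 h2
  simp [twistDiff, h1, h2, phase_zero]

lemma abs_inner_sub_le (ξ : Rd d) (z : Rd d × Rd d) :
    |(inner ℝ ξ (z.1 - z.2) : ℝ)| ≤ ‖ξ‖ * ‖z.1 - z.2‖ := abs_real_inner_le_norm _ _

lemma norm_le_of_norm_inner_le {H : Type*} [NormedAddCommGroup H] [InnerProductSpace ℂ H] {x : H}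
    {K : ℝ} (h : ‖inner ℂ x x‖ ≤ K * ‖x‖) (hK : 0 ≤ K) : ‖x‖ ≤ K := by
  rw [inner_self_eq_norm_sq_to_K] at h
  simp only [norm_pow, Complex.coe_algebraMap, Complex.norm_real, norm_norm] at h
  have := norm_le_div_of_mul_sq_le (z := x) one_pos hK (by simpa using h)
  simpa using this

/-- The fiber operators depend on the quasimomentum in a Lipschitz way. -/
lemma norm_fiberA_sub_le (hd : 1 ≤ d) (ξ : Rd d) :
    ‖c.fiberA ξ - c.fiberA 0‖ ≤ c.muPlus * c.M 1 * ‖ξ‖ := by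
  have hμ := c.muPlus_pos
  have hM := c.M_pos hd (k := 1) (by norm_num)
  refine ContinuousLinearMap.opNorm_le_bound _ (by positivity) fun u => ?_
  refine norm_le_of_norm_inner_le ?_ (by positivity)
  set v := (c.fiberA ξ - c.fiberA 0) u with hv
  have hkey : inner ℂ v v =
      ∫ z, (starRingEnd ℂ) (v z.1) * ((1 - phase ξ z) * u (fracPt z.2)) ∂c.nu := by
    have h : inner ℂ v v = inner ℂ v (c.fiberA ξ u) - inner ℂ v (c.fiberA 0 u) := by
      rw [← inner_sub_right]; rfl
    rw [h, c.inner_fiberA, c.inner_fiberA, ← integral_sub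
      (c.integrable_conj_mul (c.memLp_fst v) (c.memLp_twistDiff ξ u))
      (c.integrable_conj_mul (c.memLp_fst v) (c.memLp_twistDiff 0 u))]
    refine integral_congr_ae (.of_forall fun z => ?_)
    simp only [twistDiff, phase_zero]
    ring
  rw [hkey]
  refine (c.norm_integral_nu_le (k := 1) (by norm_num) v u (C := ‖ξ‖) (norm_nonneg _)
    (.of_forall fun z => ?_)).trans_eq (by ring)
  rw [norm_mul, norm_mul, RCLike.norm_conj, pow_one]
  have h1 : ‖1 - phase ξ z‖ ≤ ‖ξ‖ * ‖z.1 - z.2‖ := by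
    rw [norm_sub_rev]
    exact (norm_exp_neg_I_mul_sub_one_le _).trans (abs_inner_sub_le ξ z)
  calc ‖v z.1‖ * (‖1 - phase ξ z‖ * ‖u (fracPt z.2)‖)
      ≤ ‖v z.1‖ * (‖ξ‖ * ‖z.1 - z.2‖ * ‖u (fracPt z.2)‖) := by gcongr
    _ = _ := by ring

lemma exists_orthogonal_oneCell (hd : 1 ≤ d) : ∃ v, inner ℂ (oneCell d) v = 0 ∧ v ≠ 0 := by
  have hn : (Pi.single ⟨0, hd⟩ 1 : Fin d → ℤ) ≠ 0 := by
    intro h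
    have := congrFun h ⟨0, hd⟩
    simp at this
  refine ⟨fourierBasis d (Pi.single ⟨0, hd⟩ 1), ?_, ?_⟩
  · rw [← fourierBasis_zero]
    exact (fourierBasis d).orthonormal.2 hn.symm
  · exact (fourierBasis d).orthonormal.ne_zero _

lemma gap_pos (hd : 1 ≤ d) : 0 < c.muMinus * c.calA Real.pi :=
  mul_pos c.muMinus_pos (c.calA_pos hd Real.pi_pos)

lemma gap_le_d0 (hd : 1 ≤ d) : c.muMinus * c.calA Real.pi ≤ c.d0 :=
  le_infDist_spectrum (c.fiberA_symm 0) norm_oneCell c.fiberA_zero_oneCell (c.gap_pos hd)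
    (fun _ hu => c.le_re_inner_fiberA_zero hu) (exists_orthogonal_oneCell hd)

lemma d0_pos (hd : 1 ≤ d) : 0 < c.d0 := (c.gap_pos hd).trans_le (c.gap_le_d0 hd)

lemma d0_mul_le (hd : 1 ≤ d) {u : L2cell d} (hu : inner ℂ (oneCell d) u = 0) :
    c.d0 * ‖u‖ ^ 2 ≤ (inner ℂ u (c.fiberA 0 u)).re :=
  infDist_spectrum_mul_le (c.fiberA_symm 0) norm_oneCell c.fiberA_zero_oneCell (c.gap_pos hd)
    (fun _ hu => c.le_re_inner_fiberA_zero hu) (exists_orthogonal_oneCell hd) hu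

lemma norm_le_one_of_le_delta0 {ξ : Rd d} (hξ : ‖ξ‖ ≤ c.delta0) : ‖ξ‖ ≤ 1 :=
  hξ.trans (min_le_left _ _)

/-- The threshold `δ₀` is such that the perturbation `𝔸(ξ) - 𝔸(0)` does not exceed a sixth of the
spectral gap. -/
lemma lipschitz_le_d0 (hd : 1 ≤ d) {ξ : Rd d} (hξ : ‖ξ‖ ≤ c.delta0) :
    c.muPlus * c.M 1 * ‖ξ‖ ≤ c.d0 / 6 := by
  have hμ := c.muPlus_pos
  have hM := c.M_pos hd (k := 1) (by norm_num)
  have hg := c.gap_pos hd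
  have h1 := hξ.trans (min_le_right _ _)
  have h2 : (2 : ℝ) ≤ 2 ^ d := by
    calc (2 : ℝ) = 2 ^ 1 := by norm_num
      _ ≤ 2 ^ d := by gcongr; norm_num
  have h3 : ((2 : ℝ) ^ d)⁻¹ ≤ 2⁻¹ := by gcongr
  calc c.muPlus * c.M 1 * ‖ξ‖ ≤ c.muPlus * c.M 1 *
        (3⁻¹ * (2 ^ d)⁻¹ * (c.M 1)⁻¹ * c.muPlus⁻¹ * c.muMinus * c.calA Real.pi) := by gcongr
    _ = 3⁻¹ * (2 ^ d)⁻¹ * (c.muMinus * c.calA Real.pi) := by field_simp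
    _ ≤ 3⁻¹ * 2⁻¹ * c.d0 := by
        gcongr
        exact c.gap_le_d0 hd
    _ = c.d0 / 6 := by ring

/-- On the complement of the constants the operators `𝔸(ξ)` keep most of the spectral gap. -/
lemma five_sixths_d0_mul_le (hd : 1 ≤ d) {ξ : Rd d} (hξ : ‖ξ‖ ≤ c.delta0) {u : L2cell d}
    (hu : inner ℂ (oneCell d) u = 0) :
    5 / 6 * c.d0 * ‖u‖ ^ 2 ≤ (inner ℂ u (c.fiberA ξ u)).re := by
  have h1 := c.d0_mul_le hd hu
  have h2 : |(inner ℂ u ((c.fiberA ξ - c.fiberA 0) u)).re| ≤ c.d0 / 6 * ‖u‖ ^ 2 := by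
    refine (Complex.abs_re_le_norm _).trans ((norm_inner_le_norm _ _).trans ?_)
    have h3 : ‖(c.fiberA ξ - c.fiberA 0) u‖ ≤ c.d0 / 6 * ‖u‖ :=
      ((c.fiberA ξ - c.fiberA 0).le_opNorm u).trans
        (mul_le_mul_of_nonneg_right ((c.norm_fiberA_sub_le hd ξ).trans (c.lipschitz_le_d0 hd hξ))
          (norm_nonneg u))
    calc ‖u‖ * ‖(c.fiberA ξ - c.fiberA 0) u‖ ≤ ‖u‖ * (c.d0 / 6 * ‖u‖) := by gcongr
      _ = _ := by ring
  rw [sub_apply, inner_sub_right, Complex.sub_re] at h2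
  have := (abs_le.1 h2).1
  linarith

/-! ### The cell problems -/

lemma measurable_coord_sub (j : Fin d) : Measurable fun z : Rd d × Rd d => z.1 j - z.2 j := by
  fun_prop

lemma abs_coord_le (j : Fin d) (z : Rd d × Rd d) : |z.1 j - z.2 j| ≤ ‖z.1 - z.2‖ :=
  PiLp.norm_apply_le (z.1 - z.2) j

lemma integrable_conj_mul_coord (v : L2cell d) (j : Fin d) :
    Integrable (fun z => (starRingEnd ℂ) (v z.1) * ((z.1 j - z.2 j : ℝ) : ℂ)) c.nu := by
  refine c.integrable_nu_of_le (k := 1) (by norm_num) v (oneCell d) zero_le_one ?_ ?_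
  · exact ((Complex.continuous_conj.measurable.comp (measurable_fst_comp v)).mul
      (Complex.measurable_ofReal.comp (measurable_coord_sub j))).aestronglyMeasurable
  · filter_upwards [c.ae_nu_snd oneCell_ae] with z hz
    rw [hz, norm_mul, RCLike.norm_conj, Complex.norm_real, norm_one, mul_one, one_mul, pow_one,
      mul_comm]
    exact mul_le_mul_of_nonneg_right (abs_coord_le j z) (norm_nonneg _)

lemma integrable_coord (j : Fin d) :
    Integrable (fun z => ((z.1 j - z.2 j : ℝ) : ℂ)) c.nu := by
  refine (c.integrable_conj_mul_coord (oneCell d) j).congr ?_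
  filter_upwards [c.ae_nu_fst oneCell_ae] with z hz
  rw [hz, map_one, one_mul]

/-- The right-hand side `∫ a(x-y) μ(x,y) (x_j - y_j) dy` of the cell problem. -/
noncomputable def cellSource (j : Fin d) (x : Rd d) : ℂ :=
  ∫ y, (c.density (x, y) : ℂ) * ((x j - y j : ℝ) : ℂ)

lemma cellSource_eq (j : Fin d) (x : Rd d) :
    c.cellSource j x = ((∫ y, c.a (x - y) * c.mu x y * (x j - y j) : ℝ) : ℂ) := by
  rw [cellSource, ← integral_complex_ofReal]
  refine integral_congr_ae (.of_forall fun y => ?_)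
  simp [density]

lemma memLp_cellSource (j : Fin d) : MemLp (c.cellSource j) 2 (cellMeasure d) := by
  have hint := c.integrable_nu_iff.1 (c.integrable_coord j)
  refine MemLp.of_bound (C := c.muPlus * c.M 1) hint.1.integral_prod_right' ?_
  have hden := Measure.ae_ae_of_ae_prod c.density_le
  have hnn := Measure.ae_ae_of_ae_prod c.density_nonneg
  filter_upwards [hden, hnn] with x h1 h2
  rw [M, ← integral_const_mul, ← integral_sub_left_eq_self (fun z => c.muPlus * (‖z‖ ^ 1 * c.a z))
    volume x]
  refine norm_integral_le_of_norm_le ?_ ?_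
  · exact ((c.norm_pow_mul_integrable (k := 1) (by norm_num)).const_mul c.muPlus).comp_sub_left x
  · filter_upwards [h1, h2] with y hy hy0
    rw [norm_mul, Complex.norm_real, Complex.norm_real, Real.norm_of_nonneg hy0]
    calc c.density (x, y) * ‖x j - y j‖ ≤ (c.muPlus * c.a (x - y)) * ‖x - y‖ := by
          gcongr
          · exact hy0.trans hy
          · exact abs_coord_le j (x, y)
      _ = _ := by ring

lemma inner_cellSource (j : Fin d) (w : L2cell d) :
    inner ℂ w ((c.memLp_cellSource j).toLp _) =
      ∫ z, (starRingEnd ℂ) (w z.1) * ((z.1 j - z.2 j : ℝ) : ℂ) ∂c.nu := by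
  rw [L2.inner_def, c.integral_nu_eq (c.integrable_conj_mul_coord w j)]
  refine integral_congr_ae ?_
  filter_upwards [(c.memLp_cellSource j).coeFn_toLp] with x hx
  rw [RCLike.inner_apply', hx, cellSource, ← integral_const_mul]
  refine integral_congr_ae (.of_forall fun y => ?_)
  ring

lemma integral_coord_eq_zero (j : Fin d) : ∫ z, ((z.1 j - z.2 j : ℝ) : ℂ) ∂c.nu = 0 := by
  have h := c.integral_comp_swapPt (c.integrable_coord j).1
  have h2 : ∀ z : Rd d × Rd d, (((swapPt z).1 j - (swapPt z).2 j : ℝ) : ℂ) =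
      -((z.1 j - z.2 j : ℝ) : ℂ) := fun z => by
    have := congrArg (fun w : Rd d => w j) (swapPt_sub z)
    simp only [PiLp.sub_apply, PiLp.neg_apply] at this
    rw [this]; push_cast; ring
  simp only [h2] at h
  rw [integral_neg] at h
  exact self_eq_neg.1 h.symm

/-- The action of `𝔸(0)`, which is the left-hand side of the cell problem; the integrability
allows real parts to be taken under the integral. -/
lemma fiberA_zero_apply_ae (u : L2cell d) :
    ∀ᵐ x ∂(cellMeasure d), Integrable (fun y => (c.density (x, y) : ℂ) * (u x - u (fracPt y))) ∧
      c.fiberA 0 u x = ∫ y, (c.density (x, y) : ℂ) * (u x - u (fracPt y)) := by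
  filter_upwards [c.fiberA_apply_ae 0 u,
    c.integrable_density_mul_ae ((c.memLp_twistDiff 0 u).integrable one_le_two)] with x h1 h2
  simp only [twistDiff, phase_zero, one_mul] at h1 h2
  exact ⟨h2, h1⟩

/-- A solution of the cell problem as an element of the complex space `L₂(Ω)`. -/
noncomputable def cellLp {j : Fin d} {v : Rd d → ℝ} (hv : c.IsCellSolution j v) : L2cell d :=
  hv.memLp.ofReal.toLp _

variable {c}

lemma cellLp_ae {j : Fin d} {v : Rd d → ℝ} (hv : c.IsCellSolution j v) :
    c.cellLp hv =ᵐ[cellMeasure d] fun x => (v x : ℂ) := hv.memLp.ofReal.coeFn_toLp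

lemma cellLp_orth {j : Fin d} {v : Rd d → ℝ} (hv : c.IsCellSolution j v) :
    inner ℂ (oneCell d) (c.cellLp hv) = 0 := by
  rw [L2.inner_def]
  have : ∫ x, inner ℂ (oneCell d x) (c.cellLp hv x) ∂(cellMeasure d) =
      ∫ x, (v x : ℂ) ∂(cellMeasure d) := by
    refine integral_congr_ae ?_
    filter_upwards [oneCell_ae, cellLp_ae hv] with x h1 h2
    rw [h1, h2, RCLike.inner_apply', map_one, one_mul]
  rw [this, integral_complex_ofReal, hv.mean_zero, Complex.ofReal_zero]

lemma fiberA_zero_cellLp {j : Fin d} {v : Rd d → ℝ} (hv : c.IsCellSolution j v) :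
    c.fiberA 0 (c.cellLp hv) = (c.memLp_cellSource j).toLp _ := by
  refine Lp.ext ?_
  have hfrac : ∀ᵐ y : Rd d, c.cellLp hv (fracPt y) = (v (fracPt y) : ℂ) :=
    quasiMeasurePreserving_fracPt.ae (cellLp_ae hv)
  filter_upwards [c.fiberA_zero_apply_ae (c.cellLp hv), (c.memLp_cellSource j).coeFn_toLp,
    hv.equation, cellLp_ae hv] with x h1 h2 h3 h4
  rw [h1.2, h2, cellSource_eq, ← h3, ← integral_complex_ofReal]
  refine integral_congr_ae ?_
  filter_upwards [hfrac] with y hy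
  rw [hy, h4, apply_fracPt hv.periodic]
  simp [density]

lemma IsCellSolution.ae_eq (hd : 1 ≤ d) {j : Fin d} {v v' : Rd d → ℝ}
    (hv : c.IsCellSolution j v) (hv' : c.IsCellSolution j v') : v' =ᵐ[volume] v := by
  have h0 : c.cellLp hv' - c.cellLp hv = 0 := by
    have h1 := c.d0_mul_le hd (u := c.cellLp hv' - c.cellLp hv)
      (by rw [inner_sub_right, cellLp_orth, cellLp_orth, sub_zero])
    rw [map_sub, fiberA_zero_cellLp, fiberA_zero_cellLp, sub_self, inner_zero_right,
      Complex.zero_re] at h1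
    have h2 := c.d0_pos hd
    have h3 : ‖c.cellLp hv' - c.cellLp hv‖ ^ 2 ≤ 0 := by
      by_contra! h
      have := mul_pos h2 h
      linarith
    exact norm_eq_zero.1 (pow_eq_zero_iff two_ne_zero |>.1 (le_antisymm h3 (sq_nonneg _)))
  have h1 : ∀ᵐ x ∂(cellMeasure d), v' x = v x := by
    have e := sub_eq_zero.1 h0
    filter_upwards [cellLp_ae hv, cellLp_ae hv'] with x h1 h2
    rw [e, h1] at h2
    exact_mod_cast h2.symm
  filter_upwards [quasiMeasurePreserving_fracPt.ae h1] with x hx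
  rwa [apply_fracPt hv.periodic, apply_fracPt hv'.periodic] at hx

/-- The equation `A u = f` is solvable for `f` orthogonal to the kernel vector. -/
lemma exists_orthogonal_solution {H : Type*} [NormedAddCommGroup H] [InnerProductSpace ℂ H]
    [CompleteSpace H] {A : H →L[ℂ] H} {e : H} {γ : ℝ}
    (hsym : ∀ x y, inner ℂ (A x) y = inner ℂ x (A y)) (he : ‖e‖ = 1) (hAe : A e = 0) (hγ : 0 < γ)
    (hA : ∀ u, inner ℂ e u = 0 → γ * ‖u‖ ^ 2 ≤ (inner ℂ u (A u)).re) {f : H}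
    (hf : inner ℂ e f = 0) : ∃ u, inner ℂ e u = 0 ∧ A u = f := by
  obtain ⟨U, hU⟩ := isUnit_of_coercive hγ (re_inner_add_smul_proj hsym he hAe γ hA le_rfl)
  set u := (↑U⁻¹ : H →L[ℂ] H) f with hu
  have h1 : (A + (γ : ℂ) • rankOneProj e) u = f := by
    rw [← hU, hu, ← mul_apply_eq_comp, Units.mul_inv]; rfl
  have h2 : inner ℂ e u = 0 := by
    have h3 := congrArg (inner ℂ e) h1
    rw [hf, add_apply, inner_add_right, ← hsym, hAe, inner_zero_left, zero_add, smul_apply,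
      rankOneProj_apply, inner_smul_right, inner_smul_right, inner_unit_self he, mul_one] at h3
    exact (mul_eq_zero.1 h3).resolve_left (by exact_mod_cast hγ.ne')
  refine ⟨u, h2, ?_⟩
  rw [add_apply, smul_apply, rankOneProj_apply, h2, zero_smul, smul_zero, add_zero] at h1
  exact h1

lemma exists_isCellSolution (hd : 1 ≤ d) (j : Fin d) : ∃ v, c.IsCellSolution j v := by
  obtain ⟨u, hu, hAu⟩ := exists_orthogonal_solution (c.fiberA_symm 0) norm_oneCell
    c.fiberA_zero_oneCell (c.gap_pos hd) (fun _ hu => c.le_re_inner_fiberA_zero hu)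
    (f := (c.memLp_cellSource j).toLp _) (by
      rw [c.inner_cellSource, ← c.integral_coord_eq_zero j]
      refine integral_congr_ae ?_
      filter_upwards [c.ae_nu_fst oneCell_ae] with z hz
      rw [hz, map_one, one_mul])
  have hcell : ∀ᵐ x ∂(cellMeasure d), (u (fracPt x)).re = (u x).re := by
    filter_upwards [ae_restrict_mem (measurableSet_cell d)] with x hx
    rw [fracPt_of_mem hx]
  refine ⟨fun x => (u (fracPt x)).re, ⟨fun n x => by rw [fracPt_add_latt], ?_, ?_, ?_⟩⟩
  · exact (Lp.memLp u).re.ae_eq (by filter_upwards [hcell] with x hx; rw [hx]; rfl)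
  · filter_upwards [c.fiberA_zero_apply_ae u, (c.memLp_cellSource j).coeFn_toLp, hcell]
      with x h1 h2 h3
    have h4 := h1.2
    rw [hAu, h2, cellSource_eq] at h4
    have h5 := congrArg Complex.re h4
    have h6 := integral_re h1.1
    simp only [RCLike.re_eq_complex_re] at h6
    rw [← h6, Complex.ofReal_re] at h5
    rw [h5]
    refine integral_congr_ae (.of_forall fun y => ?_)
    simp only [h3, Complex.re_ofReal_mul, Complex.sub_re, density]
  · have h1 : ∫ x in cell d, (u (fracPt x)).re = ∫ x in cell d, (u x).re := integral_congr_ae hcell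
    have h2 := integral_re ((Lp.memLp u).integrable one_le_two)
    simp only [RCLike.re_eq_complex_re] at h2
    rw [h1, h2]
    rw [L2.inner_def] at hu
    have h3 : ∫ x, inner ℂ (oneCell d x) (u x) ∂(cellMeasure d) = ∫ x, u x ∂(cellMeasure d) := by
      refine integral_congr_ae ?_
      filter_upwards [oneCell_ae] with x hx
      rw [hx, RCLike.inner_apply', map_one, one_mul]
    rw [← h3, hu, Complex.zero_re]

end Coefficients

end NonlocalHom

/-! ### The effective form -/

namespace NonlocalHom

variable {d : ℕ}

namespace Coefficients

variable {c : Coefficients d} {v : Fin d → Rd d → ℝ}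

/-- The combination `∑ ξ_j v_j` of the solutions of the cell problems. -/
noncomputable def corrector (hv : ∀ j, c.IsCellSolution j (v j)) (ξ : Rd d) : L2cell d :=
  ∑ j, (ξ j : ℂ) • c.cellLp (hv j)

lemma corrector_orth (hv : ∀ j, c.IsCellSolution j (v j)) (ξ : Rd d) :
    inner ℂ (oneCell d) (corrector hv ξ) = 0 := by
  rw [corrector, inner_sum]
  refine Finset.sum_eq_zero fun j _ => ?_
  rw [inner_smul_right, cellLp_orth, mul_zero]

lemma inner_eq_sum (ξ w : Rd d) : (inner ℝ ξ w : ℝ) = ∑ j, ξ j * w j := by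
  simp [PiLp.inner_apply, mul_comm]

lemma inner_fiberA_zero_corrector (hv : ∀ j, c.IsCellSolution j (v j)) (ξ : Rd d)
    (w : L2cell d) : inner ℂ w (c.fiberA 0 (corrector hv ξ)) =
      ∫ z, (starRingEnd ℂ) (w z.1) * ((inner ℝ ξ (z.1 - z.2) : ℝ) : ℂ) ∂c.nu := by
  rw [corrector, map_sum, inner_sum]
  have h1 : ∀ j, inner ℂ w (c.fiberA 0 ((ξ j : ℂ) • c.cellLp (hv j))) =
      ∫ z, (ξ j : ℂ) * ((starRingEnd ℂ) (w z.1) * ((z.1 j - z.2 j : ℝ) : ℂ)) ∂c.nu := fun j => by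
    rw [map_smul, inner_smul_right, fiberA_zero_cellLp, c.inner_cellSource, integral_const_mul]
  simp only [h1]
  rw [← integral_finsetSum _ fun j _ => (c.integrable_conj_mul_coord w j).const_mul _]
  refine integral_congr_ae (.of_forall fun z => ?_)
  simp only [inner_eq_sum, PiLp.sub_apply]
  push_cast
  rw [Finset.mul_sum]
  refine Finset.sum_congr rfl fun j _ => ?_
  ring

lemma norm_fiberA_zero_corrector_le (hd : 1 ≤ d) (hv : ∀ j, c.IsCellSolution j (v j)) (ξ : Rd d) :
    ‖c.fiberA 0 (corrector hv ξ)‖ ≤ c.muPlus * c.M 1 * ‖ξ‖ := by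
  have hμ := c.muPlus_pos
  have hM := c.M_pos hd (k := 1) (by norm_num)
  refine norm_le_of_norm_inner_le ?_ (by positivity)
  rw [inner_fiberA_zero_corrector]
  refine (c.norm_integral_nu_le (k := 1) (by norm_num) (c.fiberA 0 (corrector hv ξ)) (oneCell d)
    (C := ‖ξ‖) (norm_nonneg _) ?_).trans_eq (by rw [norm_oneCell]; ring)
  filter_upwards [c.ae_nu_snd oneCell_ae] with z hz
  rw [hz, norm_mul, RCLike.norm_conj, Complex.norm_real, norm_one, mul_one, pow_one, mul_comm]
  exact mul_le_mul_of_nonneg_right (abs_inner_sub_le ξ z) (norm_nonneg _)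

/-- First-order expansion of `𝔸(ξ) 𝟏`. -/
lemma norm_inner_fiberA_oneCell_sub_le (hv : ∀ j, c.IsCellSolution j (v j))
    (ξ : Rd d) (w : L2cell d) :
    ‖inner ℂ w (c.fiberA ξ (oneCell d) - c.fiberA 0 (Complex.I • corrector hv ξ))‖ ≤
      c.muPlus * c.M 2 * ‖ξ‖ ^ 2 * ‖w‖ := by
  have hint : Integrable (fun z => (starRingEnd ℂ) (w z.1) *
      ((inner ℝ ξ (z.1 - z.2) : ℝ) : ℂ)) c.nu := by
    refine c.integrable_nu_of_le (k := 1) (by norm_num) w (oneCell d) (norm_nonneg ξ) ?_ ?_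
    · exact ((Complex.continuous_conj.measurable.comp (measurable_fst_comp w)).mul
        (Complex.measurable_ofReal.comp (by fun_prop))).aestronglyMeasurable
    · filter_upwards [c.ae_nu_snd oneCell_ae] with z hz
      rw [hz, norm_mul, RCLike.norm_conj, Complex.norm_real, norm_one, mul_one, pow_one, mul_comm]
      exact mul_le_mul_of_nonneg_right (abs_inner_sub_le ξ z) (norm_nonneg _)
  rw [inner_sub_right, map_smul, inner_smul_right, inner_fiberA_zero_corrector, c.inner_fiberA,
    ← integral_const_mul, ← integral_sub
      (c.integrable_conj_mul (c.memLp_fst w) (c.memLp_twistDiff ξ _)) (hint.const_mul _)]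
  refine (c.norm_integral_nu_le (k := 2) (by norm_num) w (oneCell d) (C := ‖ξ‖ ^ 2) (by positivity)
    ?_).trans_eq (by rw [norm_oneCell]; ring)
  filter_upwards [c.ae_nu_fst oneCell_ae, c.ae_nu_snd oneCell_ae] with z h1 h2
  have e : (starRingEnd ℂ) (w z.1) * twistDiff ξ (oneCell d) z -
      Complex.I * ((starRingEnd ℂ) (w z.1) * ((inner ℝ ξ (z.1 - z.2) : ℝ) : ℂ)) =
      (starRingEnd ℂ) (w z.1) * (1 - Complex.exp (-Complex.I * (inner ℝ ξ (z.1 - z.2) : ℝ)) -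
        Complex.I * (inner ℝ ξ (z.1 - z.2) : ℝ)) := by
    rw [twistDiff, h1, h2, phase]; ring
  rw [e, h2, norm_mul, RCLike.norm_conj, norm_one, mul_one, mul_comm]
  refine mul_le_mul_of_nonneg_right ?_ (norm_nonneg _)
  refine (norm_one_sub_exp_sub_le _).trans ?_
  rw [← sq_abs, ← mul_pow]
  exact pow_le_pow_left₀ (abs_nonneg _) (abs_inner_sub_le ξ z) 2

variable (c) in
/-- The leading term of `⟪𝟏, 𝔸(ξ) 𝟏⟫`. -/
noncomputable def leadingForm (ξ : Rd d) : ℝ :=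
  1 / 2 * ∫ z, (inner ℝ ξ (z.1 - z.2) : ℝ) ^ 2 ∂c.nu

lemma integrable_coord_mul_coord (i j : Fin d) :
    Integrable (fun z => (z.1 i - z.2 i) * (z.1 j - z.2 j)) c.nu := by
  refine c.integrable_nu_of_le (k := 2) (by norm_num) (oneCell d) (oneCell d) zero_le_one
    (by fun_prop) ?_
  filter_upwards [c.ae_nu_fst oneCell_ae, c.ae_nu_snd oneCell_ae] with z h1 h2
  rw [h1, h2, norm_mul, norm_one, mul_one, mul_one, one_mul, sq]
  exact mul_le_mul (abs_coord_le i z) (abs_coord_le j z) (abs_nonneg _) (norm_nonneg _)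

lemma inner_sq_eq_sum (ξ w : Rd d) :
    (inner ℝ ξ w : ℝ) ^ 2 = ∑ i, ∑ j, ξ i * ξ j * (w i * w j) := by
  rw [inner_eq_sum, sq, Finset.sum_mul_sum]
  refine Finset.sum_congr rfl fun i _ => Finset.sum_congr rfl fun j _ => ?_
  ring

lemma integrable_inner_sq (ξ : Rd d) :
    Integrable (fun z => (inner ℝ ξ (z.1 - z.2) : ℝ) ^ 2) c.nu := by
  simp only [inner_sq_eq_sum]
  exact integrable_finsetSum _ fun i _ => integrable_finsetSum _ fun j _ =>
    (integrable_coord_mul_coord i j).const_mul _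

lemma leadingForm_eq_sum (ξ : Rd d) : c.leadingForm ξ =
    1 / 2 * ∑ i, ∑ j, ξ i * ξ j * ∫ z, (z.1 i - z.2 i) * (z.1 j - z.2 j) ∂c.nu := by
  rw [leadingForm]
  simp only [inner_sq_eq_sum, PiLp.sub_apply]
  rw [integral_finsetSum _ fun i _ => integrable_finsetSum _ fun j _ =>
    (integrable_coord_mul_coord i j).const_mul _]
  congr 1
  refine Finset.sum_congr rfl fun i _ => ?_
  rw [integral_finsetSum _ fun j _ => (integrable_coord_mul_coord i j).const_mul _]
  refine Finset.sum_congr rfl fun j _ => ?_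
  rw [← integral_const_mul]

/-- Second-order expansion of `⟪𝟏, 𝔸(ξ) 𝟏⟫`. -/
lemma abs_inner_oneCell_sub_le (ξ : Rd d) :
    |(inner ℂ (oneCell d) (c.fiberA ξ (oneCell d))).re - c.leadingForm ξ| ≤
      c.muPlus * c.M 3 * ‖ξ‖ ^ 3 / 6 := by
  have hcos : ∀ᵐ z ∂c.nu, 1 / 2 * ‖twistDiff ξ (oneCell d) z‖ ^ 2 =
      1 - Real.cos (inner ℝ ξ (z.1 - z.2)) := by
    filter_upwards [c.ae_nu_fst oneCell_ae, c.ae_nu_snd oneCell_ae] with z h1 h2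
    rw [twistDiff, h1, h2, phase, mul_one, exp_neg_I_mul, ← Complex.normSq_eq_norm_sq,
      Complex.normSq_apply]
    simp only [Complex.sub_re, Complex.sub_im, Complex.one_re, Complex.one_im]
    linear_combination (1 / 2) * Real.sin_sq_add_cos_sq (inner ℝ ξ (z.1 - z.2))
  have i1 := (c.memLp_twistDiff ξ (oneCell d)).integrable_norm_pow (by norm_num)
  simp only at i1
  rw [c.re_inner_fiberA, leadingForm, ← integral_const_mul, ← integral_const_mul,
    ← integral_sub (i1.const_mul _) ((integrable_inner_sq ξ).const_mul _), ← Real.norm_eq_abs]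
  refine (c.norm_integral_nu_le (k := 3) le_rfl (oneCell d) (oneCell d) (C := ‖ξ‖ ^ 3 / 6)
    (by positivity) ?_).trans_eq (by rw [norm_oneCell]; ring)
  filter_upwards [c.ae_nu_fst oneCell_ae, c.ae_nu_snd oneCell_ae, hcos] with z h1 h2 h3
  rw [h1, h2, h3, norm_one, mul_one, mul_one, Real.norm_eq_abs]
  have h4 := abs_one_sub_cos_sub_le (inner ℝ ξ (z.1 - z.2))
  calc |1 - Real.cos (inner ℝ ξ (z.1 - z.2)) - 1 / 2 * (inner ℝ ξ (z.1 - z.2) : ℝ) ^ 2|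
      = |1 - Real.cos (inner ℝ ξ (z.1 - z.2)) - (inner ℝ ξ (z.1 - z.2) : ℝ) ^ 2 / 2| := by
        congr 1; ring
    _ ≤ |(inner ℝ ξ (z.1 - z.2) : ℝ)| ^ 3 / 6 := h4
    _ ≤ (‖ξ‖ * ‖z.1 - z.2‖) ^ 3 / 6 := by gcongr; exact abs_inner_sub_le ξ z
    _ = _ := by ring

/-- The mixed moment `∫ v_i(x) (x_j - y_j) dν`. -/
noncomputable def mixedMoment (c : Coefficients d) (v : Fin d → Rd d → ℝ) (i j : Fin d) : ℝ :=
  ∫ z, v i z.1 * (z.1 j - z.2 j) ∂c.nu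

lemma integrable_mixed (hv : ∀ j, c.IsCellSolution j (v j)) (i j : Fin d) :
    Integrable (fun z => v i z.1 * (z.1 j - z.2 j)) c.nu := by
  refine (c.integrable_conj_mul_coord (c.cellLp (hv i)) j).re.congr ?_
  filter_upwards [c.ae_nu_fst (cellLp_ae (hv i))] with z hz
  rw [hz, RCLike.re_eq_complex_re, Complex.conj_ofReal, Complex.re_ofReal_mul, Complex.ofReal_re]

lemma inner_cellLp (hv : ∀ j, c.IsCellSolution j (v j)) (i j : Fin d) :
    inner ℂ (c.cellLp (hv i)) (c.fiberA 0 (c.cellLp (hv j))) = (mixedMoment c v i j : ℂ) := by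
  rw [fiberA_zero_cellLp, c.inner_cellSource, mixedMoment, ← integral_complex_ofReal]
  refine integral_congr_ae ?_
  filter_upwards [c.ae_nu_fst (cellLp_ae (hv i))] with z hz
  rw [hz, Complex.conj_ofReal]
  push_cast; ring

lemma g_eq (hv : ∀ j, c.IsCellSolution j (v j)) (i j : Fin d) :
    c.g v i j = (∫ z, (z.1 i - z.2 i) * (z.1 j - z.2 j) ∂c.nu) - mixedMoment c v j i -
      mixedMoment c v i j := by
  have i1 := integrable_coord_mul_coord (c := c) i j
  have i2 := integrable_mixed hv j i
  have i3 := integrable_mixed hv i j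
  have i12 : Integrable (fun z => (z.1 i - z.2 i) * (z.1 j - z.2 j) -
      v j z.1 * (z.1 i - z.2 i)) c.nu := i1.sub i2
  have i123 : Integrable (fun z => (z.1 i - z.2 i) * (z.1 j - z.2 j) -
      v j z.1 * (z.1 i - z.2 i) - v i z.1 * (z.1 j - z.2 j)) c.nu := i12.sub i3
  rw [mixedMoment, mixedMoment, ← integral_sub i1 i2, ← integral_sub i12 i3,
    c.integral_nu_real, integral_prod _ (c.integrable_nu_real_iff.1 i123), g]
  refine integral_congr_ae (.of_forall fun x => integral_congr_ae (.of_forall fun y => ?_))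
  simp only [density]
  ring

/-- The effective form is the leading term corrected by the form of the corrector. -/
lemma effForm_eq (hv : ∀ j, c.IsCellSolution j (v j)) (ξ : Rd d) :
    c.effForm v ξ = c.leadingForm ξ -
      (inner ℂ (c.fiberA 0 (corrector hv ξ)) (corrector hv ξ)).re := by
  have h1 : (inner ℂ (c.fiberA 0 (corrector hv ξ)) (corrector hv ξ)).re =
      ∑ i, ∑ j, ξ i * ξ j * mixedMoment c v i j := by
    rw [c.fiberA_symm, corrector, map_sum, sum_inner, Complex.re_sum]
    refine Finset.sum_congr rfl fun i _ => ?_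
    rw [inner_sum, Complex.re_sum]
    refine Finset.sum_congr rfl fun j _ => ?_
    rw [map_smul, inner_smul_left, inner_smul_right, inner_cellLp, Complex.conj_ofReal,
      ← Complex.ofReal_mul, ← Complex.ofReal_mul, Complex.ofReal_re]
    ring
  have h2 : ∑ i, ∑ j, ξ i * ξ j * mixedMoment c v j i =
      ∑ i, ∑ j, ξ i * ξ j * mixedMoment c v i j := by
    rw [Finset.sum_comm]
    refine Finset.sum_congr rfl fun i _ => Finset.sum_congr rfl fun j _ => ?_
    ring
  rw [h1, leadingForm_eq_sum, effForm]
  have h3 : ∑ i, ∑ j, c.g v i j * ξ i * ξ j =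
      ∑ i, ∑ j, ξ i * ξ j * (∫ z, (z.1 i - z.2 i) * (z.1 j - z.2 j) ∂c.nu) -
      ∑ i, ∑ j, ξ i * ξ j * mixedMoment c v j i - ∑ i, ∑ j, ξ i * ξ j * mixedMoment c v i j := by
    simp only [← Finset.sum_sub_distrib]
    refine Finset.sum_congr rfl fun i _ => Finset.sum_congr rfl fun j _ => ?_
    rw [g_eq hv]; ring
  rw [h3, h2]; ring

lemma effForm_smul (t : ℝ) (ξ : Rd d) : c.effForm v (t • ξ) = t ^ 2 * c.effForm v ξ := by
  simp only [effForm, PiLp.smul_apply, smul_eq_mul, Finset.mul_sum]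
  refine Finset.sum_congr rfl fun i _ => Finset.sum_congr rfl fun j _ => ?_
  ring

end Coefficients

end NonlocalHom

/-! ### The resolvent estimate -/

namespace NonlocalHom

variable {d : ℕ}

namespace Coefficients

variable {c : Coefficients d} {v : Fin d → Rd d → ℝ}

/-- The Schur complement of `𝔸(ξ) + τ` with respect to the constants is `effForm v ξ + τ` up to
an error of the third order. -/
lemma abs_schur_sub_effForm_le (hd : 1 ≤ d) (hv : ∀ j, c.IsCellSolution j (v j)) {ξ : Rd d}
    (hξ : ‖ξ‖ ≤ c.delta0) {τ : ℝ} (hτ : 0 < τ) (D : SchurData (c.fiberA ξ) (oneCell d) τ) :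
    |D.s - τ - c.effForm v ξ| ≤ schurError (5 / 6 * c.d0) c.d0 (c.muPlus * c.M 1 * ‖ξ‖)
      (c.muPlus * c.M 2 * ‖ξ‖ ^ 2) (c.muPlus * c.M 3 * ‖ξ‖ ^ 3 / 6) τ := by
  have hμ := c.muPlus_pos
  have hM1 := c.M_pos hd (k := 1) (by norm_num)
  have hM2 := c.M_pos hd (k := 2) (by norm_num)
  have hd0 := c.d0_pos hd
  have hI : inner ℂ (c.fiberA 0 (Complex.I • corrector hv ξ)) (Complex.I • corrector hv ξ) =
      inner ℂ (c.fiberA 0 (corrector hv ξ)) (corrector hv ξ) := by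
    rw [map_smul, inner_smul_left, inner_smul_right, ← mul_assoc, Complex.conj_I, neg_mul,
      Complex.I_mul_I, neg_neg, one_mul]
  -- `exp(-i⟨ξ, x-y⟩)` has first-order term `-i⟨ξ, x-y⟩`, hence the factor `i`
  have h := D.abs_s_sub_le (A₀ := c.fiberA 0) (V := Complex.I • corrector hv ξ)
    (g := 5 / 6 * c.d0) (dlt := c.d0) (η := c.muPlus * c.M 1 * ‖ξ‖)
    (ρ := c.muPlus * c.M 2 * ‖ξ‖ ^ 2) (θ := c.muPlus * c.M 3 * ‖ξ‖ ^ 3 / 6)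
    (α₂ := c.leadingForm ξ) norm_oneCell (c.fiberA_symm ξ)
    hτ (by positivity) hd0 (by positivity) (by positivity)
    (fun u hu => c.five_sixths_d0_mul_le hd hξ hu) (fun u hu => c.d0_mul_le hd hu)
    c.fiberA_zero_oneCell (c.norm_fiberA_sub_le hd ξ)
    (by rw [inner_smul_right, corrector_orth, mul_zero])
    (by rw [map_smul, norm_smul, Complex.norm_I, one_mul]
        exact norm_fiberA_zero_corrector_le hd hv ξ)
    (fun z _ => norm_inner_fiberA_oneCell_sub_le hv ξ z) (abs_inner_oneCell_sub_le ξ)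
  rwa [hI, ← effForm_eq] at h

lemma kappa_nonneg (hd : 1 ≤ d) (ξ : Rd d) : 0 ≤ c.muMinus * c.Ca * ‖ξ‖ ^ 2 := by
  have := c.muMinus_pos
  have := c.Ca_pos hd
  positivity

/-- The effective form inherits the lower bound of the fiber operators: at `t ξ`, with `τ = t`, all
errors are `O(t³)`, while both forms scale as `t²`, and `t → 0`. -/
lemma le_effForm (hd : 1 ≤ d) (hv : ∀ j, c.IsCellSolution j (v j)) {ξ : Rd d}
    (hξ : ‖ξ‖ ≤ c.delta0) : c.muMinus * c.Ca * ‖ξ‖ ^ 2 ≤ c.effForm v ξ := by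
  have hd0 := c.d0_pos hd
  set η := c.muPlus * c.M 1 * ‖ξ‖ with hη
  set ρ := c.muPlus * c.M 2 * ‖ξ‖ ^ 2 with hρ
  set θ := c.muPlus * c.M 3 * ‖ξ‖ ^ 3 / 6 with hθ
  set K := schurError (5 / 6 * c.d0) c.d0 η ρ θ 1 with hK
  -- the estimate at the point `t ξ`, with `τ = t`
  have key : ∀ t : ℝ, 0 < t → t ≤ 1 → c.muMinus * c.Ca * ‖ξ‖ ^ 2 ≤ c.effForm v ξ + K * t := by
    intro t ht ht1
    have hnorm : ‖t • ξ‖ = t * ‖ξ‖ := by rw [norm_smul, Real.norm_of_nonneg ht.le]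
    have htξ : ‖t • ξ‖ ≤ c.delta0 := by
      rw [hnorm]
      exact (mul_le_of_le_one_left (norm_nonneg ξ) ht1).trans hξ
    have hlow : ∀ u, c.muMinus * c.Ca * ‖t • ξ‖ ^ 2 * ‖u‖ ^ 2 ≤
        (inner ℂ u (c.fiberA (t • ξ) u)).re := fun u =>
      c.le_re_inner_fiberA hd (c.norm_le_one_of_le_delta0 htξ) u
    obtain ⟨D⟩ := exists_schurData norm_oneCell (c.fiberA_symm (t • ξ)) (kappa_nonneg hd _) hlow ht
    have h1 := D.le_s norm_oneCell (kappa_nonneg hd _) ht hlow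
    have h2 := (abs_le.1 (abs_schur_sub_effForm_le hd hv htξ ht D)).2
    rw [effForm_smul, hnorm] at h2
    rw [hnorm] at h1
    have e : schurError (5 / 6 * c.d0) c.d0 (c.muPlus * c.M 1 * (t * ‖ξ‖))
        (c.muPlus * c.M 2 * (t * ‖ξ‖) ^ 2) (c.muPlus * c.M 3 * (t * ‖ξ‖) ^ 3 / 6) t =
        t ^ 2 * (K * t) := by
      rw [hK, schurError, schurError, hη, hρ, hθ]
      ring
    rw [e] at h2
    have ht2 : 0 < t ^ 2 := by positivity
    have h3 : t ^ 2 * (c.muMinus * c.Ca * ‖ξ‖ ^ 2) ≤ t ^ 2 * (c.effForm v ξ + K * t) := by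
      nlinarith
    exact le_of_mul_le_mul_left h3 ht2
  have hlim : Filter.Tendsto (fun t : ℝ => c.effForm v ξ + K * t) (nhdsWithin 0 (Set.Ioi 0))
      (nhds (c.effForm v ξ)) := by
    have : Filter.Tendsto (fun t : ℝ => c.effForm v ξ + K * t) (nhds 0)
        (nhds (c.effForm v ξ + K * 0)) := (by fun_prop : Continuous fun t : ℝ =>
          c.effForm v ξ + K * t).tendsto 0
    rw [mul_zero, add_zero] at this
    exact this.mono_left nhdsWithin_le_nhds
  refine ge_of_tendsto hlim ?_
  filter_upwards [Ioc_mem_nhdsGT one_pos] with t ht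
  exact key t ht.1 ht.2

end Coefficients

/-- The sum of the error terms in the resolvent estimate, maximised over `X = |ξ|`.  With
`K = q² X² + ε²` each term reduces to `X / K ≤ 1 / (2 q ε)`, `X² / K ≤ 1 / q²` and `ε² / K ≤ 1`. -/
lemma error_terms_le {δ q X ε m₁ m₂ m₃ : ℝ} (hδ : 0 < δ) (hq : 0 < q) (hX : 0 ≤ X) (hε : 0 < ε)
    (h₁ : 0 ≤ m₁) (h₂ : 0 ≤ m₂) (h₃ : 0 ≤ m₃) (hX6 : m₁ * X ≤ δ / 6) :
    1 / (5 / 6 * δ + ε ^ 2) + 11 / 5 * (m₁ * X / (5 / 6 * δ)) / (q ^ 2 * X ^ 2 + ε ^ 2) +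
      schurError (5 / 6 * δ) δ (m₁ * X) (m₂ * X ^ 2) (m₃ * X ^ 3 / 6) (ε ^ 2) /
        (q ^ 2 * X ^ 2 + ε ^ 2) ^ 2 ≤
    (12 * (m₁ / δ) / q + 1 / 2 * (m₃ + 36 * (m₁ * m₂) / δ + 216 * m₁ ^ 3 / δ ^ 2) / q ^ 3 +
      (Real.sqrt (2 * δ / 3))⁻¹) * ε⁻¹ := by
  set K := q ^ 2 * X ^ 2 + ε ^ 2 with hK
  have hK0 : 0 < K := by positivity
  have hXK : X / K ≤ 1 / (2 * q * ε) := by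
    rw [div_le_div_iff₀ hK0 (by positivity)]
    nlinarith [sq_nonneg (q * X - ε)]
  have hX2K : X ^ 2 / K ≤ 1 / q ^ 2 := by
    rw [div_le_div_iff₀ hK0 (by positivity)]
    nlinarith [sq_nonneg ε]
  have hεK : ε ^ 2 / K ≤ 1 := by
    rw [div_le_one hK0]
    nlinarith [sq_nonneg (q * X)]
  have t1 : 1 / (5 / 6 * δ + ε ^ 2) ≤ (Real.sqrt (2 * δ / 3))⁻¹ * ε⁻¹ := by
    have hs : 0 < Real.sqrt (2 * δ / 3) := Real.sqrt_pos.2 (by positivity)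
    have hs2 : Real.sqrt (2 * δ / 3) ^ 2 = 2 * δ / 3 := Real.sq_sqrt (by positivity)
    rw [← mul_inv, one_div]
    refine inv_anti₀ (by positivity) ?_
    nlinarith [sq_nonneg (Real.sqrt (2 * δ / 3) - ε)]
  have t2 : 11 / 5 * (m₁ * X / (5 / 6 * δ)) / K ≤ 66 / 50 * (m₁ / δ) / q * ε⁻¹ := by
    calc 11 / 5 * (m₁ * X / (5 / 6 * δ)) / K = 66 / 25 * (m₁ / δ) * (X / K) := by
          field_simp; ring
      _ ≤ 66 / 25 * (m₁ / δ) * (1 / (2 * q * ε)) := by gcongr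
      _ = _ := by field_simp; ring
  have t3 : schurError (5 / 6 * δ) δ (m₁ * X) (m₂ * X ^ 2) (m₃ * X ^ 3 / 6) (ε ^ 2) / K ^ 2 ≤
      1 / 2 * (m₃ + 36 * (m₁ * m₂) / δ + 216 * m₁ ^ 3 / δ ^ 2) / q ^ 3 * ε⁻¹ +
        1 / 10 * (m₁ / δ) / q * ε⁻¹ := by
    have e : schurError (5 / 6 * δ) δ (m₁ * X) (m₂ * X ^ 2) (m₃ * X ^ 3 / 6) (ε ^ 2) / K ^ 2 =
        (m₃ / 6 + 12 / 5 * (m₁ * m₂) / δ + 6 / 5 * m₁ ^ 3 / δ ^ 2) * ((X / K) * (X ^ 2 / K)) +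
          6 / 5 * (m₁ / δ ^ 2) * ((m₁ * X) * (X / K) * (ε ^ 2 / K)) := by
      rw [schurError]
      field_simp
      ring
    rw [e]
    refine add_le_add ?_ ?_
    · calc (m₃ / 6 + 12 / 5 * (m₁ * m₂) / δ + 6 / 5 * m₁ ^ 3 / δ ^ 2) * ((X / K) * (X ^ 2 / K))
          ≤ (m₃ + 36 * (m₁ * m₂) / δ + 216 * m₁ ^ 3 / δ ^ 2) *
            ((1 / (2 * q * ε)) * (1 / q ^ 2)) := by
            gcongr
            · linarith
            · norm_num
            · norm_num
        _ = _ := by field_simp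
    · calc 6 / 5 * (m₁ / δ ^ 2) * ((m₁ * X) * (X / K) * (ε ^ 2 / K))
          ≤ 6 / 5 * (m₁ / δ ^ 2) * ((δ / 6) * (1 / (2 * q * ε)) * 1) := by gcongr
        _ = _ := by field_simp; ring
  have hp : 0 ≤ (m₁ / δ) / q * ε⁻¹ := by positivity
  have e1 : 66 / 50 * (m₁ / δ) / q * ε⁻¹ = 66 / 50 * ((m₁ / δ) / q * ε⁻¹) := by ring
  have e2 : 1 / 10 * (m₁ / δ) / q * ε⁻¹ = 1 / 10 * ((m₁ / δ) / q * ε⁻¹) := by ring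
  have e3 : 12 * (m₁ / δ) / q * ε⁻¹ = 12 * ((m₁ / δ) / q * ε⁻¹) := by ring
  rw [e1] at t2
  rw [e2] at t3
  rw [add_mul, add_mul, e3]
  linarith

lemma rpow_half_and_three_halves {x : ℝ} (hx : 0 ≤ x) :
    x ^ (1 / 2 : ℝ) = Real.sqrt x ∧ x ^ (3 / 2 : ℝ) = Real.sqrt x ^ 3 := by
  refine ⟨(Real.sqrt_eq_rpow x).symm, ?_⟩
  rw [Real.sqrt_eq_rpow, ← Real.rpow_natCast, ← Real.rpow_mul hx]
  norm_num

lemma rpow_neg_half {x : ℝ} (hx : 0 ≤ x) : x ^ (-(1 / 2) : ℝ) = (Real.sqrt x)⁻¹ := by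
  rw [Real.rpow_neg hx, Real.sqrt_eq_rpow]

namespace Coefficients

variable {c : Coefficients d} {v : Fin d → Rd d → ℝ}

/-- The error terms are controlled by `S`: the constants `C₁` and `C₂` carry the additional factors
`(π + 2)/π ≥ 1` and `2ᵈ`, and additional nonnegative summands. -/
lemma error_terms_le_S (hd : 1 ≤ d) :
    12 * (c.muPlus * c.M 1 / c.d0) / Real.sqrt (c.muMinus * c.Ca) +
      1 / 2 * (c.muPlus * c.M 3 + 36 * (c.muPlus * c.M 1 * (c.muPlus * c.M 2)) / c.d0 +
        216 * (c.muPlus * c.M 1) ^ 3 / c.d0 ^ 2) / Real.sqrt (c.muMinus * c.Ca) ^ 3 +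
      (Real.sqrt (2 * c.d0 / 3))⁻¹ ≤ c.S := by
  have hμ := c.muPlus_pos
  have hM1 := c.M_pos hd (k := 1) (by norm_num)
  have hM2 := c.M_pos hd (k := 2) (by norm_num)
  have hM3 := c.M_pos hd (k := 3) (by norm_num)
  have hd0 := c.d0_pos hd
  have hm : 0 < c.muMinus * c.Ca := mul_pos c.muMinus_pos (c.Ca_pos hd)
  have hsq : 0 < Real.sqrt (c.muMinus * c.Ca) := Real.sqrt_pos.2 hm
  have hpi := Real.pi_pos
  have hS : c.S = 2 * constC1 d c.muPlus (c.M 1) c.d0 / Real.sqrt (c.muMinus * c.Ca) +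
      constC2 c.muPlus (c.M 1) (c.M 2) (c.M 3) c.d0 / Real.sqrt (c.muMinus * c.Ca) ^ 3 +
      (Real.sqrt (2 * c.d0 / 3))⁻¹ := by
    rw [← rpow_neg_half (by positivity), ← (rpow_half_and_three_halves hm.le).2,
      ← (rpow_half_and_three_halves hm.le).1]
    rfl
  rw [hS]
  have h1 : 12 * (c.muPlus * c.M 1 / c.d0) ≤ 2 * constC1 d c.muPlus (c.M 1) c.d0 := by
    have hp : 1 ≤ (Real.pi + 2) * Real.pi⁻¹ := by
      rw [← div_eq_mul_inv, le_div_iff₀ hpi]; linarith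
    have h2d : (1 : ℝ) ≤ 2 ^ d := one_le_pow₀ (by norm_num)
    calc 12 * (c.muPlus * c.M 1 / c.d0) = 12 * 1 * 1 * (c.muPlus * c.M 1 / c.d0) := by ring
      _ ≤ 12 * ((Real.pi + 2) * Real.pi⁻¹) * 2 ^ d * (c.muPlus * c.M 1 / c.d0) := by gcongr
      _ = _ := by rw [constC1]; ring
  have h2 : 1 / 2 * (c.muPlus * c.M 3 + 36 * (c.muPlus * c.M 1 * (c.muPlus * c.M 2)) / c.d0 +
      216 * (c.muPlus * c.M 1) ^ 3 / c.d0 ^ 2) ≤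
      constC2 c.muPlus (c.M 1) (c.M 2) (c.M 3) c.d0 := by
    have hp : 1 / 2 ≤ (Real.pi + 2) / (2 * Real.pi) := by
      rw [div_le_div_iff₀ (by norm_num) (by positivity)]; linarith
    have e1 : 36 * (c.muPlus * c.M 1 * (c.muPlus * c.M 2)) / c.d0 =
        c.muPlus ^ 2 / c.d0 * ((3 * c.M 2 + 0) * (12 * c.M 1 + 0 + 0)) := by ring
    have e2 : 216 * (c.muPlus * c.M 1) ^ 3 / c.d0 ^ 2 =
        c.muPlus ^ 3 / c.d0 ^ 2 * (6 * c.M 1 + 0 + 0) ^ 3 := by ring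
    rw [constC2, e1, e2]
    gcongr <;> positivity
  gcongr

/-- `S` decreases as the spectral gap grows, so a lower bound for the gap gives an upper bound. -/
lemma constS_antitone {mm mp M1 M2 M3 cM Ar Ap δ δ' : ℝ} (hmp : 0 ≤ mp) (h1 : 0 ≤ M1)
    (h2 : 0 ≤ M2) (h3 : 0 ≤ M3) (hC : 0 ≤ mm * constC d cM Ar Ap) (hδ : 0 < δ) (hδδ : δ ≤ δ') :
    constS d mm mp M1 M2 M3 cM Ar Ap δ' ≤ constS d mm mp M1 M2 M3 cM Ar Ap δ := by
  have hpi := Real.pi_pos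
  have hδ' := hδ.trans_le hδδ
  rw [constS, constS, rpow_neg_half (by positivity), rpow_neg_half (by positivity), constC1,
    constC1, constC2, constC2]
  have hs : 0 < Real.sqrt (2 * δ / 3) := Real.sqrt_pos.2 (by positivity)
  gcongr

lemma norm_inverse_fiberA_sub_le (hd : 1 ≤ d) (hv : ∀ j, c.IsCellSolution j (v j)) {ξ : Rd d}
    (hξ : ‖ξ‖ ≤ c.delta0) {ε : ℝ} (hε : 0 < ε) :
    IsUnit (c.fiberA ξ + ((ε ^ 2 : ℝ) : ℂ) • 1) ∧
    ‖Ring.inverse (c.fiberA ξ + ((ε ^ 2 : ℝ) : ℂ) • 1)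
        - (((c.effForm v ξ + ε ^ 2)⁻¹ : ℝ) : ℂ) • projConst d‖ ≤ c.S * ε⁻¹ := by
  have hτ : 0 < ε ^ 2 := by positivity
  have hμ := c.muPlus_pos
  have hM1 := c.M_pos hd (k := 1) (by norm_num)
  have hM2 := c.M_pos hd (k := 2) (by norm_num)
  have hM3 := c.M_pos hd (k := 3) (by norm_num)
  have hd0 := c.d0_pos hd
  have hm : 0 < c.muMinus * c.Ca := mul_pos c.muMinus_pos (c.Ca_pos hd)
  have hκ := kappa_nonneg (c := c) hd ξ
  have hlow : ∀ u, c.muMinus * c.Ca * ‖ξ‖ ^ 2 * ‖u‖ ^ 2 ≤ (inner ℂ u (c.fiberA ξ u)).re := fun u =>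
    c.le_re_inner_fiberA hd (c.norm_le_one_of_le_delta0 hξ) u
  have hunit : IsUnit (c.fiberA ξ + ((ε ^ 2 : ℝ) : ℂ) • 1) :=
    isUnit_of_coercive (by linarith) fun u => coercive_add_smul (ε ^ 2) (hlow u)
  refine ⟨hunit, ?_⟩
  obtain ⟨D⟩ := exists_schurData norm_oneCell (c.fiberA_symm ξ) hκ hlow hτ
  have hAe : ‖c.fiberA ξ (oneCell d)‖ ≤ c.muPlus * c.M 1 * ‖ξ‖ := by
    have h := (c.fiberA ξ - c.fiberA 0).le_opNorm (oneCell d)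
    rw [sub_apply, c.fiberA_zero_oneCell, sub_zero, norm_oneCell, mul_one] at h
    exact h.trans (c.norm_fiberA_sub_le hd ξ)
  have hη6 := c.lipschitz_le_d0 hd hξ
  have hbound := error_terms_le hd0 (Real.sqrt_pos.2 hm) (norm_nonneg ξ) hε
    (by positivity : 0 ≤ c.muPlus * c.M 1) (by positivity : 0 ≤ c.muPlus * c.M 2)
    (by positivity : 0 ≤ c.muPlus * c.M 3) hη6
  rw [Real.sq_sqrt hm.le] at hbound
  have hS := mul_le_mul_of_nonneg_right (error_terms_le_S (c := c) hd) (inv_nonneg.2 hε.le)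
  have htot := hbound.trans hS
  have hSε : 0 ≤ c.S * ε⁻¹ := by
    refine le_trans ?_ htot
    rw [schurError]
    positivity
  refine ContinuousLinearMap.opNorm_le_bound _ hSε fun f => ?_
  have hu : (c.fiberA ξ + ((ε ^ 2 : ℝ) : ℂ) • 1)
      (Ring.inverse (c.fiberA ξ + ((ε ^ 2 : ℝ) : ℂ) • 1) f) = f := by
    rw [← mul_apply_eq_comp, Ring.mul_inverse_cancel _ hunit]; rfl
  have hproj : projConst d f = inner ℂ (oneCell d) f • oneCell d :=
    Submodule.starProjection_unit_singleton ℂ norm_oneCell f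
  have h := D.norm_resolvent_sub_le (κ := c.muMinus * c.Ca * ‖ξ‖ ^ 2) (g := 5 / 6 * c.d0)
    (η := c.muPlus * c.M 1 * ‖ξ‖) norm_oneCell (c.fiberA_symm ξ) hκ hτ (by positivity)
    (by positivity) hlow (fun u hu => c.five_sixths_d0_mul_le hd hξ hu) hAe (by linarith)
    (le_effForm hd hv hξ) (abs_schur_sub_effForm_le hd hv hξ hτ D) hu
  rw [sub_apply, smul_apply, hproj]
  exact h.trans (mul_le_mul_of_nonneg_right htot (norm_nonneg f))

end Coefficients

end NonlocalHom

theorem theorem2p2 {d : ℕ} (hd : 1 ≤ d) (c : NonlocalHom.Coefficients d) :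
    0 < c.delta0 ∧ 0 < c.Ca ∧ c.muMinus * c.calA Real.pi ≤ c.d0 ∧ c.S ≤ c.SBound ∧
    (∀ j : Fin d, ∃ v : NonlocalHom.Rd d → ℝ, c.IsCellSolution j v ∧
      ∀ v' : NonlocalHom.Rd d → ℝ, c.IsCellSolution j v' → v' =ᵐ[MeasureTheory.volume] v) ∧
    ∀ v : Fin d → NonlocalHom.Rd d → ℝ, (∀ j, c.IsCellSolution j (v j)) →
      ∀ ξ : NonlocalHom.Rd d, ‖ξ‖ ≤ c.delta0 → ∀ ε : ℝ, 0 < ε →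
        IsUnit (c.fiberA ξ + ((ε ^ 2 : ℝ) : ℂ) • 1) ∧
        0 < c.effForm v ξ + ε ^ 2 ∧
        ‖Ring.inverse (c.fiberA ξ + ((ε ^ 2 : ℝ) : ℂ) • 1)
            - (((c.effForm v ξ + ε ^ 2)⁻¹ : ℝ) : ℂ) • NonlocalHom.projConst d‖
          ≤ c.S * ε⁻¹ := by
  refine ⟨c.delta0_pos hd, c.Ca_pos hd, c.gap_le_d0 hd, ?_, fun j => ?_, fun v hv ξ hξ ε hε => ?_⟩
  · exact NonlocalHom.Coefficients.constS_antitone c.muPlus_pos.le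
      (c.M_pos hd (by norm_num)).le (c.M_pos hd (by norm_num)).le (c.M_pos hd (by norm_num)).le
      (mul_pos c.muMinus_pos (c.Ca_pos hd)).le (c.gap_pos hd) (c.gap_le_d0 hd)
  · obtain ⟨v, hv⟩ := NonlocalHom.Coefficients.exists_isCellSolution (c := c) hd j
    exact ⟨v, hv, fun v' hv' => hv.ae_eq hd hv'⟩
  · obtain ⟨h1, h2⟩ := NonlocalHom.Coefficients.norm_inverse_fiberA_sub_le hd hv hξ hε
    have h3 := NonlocalHom.Coefficients.le_effForm hd hv hξ
    have h4 := NonlocalHom.Coefficients.kappa_nonneg (c := c) hd ξ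
    exact ⟨h1, by linarith [sq_pos_of_pos hε], h2⟩
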